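/- Let $0<\alpha<1$, $c>0$, and let $(S_t)_{t\ge0}$ be a driftless stable subordinator of index $\alpha$ (nondecreasing and right-continuous, $S_0=0$), with Lévy measure $\Lambda(dx)=c\,\alpha x^{-\alpha-1}dx$ on $(0,\infty)$, i.e. $E e^{-\lambda S_t}=\exp\left(-t\int_0^\infty(1-e^{-\lambda x})\Lambda(dx)\right)$, $\lambda>0$. Let $\Delta S_1^{(1)}\ge\Delta S_1^{(2)}\ge\cdots$ be its ordered jumps up till time $1$. For $k\ge1$ put $J_k(i)=\Delta S_1^{(k+i)}/\Delta S_1^{(k)}$, $i\ge 1$, and ${}^{(k)}T=\sum_{i\ge1}J_k(i)$. Then each ${}^{(k)}T$, $k\ge1$, has a density with respect to Lebesgue measure; call it $g_k$. Fix an integer $r\ge1$ and let $(\tilde J_1,\tilde J_2,\dots)$ be a size-biased random permutation of $(J_r(i))_{i\ge1}$: for $n\ge0$, $\tilde J_{n+1}$ takes values in $\{J_r(j): j\ge 1\}\setminus\{\tilde J_1,\dots,\tilde J_n\}$ and, for each $j \ge 1$, $$P\left(\tilde J_{n+1}=J_r(j)\mid (J_r(i))_{i\ge1},\tilde J_1,\dots,\tilde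 J_n\right)=\frac{J_r(j)\,\mathbf 1\{J_r(j)\ne\tilde J_l,\ 1\le l\le n\}}{{}^{(r)}T-\sum_{l=1}^n\tilde J_l}\quad\text{a.s.}$$ Define ${}^{(r)}T_0={}^{(r)}T$, and for $n\ge1$, ${}^{(r)}T_n={}^{(r)}T_{n-1}-\tilde J_n$ and ${}^{(r)}U_n={}^{(r)}T_n/{}^{(r)}T_{n-1}$. Write $\Theta(x)=\alpha x^{-\alpha}\mathbf 1_{\{0<x<1\}}$ and $r^{(n)}=r(r+1)\cdots(r+n-1)$, with $r^{(0)}=1$. (i) For each $n\ge0$ the joint density of $({}^{(r)}T_0,{}^{(r)}T_1,\dots,{}^{(r)}T_n)$ with respect to Lebesgue measure is, for $t_0>t_1>\cdots>t_n>0$, $$f(t_0,\dots,t_n)=r^{(n)}g_{r+n}(t_n)\prod_{i=0}^{n-1}\frac{\Theta(t_i-t_{i+1})}{t_i},$$ and $0$ elsewhere. (ii) The sequence $({}^{(r)}T_n)_{n\ge0}$ is a Markov chain such that, for each $n\ge0$ and almost every $t_n$ with respect to the law of ${}^{(r)}T_n$, the conditional law of ${}^{(r)}T_{n+1}$ given ${}^{(r)}T_n=t_n$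 has density $$(r+n)\,\frac{\Theta(t_n-t_{n+1})}{t_n}\,\frac{g_{r+n+1}(t_{n+1})}{g_{r+n}(t_n)},\qquad 0<t_{n+1}<t_n,$$ and $0$ elsewhere. The chain is non-homogeneous: no single transition kernel serves for all steps $n$. (iii) For each $n\ge0$ the joint density of $({}^{(r)}T_n,{}^{(r)}U_1,\dots,{}^{(r)}U_n)$ is, for $t_n>0$ and $0<u_i<1$, $1\le i\le n$, with $\bar u_i=1-u_i$, $$h(t_n,u_1,\dots,u_n)=\frac{r^{(n)}}{K_n}\,g_{r+n}(t_n)\,t_n^{-n\alpha}\prod_{i=1}^n\frac{\Gamma(i\alpha+1-\alpha)}{\Gamma(i\alpha)\Gamma(1-\alpha)}\,u_i^{i\alpha-1}\,\bar u_i^{-\alpha}\,\mathbf 1_{\left\{t_n<\left(\prod_{j=i}^nu_j\right)/\bar u_i\right\}},$$ and $0$ elsewhere, where $$K_n=\frac{\prod_{i=0}^{n-1}\Gamma(1+i\alpha)}{\alpha^n\,\Gamma(1-\alpha)^n\prod_{i=1}^n\Gamma(i\alpha)}=\frac{\Gamma(n+1)}{\Gamma(1-\alpha)^n\,\Gamma(n\alpha+1)}.$$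 -/

import Mathlib

open MeasureTheory ProbabilityTheory Filter Topology
open scoped NNReal ENNReal

noncomputable section

namespace TrimmedStable

/-- The Laplace exponent `∫₀^∞ (1 - e^{-l x}) Λ(dx)` of the Lévy measure
`Λ(dx) = c α x^{-α-1} dx` on `(0, ∞)`. -/
def laplaceExponent (α c l : ℝ) : ℝ :=
  ∫ x in Set.Ioi (0 : ℝ), (1 - Real.exp (-l * x)) * (c * α * x ^ (-α - 1))

/-- `S` is a driftless stable subordinator of index `α` with Lévy measure
`c α x^{-α-1} dx` on `(0, ∞)`: a Lévy process with nondecreasing right-continuous paths (left limits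
then exist by monotonicity), and Laplace transform `E e^{-l S_t} = exp (-t ∫ (1 - e^{-l x}) Λ(dx))`. -/
structure IsStableSubordinator {Ω : Type*} [MeasurableSpace Ω] (S : ℝ≥0 → Ω → ℝ) (α c : ℝ)
    (P : Measure Ω) : Prop where
  measurable : ∀ t, Measurable (S t)
  zero : ∀ ω, S 0 ω = 0
  mono : ∀ ω, Monotone (fun t => S t ω)
  rightContinuous : ∀ ω t, ContinuousWithinAt (fun s => S s ω) (Set.Ici t) t
  indepIncrements : HasIndepIncrements S P
  stationary : ∀ s t, IdentDistrib (fun ω => S (s + t) ω - S s ω) (S t) P P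
  laplace : ∀ (t : ℝ≥0) (l : ℝ), 0 < l →
    ∫ ω, Real.exp (-l * S t ω) ∂P = Real.exp (-(t : ℝ) * laplaceExponent α c l)

/-- The jump `ΔS_t = S_t - S_{t-}` (equal to `0` at `t = 0`). -/
def jump {Ω : Type*} (S : ℝ≥0 → Ω → ℝ) (t : ℝ≥0) (ω : Ω) : ℝ :=
  S t ω - Function.leftLim (fun s => S s ω) t

/-- The `i`-th largest jump up till time 1, `i ≥ 1`, counted with multiplicity: the largest `x > 0`
such that at least `i` of the jumps in the time interval `(0, 1]` have size at least `x`. -/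
def orderedJump {Ω : Type*} (S : ℝ≥0 → Ω → ℝ) (i : ℕ) (ω : Ω) : ℝ :=
  sSup {x : ℝ | 0 < x ∧
    (i : ℕ∞) ≤ Set.encard {t : ℝ≥0 | t ∈ Set.Ioc (0 : ℝ≥0) 1 ∧ x ≤ jump S t ω}}

/-- `J_r(i) = ΔS_1^{(r+i)} / ΔS_1^{(r)}`, for `r, i ≥ 1`. -/
def jumpRatio {Ω : Type*} (S : ℝ≥0 → Ω → ℝ) (r i : ℕ) (ω : Ω) : ℝ :=
  orderedJump S (r + i) ω / orderedJump S r ω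

/-- The sum `T = ∑_{i ≥ 1} J_r(i)`. -/
def ratioSum {Ω : Type*} (S : ℝ≥0 → Ω → ℝ) (r : ℕ) (ω : Ω) : ℝ :=
  ∑' i : ℕ, jumpRatio S r (i + 1) ω

/-- The density `g_k` of the sum of the ratios `J_k(1), J_k(2), …` with respect to Lebesgue measure
(its Radon-Nikodym derivative). -/
def ratioSumDensity {Ω : Type*} [MeasurableSpace Ω] (S : ℝ≥0 → Ω → ℝ) (P : Measure Ω) (k : ℕ)
    (t : ℝ) : ℝ :=
  ((P.map (ratioSum S k)).rnDeriv volume t).toReal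

/-- The σ-algebra generated by the ratios `J_r(1), J_r(2), …` and the first `n` picks. -/
abbrev pickSigma {Ω : Type*} (S : ℝ≥0 → Ω → ℝ) (r : ℕ) (Jt : ℕ → Ω → ℝ) (n : ℕ) :
    MeasurableSpace Ω :=
  MeasurableSpace.comap
    (fun ω => ((fun i : ℕ => jumpRatio S r (i + 1) ω), (fun l : Fin n => Jt l ω))) inferInstance

open scoped Classical in
/-- The conditional probability that the next size-biased pick, after the first `n` ones,
is `J_r(j)`. -/
def pickWeight {Ω : Type*} (S : ℝ≥0 → Ω → ℝ) (r : ℕ) (Jt : ℕ → Ω → ℝ) (n j : ℕ) (ω : Ω) : ℝ :=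
  (if ∀ l < n, jumpRatio S r j ω ≠ Jt l ω then jumpRatio S r j ω else 0) /
    (ratioSum S r ω - ∑ l ∈ Finset.range n, Jt l ω)

/-- `Jt 0, Jt 1, …` is a size-biased random permutation of `J_r(1), J_r(2), …`
(`Jt n` is the pick number `n + 1`). -/
structure IsSizeBiasedPermutation {Ω : Type*} [MeasurableSpace Ω] (S : ℝ≥0 → Ω → ℝ) (r : ℕ)
    (Jt : ℕ → Ω → ℝ) (P : Measure Ω) : Prop where
  measurable : ∀ n, Measurable (Jt n)
  mem : ∀ n, ∀ᵐ ω ∂P, ∃ j, 1 ≤ j ∧ Jt n ω = jumpRatio S r j ω ∧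
    ∀ l < n, jumpRatio S r j ω ≠ Jt l ω
  condProb : ∀ n j, 1 ≤ j →
    P⟦{ω | Jt n ω = jumpRatio S r j ω} | pickSigma S r Jt n⟧ =ᵐ[P] pickWeight S r Jt n j

/-- The residual sums: `T_0 = T` and `T_{n+1} = T_n - (pick number n + 1)`. -/
def residualSum {Ω : Type*} (S : ℝ≥0 → Ω → ℝ) (r : ℕ) (Jt : ℕ → Ω → ℝ) : ℕ → Ω → ℝ
  | 0 => ratioSum S r
  | n + 1 => fun ω => residualSum S r Jt n ω - Jt n ω

/-- The residual fraction `U_n = T_n / T_{n-1}`, for `n ≥ 1`. -/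
def residualFraction {Ω : Type*} (S : ℝ≥0 → Ω → ℝ) (r : ℕ) (Jt : ℕ → Ω → ℝ) (n : ℕ) (ω : Ω) : ℝ :=
  residualSum S r Jt n ω / residualSum S r Jt (n - 1) ω

/-- `Θ(x) = α x^{-α} 1_{0 < x < 1}`. -/
def Theta (α x : ℝ) : ℝ := Set.indicator (Set.Ioo 0 1) (fun y => α * y ^ (-α)) x

/-- The function `f(t_0, …, t_n)`, for a sequence `g` of densities. -/
def densityT (α : ℝ) (g : ℕ → ℝ → ℝ) (r n : ℕ) (t : Fin (n + 1) → ℝ) : ℝ :=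
  Set.indicator {t : Fin (n + 1) → ℝ | StrictAnti t ∧ 0 < t (Fin.last n)}
    (fun t => (r.ascFactorial n : ℝ) * g (r + n) (t (Fin.last n)) *
      ∏ i : Fin n, Theta α (t i.castSucc - t i.succ) / t i.castSucc) t

/-- The transition density from `T_n = t` to `T_{n+1} = s`. -/
def transitionDensity (α : ℝ) (g : ℕ → ℝ → ℝ) (r n : ℕ) (t s : ℝ) : ℝ :=
  Set.indicator (Set.Ioo 0 t)
    (fun s => ((r : ℝ) + n) * (Theta α (t - s) / t) * (g (r + n + 1) s / g (r + n) t)) s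

/-- The constant `K_n`. -/
def constK (α : ℝ) (n : ℕ) : ℝ :=
  (∏ i ∈ Finset.range n, Real.Gamma (1 + i * α)) /
    (α ^ n * Real.Gamma (1 - α) ^ n * ∏ i ∈ Finset.Icc 1 n, Real.Gamma (i * α))

/-- The function `h(t, u_1, …, u_n)`; the coordinate `u i`, `i : Fin n`, stands for `u_{i+1}`. -/
def densityTU (α : ℝ) (g : ℕ → ℝ → ℝ) (r n : ℕ) (p : ℝ × (Fin n → ℝ)) : ℝ :=
  Set.indicator {p : ℝ × (Fin n → ℝ) | 0 < p.1 ∧ ∀ i, p.2 i ∈ Set.Ioo (0 : ℝ) 1}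
    (fun p => (r.ascFactorial n : ℝ) / constK α n * g (r + n) p.1 * p.1 ^ (-(n : ℝ) * α) *
      ∏ i : Fin n,
        (Real.Gamma (((i : ℕ) + 1 : ℝ) * α + 1 - α) /
            (Real.Gamma (((i : ℕ) + 1 : ℝ) * α) * Real.Gamma (1 - α)) *
          p.2 i ^ (((i : ℕ) + 1 : ℝ) * α - 1) * (1 - p.2 i) ^ (-α) *
          Set.indicator (Set.Iio ((∏ j ∈ Finset.Ici i, p.2 j) / (1 - p.2 i)))
            (fun _ => (1 : ℝ)) p.1)) p

/-- A real-valued (discrete time) Markov chain: the conditional law of `X (n + 1)` given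
`X 0, …, X n` is its conditional law given `X n`. -/
def IsMarkovChain {Ω : Type*} [MeasurableSpace Ω] (X : ℕ → Ω → ℝ) (P : Measure Ω) : Prop :=
  (∀ n, Measurable (X n)) ∧
  ∀ (n : ℕ) (A : Set ℝ), MeasurableSet A →
    P⟦X (n + 1) ⁻¹' A | MeasurableSpace.comap (fun ω (i : Fin (n + 1)) => X i ω) inferInstance⟧
      =ᵐ[P] P⟦X (n + 1) ⁻¹' A | MeasurableSpace.comap (X n) inferInstance⟧

/-- Time homogeneity: one and the same kernel serves as transition kernel at every step. -/
def IsTimeHomogeneous {Ω : Type*} [MeasurableSpace Ω] (X : ℕ → Ω → ℝ) (P : Measure Ω)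
    [IsFiniteMeasure P] : Prop :=
  ∃ κ : Kernel ℝ ℝ, ∀ n, ∀ᵐ t ∂(P.map (X n)), condDistrib (X (n + 1)) (X n) P t = κ t

end TrimmedStable

end

/-! Everything follows from iterating one size-biased Mecke formula.

Let Γ_1 < Γ_2 < ⋯ be the arrivals of a unit rate Poisson process. The ordered jumps are in law (Γ_i
/ c)^(-1/α), so the ratio sequence for r = m + 1 has the law `nu α m` of (Γ_{r+i} / Γ_r)^(-1/α),
from which c has disappeared. Deleting an arrival amounts to integrating over a point placed between
its two neighbours (`lintegral_arrival_skip`). Summing over the arrivals after Γ_r and rescaling by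
Γ_r produces a factor Γ_r, and weighting by Γ_r is in turn r times a shift of the arrivals by one
place (`lintegral_arrival_mul`). In the variable x = y^(-1/α) this says that E ∑_j s_j K(s_j, s
without s_j) under `nu α m` equals (m + 1) ∫ Θ(x) E K(x, s) dx with s under `nu α (m + 1)`
(`lintegral_tsum_nu`).

A size-biased pick takes s_j with probability s_j / t, where t is the current sum. One pick
therefore contributes a factor (m + 1) Θ(t - t') / t, with t' the new sum, and the remaining
sequence is governed by the law of next index. Induction gives the joint law of the residual sums
and the remaining ratios (`lintegral_residualSum_remainingSeq`), and (i) follows by integrating out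
all but the sum of the remaining ratios. The same formula shows that the sums have densities,
positive almost everywhere on (0, ∞) (`ae_sumDensity_pos`), so consecutive joint densities may be
divided, which gives (ii). A common transition kernel would make g_{r+2} proportional to g_{r+1},
hence equal to it, although the means kα/(1-α) of the g_k differ. Part (iii) is the substitution
t_{i-1} = t_i / u_i, made one coordinate at a time.

The law of the ordered jumps is obtained by comparing characteristic functionals. For the
subordinator, a sum over jumps is a limit of sums over independent stationary increments, and n
P(S_{1/n} ∈ dx) tends to Λ by the Laplace transform and the Weierstrass theorem in the variable
e^(-x). For the Poisson points, conditioning on the first arrival gives a linear differential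
equation (`charFull_zero`). Both functionals are exp ∫ (e^(if) - 1) dΛ. Counting the points above
given levels then identifies the ordered sequences (`map_orderedJump`). -/

noncomputable section

namespace TrimmedStable

/-! ### Poisson arrivals and the Mecke formula. -/

/-- The law of a sequence of independent standard exponential random variables. -/
def expSeq : Measure (ℕ → ℝ) := Measure.infinitePi (fun _ => expMeasure 1)

instance isProbabilityMeasure_expMeasure_one : IsProbabilityMeasure (expMeasure 1) :=
  isProbabilityMeasure_expMeasure one_pos

instance : IsProbabilityMeasure expSeq := by unfold expSeq; infer_instance

/-- Prepend a real number to a sequence. -/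
def seqCons (x : ℝ) (s : ℕ → ℝ) : ℕ → ℝ
  | 0 => x
  | n + 1 => s n

@[simp] lemma seqCons_zero (x : ℝ) (s : ℕ → ℝ) : seqCons x s 0 = x := rfl
@[simp] lemma seqCons_succ (x : ℝ) (s : ℕ → ℝ) (n : ℕ) : seqCons x s (n + 1) = s n := rfl

@[fun_prop]
lemma measurable_seqCons {β : Type*} [MeasurableSpace β] {f : β → ℝ} {g : β → ℕ → ℝ}
    (hf : Measurable f) (hg : Measurable g) : Measurable (fun b => seqCons (f b) (g b)) := by
  refine measurable_pi_iff.2 fun n => ?_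
  cases n with
  | zero => simpa using hf
  | succ n => simpa using (measurable_pi_iff.1 hg n)

/-- Source of every first-step argument below, through `lintegral_expSeq` and `integral_expSeq`:
conditioning on the first gap leaves an independent copy of the whole sequence. Agreement on
finite-dimensional boxes is enough. -/
lemma expSeq_eq_map : ((expMeasure 1).prod expSeq).map (fun p => seqCons p.1 p.2) = expSeq := by
  refine Measure.eq_infinitePi _ fun s t ht => ?_
  have hm : Measurable (fun p : ℝ × (ℕ → ℝ) => seqCons p.1 p.2) := by fun_prop
  rw [Measure.map_apply hm (MeasurableSet.pi s.countable_toSet fun i _ => ht i)]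
  set s' : Finset ℕ := s.preimage Nat.succ (Nat.succ_injective.injOn) with hs'
  have key : (fun p : ℝ × (ℕ → ℝ) => seqCons p.1 p.2) ⁻¹' ((s : Set ℕ).pi t) =
      (if 0 ∈ s then t 0 else Set.univ) ×ˢ ((s' : Set ℕ).pi fun n => t (n + 1)) := by
    ext p
    simp only [Set.mem_preimage, Set.mem_pi, Set.mem_prod, Finset.mem_coe]
    constructor
    · intro h
      refine ⟨?_, fun i hi => h (i + 1) (by simpa [hs'] using hi)⟩
      split_ifs with h0
      · exact h 0 h0
      · trivial
    · rintro ⟨h1, h2⟩ i hi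
      cases i with
      | zero => simpa [hi] using h1
      | succ i => exact h2 i (by simpa [hs'] using hi)
  rw [key, Measure.prod_prod, expSeq, Measure.infinitePi_pi _ (fun i _ => ht (i + 1))]
  have h1 : ∏ i ∈ s', (expMeasure 1) (t (i + 1)) =
      ∏ i ∈ s.erase 0, (expMeasure 1) (t i) := by
    refine Finset.prod_bij (fun i _ => i + 1) ?_ ?_ ?_ ?_
    · intro i hi; simpa [hs'] using hi
    · intro i _ j _ h; simpa using h
    · intro i hi
      obtain ⟨h0, hi⟩ := Finset.mem_erase.1 hi
      obtain ⟨j, rfl⟩ := Nat.exists_eq_succ_of_ne_zero h0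
      exact ⟨j, by simpa [hs'] using hi, rfl⟩
    · intro i _; rfl
  rw [h1]
  split_ifs with h0
  · rw [Finset.mul_prod_erase s (fun i => (expMeasure 1) (t i)) h0]
  · simp [Finset.erase_eq_of_notMem h0]

lemma lintegral_expSeq {F : (ℕ → ℝ) → ℝ≥0∞} (hF : Measurable F) :
    ∫⁻ e, F e ∂expSeq = ∫⁻ u, ∫⁻ e, F (seqCons u e) ∂expSeq ∂(expMeasure 1) := by
  conv_lhs => rw [← expSeq_eq_map]
  rw [lintegral_map hF (by fun_prop), lintegral_prod _ (by fun_prop)]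

lemma lintegral_expMeasure (F : ℝ → ℝ≥0∞) (hF : Measurable F) :
    ∫⁻ u, F u ∂(expMeasure 1) = ∫⁻ u in Set.Ioi 0, ENNReal.ofReal (Real.exp (-u)) * F u := by
  rw [expMeasure, gammaMeasure, lintegral_withDensity_eq_lintegral_mul _
    (by unfold gammaPDF; exact (measurable_gammaPDFReal 1 1).ennreal_ofReal) hF,
    restrict_Ioi_eq_restrict_Ici, ← lintegral_indicator measurableSet_Ici]
  refine lintegral_congr fun u => ?_
  by_cases hu : 0 ≤ u
  · simp [gammaPDF, gammaPDFReal, hu]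
  · simp [gammaPDF, gammaPDFReal, hu]

/-- Partial sums `e 0 + ⋯ + e (n - 1)`. -/
def psum (e : ℕ → ℝ) (n : ℕ) : ℝ := ∑ k ∈ Finset.range n, e k

/-- The arrival times `e 0 + ⋯ + e n`. -/
def arrival (e : ℕ → ℝ) (n : ℕ) : ℝ := psum e (n + 1)

@[simp] lemma psum_zero (e : ℕ → ℝ) : psum e 0 = 0 := by simp [psum]

lemma psum_succ (e : ℕ → ℝ) (n : ℕ) : psum e (n + 1) = psum e n + e n := by
  simp [psum, Finset.sum_range_succ]

lemma psum_seqCons_succ (u : ℝ) (e : ℕ → ℝ) (n : ℕ) :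
    psum (seqCons u e) (n + 1) = u + psum e n := by
  simp [psum, Finset.sum_range_succ', add_comm]

@[simp] lemma arrival_seqCons_zero (u : ℝ) (e : ℕ → ℝ) : arrival (seqCons u e) 0 = u := by
  simp [arrival, psum]

lemma arrival_seqCons_succ (u : ℝ) (e : ℕ → ℝ) (n : ℕ) :
    arrival (seqCons u e) (n + 1) = u + arrival e n := psum_seqCons_succ u e (n + 1)

lemma arrival_seqCons (u : ℝ) (e : ℕ → ℝ) :
    arrival (seqCons u e) = seqCons u (fun n => u + arrival e n) := by
  funext n
  cases n with
  | zero => simp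
  | succ n => simp [arrival_seqCons_succ]

@[fun_prop] lemma measurable_psum_apply (n : ℕ) : Measurable (fun e => psum e n) := by
  unfold psum; fun_prop

@[fun_prop] lemma measurable_arrival_apply (n : ℕ) : Measurable (fun e => arrival e n) := by
  unfold arrival; fun_prop

@[fun_prop] lemma measurable_arrival : Measurable arrival := by
  refine measurable_pi_iff.2 fun n => by fun_prop

/-- Remove the entry number `i` of a sequence. -/
def skip (i : ℕ) (s : ℕ → ℝ) : ℕ → ℝ := fun n => s (if n < i then n else n + 1)

@[fun_prop] lemma measurable_skip (i : ℕ) : Measurable (skip i) := by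
  refine measurable_pi_iff.2 fun n => by unfold skip; fun_prop

lemma skip_zero_seqCons (u : ℝ) (s : ℕ → ℝ) : skip 0 (seqCons u s) = s := by
  funext n; simp [skip]

lemma skip_succ_seqCons (i : ℕ) (u : ℝ) (s : ℕ → ℝ) :
    skip (i + 1) (seqCons u s) = seqCons u (skip i s) := by
  funext n
  cases n with
  | zero => simp [skip]
  | succ n =>
    simp only [skip, seqCons_succ, add_lt_add_iff_right]
    split_ifs <;> simp

/-- Both sides integrate `h x s` against e^(-s) dx ds over 0 < x < s: on the left this is the joint
density of the first two arrivals, on the right e^(-s) is the density of a single arrival at s and x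
is inserted below it. -/
lemma lintegral_expMeasure_insert {h : ℝ → ℝ → ℝ≥0∞} (hh : Measurable (Function.uncurry h)) :
    ∫⁻ a, ∫⁻ b, h a (a + b) ∂(expMeasure 1) ∂(expMeasure 1) =
      ∫⁻ s, (∫⁻ x in Set.Ioc 0 s, h x s) ∂(expMeasure 1) := by
  have hm1 : Measurable fun p : ℝ × ℝ => h p.1 (p.1 + p.2) :=
    hh.comp (measurable_fst.prodMk (measurable_fst.add measurable_snd))
  have hm2 : Measurable fun p : ℝ × ℝ => (Set.Ioc 0 p.1).indicator (fun x => h x p.1) p.2 := by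
    have : (fun p : ℝ × ℝ => (Set.Ioc 0 p.1).indicator (fun x => h x p.1) p.2) =
        {p : ℝ × ℝ | 0 < p.2 ∧ p.2 ≤ p.1}.indicator (fun p => h p.2 p.1) := by
      ext p; simp [Set.indicator_apply]
    rw [this]
    refine Measurable.indicator (hh.comp measurable_swap) ?_
    exact (measurableSet_lt measurable_const measurable_snd).inter
      (measurableSet_le measurable_snd measurable_fst)
  have hL : ∀ a, ∫⁻ b, h a (a + b) ∂(expMeasure 1) =
      ∫⁻ s in Set.Ioi a, ENNReal.ofReal (Real.exp (a - s)) * h a s := by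
    intro a
    rw [lintegral_expMeasure (fun b => h a (a + b)) (hm1.comp measurable_prodMk_left),
      ← lintegral_indicator measurableSet_Ioi, ← lintegral_indicator measurableSet_Ioi,
      ← lintegral_sub_right_eq_self _ a]
    refine lintegral_congr fun s => ?_
    by_cases hs : a < s
    · simp [hs]
    · simp [hs]
  simp_rw [hL, ← lintegral_indicator measurableSet_Ioc]
  have hm3 : Measurable fun p : ℝ × ℝ => (Set.Ioi p.1).indicator
      (fun s => ENNReal.ofReal (Real.exp (p.1 - s)) * h p.1 s) p.2 := by
    have : (fun p : ℝ × ℝ => (Set.Ioi p.1).indicator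
      (fun s => ENNReal.ofReal (Real.exp (p.1 - s)) * h p.1 s) p.2) =
        {p : ℝ × ℝ | p.1 < p.2}.indicator
          (fun p => ENNReal.ofReal (Real.exp (p.1 - p.2)) * h p.1 p.2) := by
      ext p; simp [Set.indicator_apply]
    rw [this]
    refine Measurable.indicator (Measurable.mul (by fun_prop) hh) ?_
    exact measurableSet_lt measurable_fst measurable_snd
  simp_rw [← lintegral_indicator measurableSet_Ioi]
  rw [lintegral_expMeasure (fun a => ∫⁻ s, (Set.Ioi a).indicator
      (fun s => ENNReal.ofReal (Real.exp (a - s)) * h a s) s) (hm3.lintegral_prod_right'),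
    lintegral_expMeasure (fun s => ∫⁻ a, (Set.Ioc 0 s).indicator (fun x => h x s) a)
      (hm2.lintegral_prod_right'),
    ← lintegral_indicator measurableSet_Ioi, ← lintegral_indicator measurableSet_Ioi]
  have e1 : ∀ a : ℝ, (Set.Ioi 0).indicator (fun a => ENNReal.ofReal (Real.exp (-a)) *
      ∫⁻ s, (Set.Ioi a).indicator (fun s => ENNReal.ofReal (Real.exp (a - s)) * h a s) s) a =
      ∫⁻ s, {p : ℝ × ℝ | 0 < p.1 ∧ p.1 < p.2}.indicator
        (fun p => ENNReal.ofReal (Real.exp (-p.2)) * h p.1 p.2) (a, s) := by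
    intro a
    by_cases ha : 0 < a
    · have hma : Measurable fun s => (Set.Ioi a).indicator
          (fun s => ENNReal.ofReal (Real.exp (a - s)) * h a s) s := hm3.comp measurable_prodMk_left
      rw [Set.indicator_of_mem (by exact ha), ← lintegral_const_mul _ hma]
      refine lintegral_congr fun s => ?_
      by_cases hs : a < s
      · simp only [Set.indicator_apply, Set.mem_Ioi, hs, if_true, Set.mem_ofPred_eq, ha, and_self]
        rw [← mul_assoc, ← ENNReal.ofReal_mul (Real.exp_pos _).le, ← Real.exp_add]
        ring_nf
      · simp [hs]
    · simp [Set.indicator_apply, ha]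
  have e2 : ∀ s : ℝ, (Set.Ioi 0).indicator (fun s => ENNReal.ofReal (Real.exp (-s)) *
      ∫⁻ a, (Set.Ioc 0 s).indicator (fun x => h x s) a) s =
      ∫⁻ a, {p : ℝ × ℝ | 0 < p.1 ∧ p.1 < p.2}.indicator
        (fun p => ENNReal.ofReal (Real.exp (-p.2)) * h p.1 p.2) (a, s) := by
    intro s
    by_cases hs : 0 < s
    · rw [Set.indicator_of_mem (by exact hs), lintegral_indicator measurableSet_Ioc,
        ← restrict_Ioo_eq_restrict_Ioc, ← lintegral_indicator measurableSet_Ioo,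
        ← lintegral_const_mul _ ?_]
      · refine lintegral_congr fun a => ?_
        by_cases ha : 0 < a ∧ a < s
        · simp [ha]
        · simp [ha]
      · exact Measurable.indicator (hh.comp (measurable_id.prodMk measurable_const))
          measurableSet_Ioo
    · have : ∀ a, ¬ (0 < a ∧ a < s) := fun a h => hs (h.1.trans h.2)
      simp [Set.indicator_apply, hs, this]
  simp_rw [e1, e2]
  refine lintegral_lintegral_swap (Measurable.aemeasurable ?_)
  refine Measurable.indicator (Measurable.mul (by fun_prop) hh) ?_
  exact (measurableSet_lt measurable_const measurable_fst).inter
    (measurableSet_lt measurable_fst measurable_snd)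

end TrimmedStable

end

noncomputable section

namespace TrimmedStable

lemma measurable_lintegral_Ioc {β : Type*} [MeasurableSpace β] {f g : β → ℝ} {h : β → ℝ → ℝ≥0∞}
    (hf : Measurable f) (hg : Measurable g) (hh : Measurable (Function.uncurry h)) :
    Measurable fun b => ∫⁻ x in Set.Ioc (f b) (g b), h b x := by
  simp_rw [← lintegral_indicator measurableSet_Ioc]
  have : (fun p : β × ℝ => (Set.Ioc (f p.1) (g p.1)).indicator (h p.1) p.2) =
      {p : β × ℝ | f p.1 < p.2 ∧ p.2 ≤ g p.1}.indicator (Function.uncurry h) := by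
    ext p; simp [Set.indicator_apply, Function.uncurry]
  refine Measurable.lintegral_prod_right' (f := fun p : β × ℝ =>
    (Set.Ioc (f p.1) (g p.1)).indicator (h p.1) p.2) ?_
  rw [this]
  refine hh.indicator ?_
  exact (measurableSet_lt (hf.comp measurable_fst) measurable_snd).inter
    (measurableSet_le measurable_snd (hg.comp measurable_fst))

lemma setLIntegral_Ioc_add_left (f : ℝ → ℝ≥0∞) (u a b : ℝ) :
    ∫⁻ x in Set.Ioc (u + a) (u + b), f x = ∫⁻ x in Set.Ioc a b, f (u + x) := by
  rw [← lintegral_indicator measurableSet_Ioc, ← lintegral_indicator measurableSet_Ioc,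
    ← lintegral_add_left_eq_self _ u]
  refine lintegral_congr fun x => ?_
  simp [Set.indicator_apply]

/-- Removing the `i`-th arrival of a unit rate Poisson process amounts to inserting a point
uniformly distributed between the arrivals number `i - 1` and `i`. -/
lemma lintegral_arrival_skip (i : ℕ) {H : ℝ → (ℕ → ℝ) → ℝ≥0∞}
    (hH : Measurable (Function.uncurry H)) :
    ∫⁻ e, H (arrival e i) (skip i (arrival e)) ∂expSeq =
      ∫⁻ e, (∫⁻ x in Set.Ioc (psum e i) (psum e (i + 1)), H x (arrival e)) ∂expSeq := by
  induction i generalizing H with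
  | zero =>
    have hH1 : ∀ {γ : Type} [MeasurableSpace γ] {f : γ → ℝ} {g : γ → ℕ → ℝ}, Measurable f →
        Measurable g → Measurable fun c => H (f c) (g c) :=
      fun hf hg => hH.comp (hf.prodMk hg)
    have hL : Measurable fun e => H (arrival e 0) (skip 0 (arrival e)) :=
      hH1 (by fun_prop) (by fun_prop)
    rw [lintegral_expSeq hL, lintegral_expSeq (measurable_lintegral_Ioc (by fun_prop) (by fun_prop)
      (hH1 (by fun_prop) (by fun_prop)))]
    simp only [arrival_seqCons_zero, psum_zero, psum_seqCons_succ, add_zero, zero_add]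
    have hh : Measurable (Function.uncurry fun x s =>
        ∫⁻ e, H x (seqCons s (fun n => s + arrival e n)) ∂expSeq) := by
      refine Measurable.lintegral_prod_right' (f := fun p : (ℝ × ℝ) × (ℕ → ℝ) =>
        H p.1.1 (seqCons p.1.2 (fun n => p.1.2 + arrival p.2 n))) ?_
      refine hH1 (by fun_prop) ?_
      refine measurable_seqCons (by fun_prop) (measurable_pi_iff.2 fun n => ?_)
      exact Measurable.add (by fun_prop) ((measurable_arrival_apply n).comp measurable_snd)
    -- Deleting the first arrival merges the first two gaps into one. The pair formed by the deleted
    -- and the surviving arrival is exchanged for an inserted point x and a first arrival s, the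
    -- later gaps being untouched.
    have key := lintegral_expMeasure_insert hh
    convert key using 1
    · refine lintegral_congr fun u => ?_
      rw [lintegral_expSeq]
      · refine lintegral_congr fun b => lintegral_congr fun e => ?_
        rw [arrival_seqCons, skip_zero_seqCons, arrival_seqCons]
        congr 1
        funext n
        cases n <;> simp [add_assoc]
      · refine hH1 measurable_const ((measurable_skip 0).comp ?_)
        exact measurable_arrival.comp (measurable_seqCons measurable_const measurable_id)
    · refine lintegral_congr fun u => ?_
      rw [lintegral_lintegral_swap]
      · refine lintegral_congr fun e => lintegral_congr fun x => ?_
        rw [arrival_seqCons]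
      · have hs : Measurable fun p : (ℕ → ℝ) × ℝ => arrival (seqCons u p.1) :=
          measurable_arrival.comp (measurable_seqCons measurable_const measurable_fst)
        exact (hH1 measurable_snd hs).aemeasurable
  | succ i ih =>
    have hH1 : ∀ {γ : Type} [MeasurableSpace γ] {f : γ → ℝ} {g : γ → ℕ → ℝ}, Measurable f →
        Measurable g → Measurable fun c => H (f c) (g c) :=
      fun hf hg => hH.comp (hf.prodMk hg)
    have hL : Measurable fun e => H (arrival e (i + 1)) (skip (i + 1) (arrival e)) :=
      hH1 (by fun_prop) (by fun_prop)
    rw [lintegral_expSeq hL,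
      lintegral_expSeq (measurable_lintegral_Ioc (by fun_prop) (by fun_prop)
      (hH1 (by fun_prop) (by fun_prop)))]
    refine lintegral_congr fun u => ?_
    simp only [arrival_seqCons_succ, psum_seqCons_succ, arrival_seqCons, skip_succ_seqCons]
    -- With the first gap u fixed, the induction hypothesis applies to the functional translated by
    -- u.
    have := ih (H := fun x s => H (u + x) (seqCons u (fun n => u + s n))) (by
      refine hH1 (by fun_prop) (measurable_seqCons (by fun_prop) (measurable_pi_iff.2 fun n => ?_))
      exact measurable_const.add ((measurable_pi_apply n).comp measurable_snd))
    refine Eq.trans (lintegral_congr fun e => rfl) (this.trans (lintegral_congr fun e => ?_))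
    exact (setLIntegral_Ioc_add_left
      (fun x => H x (seqCons u fun n => u + arrival e n)) u _ _).symm

lemma lintegral_expMeasure_exp_neg :
    ∫⁻ u, ENNReal.ofReal (Real.exp (-u)) ∂(expMeasure 1) = 2⁻¹ := by
  rw [lintegral_expMeasure _ (by fun_prop)]
  have h : ∀ u : ℝ, ENNReal.ofReal (Real.exp (-u)) * ENNReal.ofReal (Real.exp (-u)) =
      ENNReal.ofReal (Real.exp (-2 * u)) := fun u => by
    rw [← ENNReal.ofReal_mul (Real.exp_pos _).le, ← Real.exp_add]; ring_nf
  simp_rw [h]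
  rw [← ofReal_integral_eq_lintegral_ofReal (integrableOn_exp_mul_Ioi (by norm_num) 0)
    (ae_of_all _ fun x => (Real.exp_pos _).le), integral_exp_mul_Ioi (by norm_num)]
  rw [← ENNReal.ofReal_ofNat, ← ENNReal.ofReal_inv_of_pos (by norm_num)]
  norm_num

lemma lintegral_exp_neg_psum (n : ℕ) :
    ∫⁻ e, ENNReal.ofReal (Real.exp (-psum e n)) ∂expSeq = 2⁻¹ ^ n := by
  induction n with
  | zero => simp
  | succ n ih =>
    rw [lintegral_expSeq (by fun_prop)]
    have : ∀ u e, ENNReal.ofReal (Real.exp (-psum (seqCons u e) (n + 1))) =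
        ENNReal.ofReal (Real.exp (-u)) * ENNReal.ofReal (Real.exp (-psum e n)) := fun u e => by
      rw [psum_seqCons_succ, ← ENNReal.ofReal_mul (Real.exp_pos _).le, ← Real.exp_add]
      ring_nf
    simp_rw [this]
    have h2 : ∀ u : ℝ, ∫⁻ e, ENNReal.ofReal (Real.exp (-u)) * ENNReal.ofReal (Real.exp (-psum e n))
        ∂expSeq = ENNReal.ofReal (Real.exp (-u)) * 2⁻¹ ^ n := fun u => by
      rw [lintegral_const_mul _ (by fun_prop), ih]
    simp_rw [h2]
    rw [lintegral_mul_const _ (by fun_prop), lintegral_expMeasure_exp_neg, pow_succ, mul_comm]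

lemma ae_expMeasure_pos : ∀ᵐ u ∂(expMeasure 1), 0 < u := by
  rw [ae_iff, ← lintegral_indicator_one (by measurability),
    lintegral_expMeasure _ (by measurability)]
  rw [setLIntegral_congr_fun (g := fun _ => 0) measurableSet_Ioi ?_]
  · simp
  · intro u hu
    have : 0 < u := hu
    simp [this]

lemma ae_expSeq_pos : ∀ᵐ e ∂expSeq, ∀ n, 0 < e n := by
  rw [ae_all_iff]
  intro n
  exact (measurePreserving_eval_infinitePi (fun _ : ℕ => expMeasure 1) n).quasiMeasurePreserving.ae
    ae_expMeasure_pos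

lemma strictMono_psum {e : ℕ → ℝ} (h : ∀ n, 0 < e n) : StrictMono (psum e) :=
  strictMono_nat_of_lt_succ fun n => by rw [psum_succ]; linarith [h n]

/-- Since E exp(-psum e n) = 2^(-n), the infimum over n of exp(-psum e n) has mean zero and vanishes
almost surely; the partial sums, being increasing, must diverge. -/
lemma ae_tendsto_psum : ∀ᵐ e ∂expSeq, Tendsto (psum e) atTop atTop := by
  have h0 : ∫⁻ e, (⨅ n, ENNReal.ofReal (Real.exp (-psum e n))) ∂expSeq = 0 := by
    refine le_antisymm (ge_of_tendsto' (ENNReal.tendsto_pow_atTop_nhds_zero_of_lt_one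
      (r := 2⁻¹) (by norm_num)) fun n => ?_) bot_le
    rw [← lintegral_exp_neg_psum n]
    exact lintegral_mono fun e => iInf_le _ n
  rw [lintegral_eq_zero_iff (by fun_prop)] at h0
  filter_upwards [h0, ae_expSeq_pos] with e he hpos
  refine tendsto_atTop_atTop_of_monotone (strictMono_psum hpos).monotone fun b => ?_
  by_contra! hb
  have : ENNReal.ofReal (Real.exp (-b)) ≤ ⨅ n, ENNReal.ofReal (Real.exp (-psum e n)) :=
    le_iInf fun n => ENNReal.ofReal_le_ofReal (Real.exp_le_exp.2 (by linarith [hb n]))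
  rw [he] at this
  simp only [Pi.zero_apply, nonpos_iff_eq_zero, ENNReal.ofReal_eq_zero] at this
  linarith [Real.exp_pos (-b)]

/-- The Mecke formula for the arrivals after the first `r` ones. -/
lemma lintegral_tsum_arrival_skip (r : ℕ) {H : ℝ → (ℕ → ℝ) → ℝ≥0∞}
    (hH : Measurable (Function.uncurry H)) :
    ∫⁻ e, (∑' j, H (arrival e (r + j)) (skip (r + j) (arrival e))) ∂expSeq =
      ∫⁻ e, (∫⁻ x in Set.Ioi (psum e r), H x (arrival e)) ∂expSeq := by
  have hH1 : ∀ {γ : Type} [MeasurableSpace γ] {f : γ → ℝ} {g : γ → ℕ → ℝ}, Measurable f →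
      Measurable g → Measurable fun c => H (f c) (g c) :=
    fun hf hg => hH.comp (hf.prodMk hg)
  rw [lintegral_tsum fun j => (hH1 (by fun_prop) (by fun_prop)).aemeasurable]
  simp_rw [lintegral_arrival_skip _ hH]
  rw [← lintegral_tsum fun j => (measurable_lintegral_Ioc (by fun_prop) (by fun_prop)
      (hH1 (by fun_prop) (by fun_prop))).aemeasurable]
  refine lintegral_congr_ae ?_
  filter_upwards [ae_expSeq_pos, ae_tendsto_psum] with e hpos htop
  have hm : Monotone fun j => psum e (r + j) := fun i j h =>
    (strictMono_psum hpos).monotone (by omega)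
  -- The gaps after the first r arrivals tile the half line because the arrivals diverge, so the
  -- gap-by-gap identities add up.
  have hU : ⋃ j, Set.Ioc (psum e (r + j)) (psum e (r + j + 1)) = Set.Ioi (psum e r) := by
    refine iUnion_Ioc_map_succ_eq_Ioi (f := fun j => psum e (r + j)) (fun j => hm (Nat.zero_le _)) ?_
    refine not_bddAbove_of_tendsto_atTop (l := atTop) ?_
    exact htop.comp (tendsto_add_atTop_nat r |>.congr fun n => by rw [add_comm])
  rw [← hU, lintegral_iUnion (fun _ => measurableSet_Ioc)]
  exact hm.pairwise_disjoint_on_Ioc_succ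

/-- Size-biasing by the arrival number `m + 1` shifts the sequence of arrivals. -/
lemma lintegral_arrival_mul (m : ℕ) {h : (ℕ → ℝ) → ℝ≥0∞} (hh : Measurable h) :
    ∫⁻ e, ENNReal.ofReal (arrival e m) * h (fun j => arrival e (m + j)) ∂expSeq =
      (m + 1) * ∫⁻ e, h (fun j => arrival e (m + 1 + j)) ∂expSeq := by
  have hh1 : ∀ k, Measurable fun e : ℕ → ℝ => h (fun j => e (k + j)) := fun k =>
    hh.comp (measurable_pi_iff.2 fun j => measurable_pi_apply _)
  have hh2 : Measurable fun e : ℕ → ℝ => h (fun j => arrival e (m + j)) :=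
    (hh1 m).comp measurable_arrival
  -- Deleting any arrival of index i ≤ m moves all those of index above m down by one place, so the
  -- left side is the same for each i. The m + 1 gaps in question have total length `arrival e m`.
  have h1 : ∀ i ∈ Finset.range (m + 1), ∫⁻ e, h (fun j => arrival e (m + 1 + j)) ∂expSeq =
      ∫⁻ e, (∫⁻ x in Set.Ioc (psum e i) (psum e (i + 1)), h (fun j => arrival e (m + j)))
        ∂expSeq := by
    intro i hi
    rw [← lintegral_arrival_skip i (H := fun _ γ => h (fun j => γ (m + j)))
      ((hh1 m).comp measurable_snd)]
    refine lintegral_congr fun e => ?_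
    congr 1
    funext j
    have : ¬ (m + j < i) := by simp at hi; omega
    simp only [skip, this, if_false]
    congr 1; omega
  have h2 := Finset.sum_congr rfl h1
  rw [Finset.sum_const, Finset.card_range, nsmul_eq_mul] at h2
  push_cast at h2
  rw [h2, ← lintegral_finsetSum]
  · refine lintegral_congr_ae ?_
    filter_upwards [ae_expSeq_pos] with e hpos
    simp only [lintegral_const, Measure.restrict_apply MeasurableSet.univ, Set.univ_inter,
      Real.volume_Ioc]
    rw [← Finset.mul_sum, mul_comm, ← ENNReal.ofReal_sum_of_nonneg, Finset.sum_range_sub]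
    · simp [arrival]
    · intro i _
      linarith [strictMono_psum hpos (Nat.lt_succ_self i)]
  · intro i _
    exact measurable_lintegral_Ioc (by fun_prop) (by fun_prop) (hh2.comp measurable_fst)

/-- The ratios of the arrivals to the arrival number `m + 1`. -/
def arrivalRatio (m : ℕ) (e : ℕ → ℝ) (j : ℕ) : ℝ := arrival e (m + 1 + j) / arrival e m

@[fun_prop] lemma measurable_arrivalRatio (m : ℕ) : Measurable (arrivalRatio m) := by
  refine measurable_pi_iff.2 fun j => ?_
  unfold arrivalRatio; fun_prop

/-- The Mecke formula for the ratios of arrivals. -/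
lemma lintegral_tsum_arrivalRatio (m : ℕ) {K : ℝ → (ℕ → ℝ) → ℝ≥0∞}
    (hK : Measurable (Function.uncurry K)) :
    ∫⁻ e, (∑' j, K (arrivalRatio m e j) (skip j (arrivalRatio m e))) ∂expSeq =
      (m + 1) * ∫⁻ y in Set.Ioi 1, ∫⁻ e, K y (arrivalRatio (m + 1) e) ∂expSeq := by
  have hK1 : ∀ {γ : Type} [MeasurableSpace γ] {f : γ → ℝ} {g : γ → ℕ → ℝ}, Measurable f →
      Measurable g → Measurable fun c => K (f c) (g c) :=
    fun hf hg => hK.comp (hf.prodMk hg)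
  have hmr : ∀ k, Measurable fun γ : ℕ → ℝ => fun j => γ (k + 1 + j) / γ k := fun k =>
    measurable_pi_iff.2 fun j => by fun_prop
  have h1 := lintegral_tsum_arrival_skip (m + 1)
    (H := fun x γ => K (x / γ m) (fun j => γ (m + 1 + j) / γ m))
    (hK1 (measurable_fst.div ((measurable_pi_apply m).comp measurable_snd))
      ((hmr m).comp measurable_snd))
  -- The deleted arrival comes after the reference arrival, which therefore keeps its index and
  -- value.
  have h2 : ∀ e j, skip (m + 1 + j) (arrival e) m = arrival e m := fun e j => by
    have : m < m + 1 + j := by omega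
    simp [skip, this]
  have h3 : ∀ e j, (fun i => skip (m + 1 + j) (arrival e) (m + 1 + i) / arrival e m) =
      skip j (arrivalRatio m e) := fun e j => by
    funext i
    simp only [skip, arrivalRatio, add_lt_add_iff_left]
    split_ifs <;> simp [add_assoc]
  simp only [h2, h3] at h1
  change ∫⁻ e, (∑' j, K (arrivalRatio m e j) (skip j (arrivalRatio m e))) ∂expSeq = _ at h1
  rw [h1]
  -- The scaling x = `arrival e m` * y maps (1, ∞) onto the domain of integration, since `psum e (m
  -- + 1)` is `arrival e m`.
  have h4 : ∀ᵐ e ∂expSeq, (∫⁻ x in Set.Ioi (psum e (m + 1)), K (x / arrival e m)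
      (fun j => arrival e (m + 1 + j) / arrival e m)) = ENNReal.ofReal (arrival e m) *
        ∫⁻ y in Set.Ioi 1, K y (arrivalRatio m e) := by
    filter_upwards [ae_expSeq_pos] with e hpos
    have ha : 0 < arrival e m := by
      rw [← psum_zero e]; exact strictMono_psum hpos (Nat.succ_pos m)
    have himg : Set.Ioi (psum e (m + 1)) = (fun y => arrival e m * y) '' Set.Ioi 1 := by
      rw [Set.image_mul_left_Ioi ha, mul_one]; rfl
    rw [himg, lintegral_image_eq_lintegral_abs_deriv_mul (f' := fun _ => arrival e m)
      measurableSet_Ioi (fun y _ => by simpa using ((hasDerivAt_id y).const_mul _).hasDerivWithinAt)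
      (mul_right_injective₀ ha.ne').injOn, ← lintegral_const_mul _ (hK1 (by fun_prop) (by fun_prop))]
    refine lintegral_congr fun y => ?_
    rw [abs_of_pos ha, mul_div_cancel_left₀ _ ha.ne']
    rfl
  rw [lintegral_congr_ae h4]
  have hm5 : Measurable fun s : ℕ → ℝ => ∫⁻ y in Set.Ioi 1, K y (fun j => s (1 + j) / s 0) := by
    refine Measurable.lintegral_prod_right' (f := fun p : (ℕ → ℝ) × ℝ =>
      K p.2 (fun j => p.1 (1 + j) / p.1 0)) ?_
    refine hK1 (by fun_prop) (measurable_pi_iff.2 fun j => ?_)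
    exact ((measurable_pi_apply _).comp measurable_fst).div
      ((measurable_pi_apply _).comp measurable_fst)
  -- The scaling factor is absorbed here at the price of replacing m by m + 1: this is the origin
  -- both of the factor m + 1 and of the passage from g_k to g_{k+1}.
  have h5 := lintegral_arrival_mul m hm5
  simp only [add_zero, ← add_assoc] at h5
  have h6 : ∀ k e, (fun j => arrival e (k + 1 + j) / arrival e k) = arrivalRatio k e :=
    fun k e => rfl
  simp only [h6] at h5
  rw [h5]
  congr 1
  exact lintegral_lintegral_swap (hK1 (by fun_prop) (by fun_prop)).aemeasurable

end TrimmedStable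

end

/-! ### The characteristic functional of the Poisson arrivals. -/

noncomputable section

namespace TrimmedStable

lemma integral_expSeq {F : (ℕ → ℝ) → ℂ} (hF : Measurable F) (hb : ∀ e, ‖F e‖ ≤ 1) :
    ∫ e, F e ∂expSeq = ∫ u, ∫ e, F (seqCons u e) ∂expSeq ∂(expMeasure 1) := by
  conv_lhs => rw [← expSeq_eq_map]
  have hm : Measurable fun p : ℝ × (ℕ → ℝ) => seqCons p.1 p.2 := by fun_prop
  rw [integral_map hm.aemeasurable hF.aestronglyMeasurable, integral_prod]
  exact Integrable.of_bound (hF.comp hm).aestronglyMeasurable 1 (ae_of_all _ fun p => hb _)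

lemma integral_expMeasure (F : ℝ → ℂ) :
    ∫ u, F u ∂(expMeasure 1) = ∫ u in Set.Ioi 0, (Real.exp (-u) : ℂ) * F u := by
  rw [expMeasure, gammaMeasure, integral_withDensity_eq_integral_toReal_smul
    (by unfold gammaPDF; exact (measurable_gammaPDFReal 1 1).ennreal_ofReal)
    (ae_of_all _ fun x => by simp [gammaPDF]), ← integral_Ici_eq_integral_Ioi,
    ← integral_indicator measurableSet_Ici]
  refine integral_congr_ae (ae_of_all _ fun u => ?_)
  by_cases hu : 0 ≤ u
  · simp [gammaPDF, gammaPDFReal, hu, ENNReal.toReal_ofReal (Real.exp_pos _).le]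
  · simp [gammaPDF, gammaPDFReal, hu]

lemma norm_cexp_I_mul (x : ℝ) : ‖Complex.exp (Complex.I * x)‖ = 1 := by
  rw [mul_comm]; exact Complex.norm_exp_ofReal_mul_I x

section CharFunctional

variable {φ : ℝ → ℝ} {K : ℝ}

/-- The characteristic functional of the first `N` arrivals, started from `a`. -/
def charPartial (φ : ℝ → ℝ) (N : ℕ) (a : ℝ) : ℂ :=
  ∫ e, Complex.exp (Complex.I * (∑ i ∈ Finset.range N, φ (a + arrival e i) : ℝ)) ∂expSeq

/-- The characteristic functional of the arrivals, started from `a`. -/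
def charFull (φ : ℝ → ℝ) (a : ℝ) : ℂ :=
  ∫ e, Complex.exp (Complex.I * (∑' i, φ (a + arrival e i) : ℝ)) ∂expSeq

lemma measurable_charPartial (hφ : Measurable φ) (N : ℕ) : Measurable (charPartial φ N) := by
  refine StronglyMeasurable.measurable ?_
  refine StronglyMeasurable.integral_prod_right' (f := fun p : ℝ × (ℕ → ℝ) =>
    Complex.exp (Complex.I * (∑ i ∈ Finset.range N, φ (p.1 + arrival p.2 i) : ℝ))) ?_
  refine Measurable.stronglyMeasurable ?_
  have : ∀ i, Measurable fun p : ℝ × (ℕ → ℝ) => φ (p.1 + arrival p.2 i) := fun i =>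
    hφ.comp (measurable_fst.add ((measurable_arrival_apply i).comp measurable_snd))
  fun_prop

lemma norm_charPartial_le (N : ℕ) (a : ℝ) : ‖charPartial φ N a‖ ≤ 1 := by
  refine (norm_integral_le_integral_norm _).trans ?_
  simp_rw [norm_cexp_I_mul]; simp

lemma norm_charFull_le (a : ℝ) : ‖charFull φ a‖ ≤ 1 := by
  refine (norm_integral_le_integral_norm _).trans ?_
  simp_rw [norm_cexp_I_mul]; simp

/-- Almost surely only finitely many arrivals lie below the level beyond which φ vanishes, so the
partial sums are eventually constant. -/
lemma tendsto_charPartial (hφ : Measurable φ) (h0 : ∀ v, K ≤ v → φ v = 0) (a : ℝ) :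
    Tendsto (fun N => charPartial φ N a) atTop (𝓝 (charFull φ a)) := by
  refine tendsto_integral_of_dominated_convergence (fun _ => 1) (fun N => ?_)
    (integrable_const _) (fun N => ae_of_all _ fun e => (norm_cexp_I_mul _).le) ?_
  · have : ∀ i, Measurable fun e => φ (a + arrival e i) := fun i => hφ.comp (by fun_prop)
    exact Measurable.aestronglyMeasurable (by fun_prop)
  · filter_upwards [ae_tendsto_psum] with e he
    have h1 : ∀ᶠ i in atTop, φ (a + arrival e i) = 0 := by
      filter_upwards [(he.comp (tendsto_add_atTop_nat 1)).eventually_ge_atTop (K - a)] with i hi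
      exact h0 _ (by simp only [Function.comp] at hi; unfold arrival; linarith)
    obtain ⟨n, hn⟩ := eventually_atTop.1 h1
    have h2 : ∑' i, φ (a + arrival e i) = ∑ i ∈ Finset.range n, φ (a + arrival e i) :=
      tsum_eq_sum fun i hi => hn i (by simpa using hi)
    refine tendsto_const_nhds.congr' ?_
    filter_upwards [eventually_ge_atTop n] with N hN
    rw [h2]
    congr 3
    exact Finset.sum_subset (Finset.range_mono hN) fun i _ hi => hn i (by simpa using hi)

lemma measurable_charFull (hφ : Measurable φ) (h0 : ∀ v, K ≤ v → φ v = 0) :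
    Measurable (charFull φ) :=
  measurable_of_tendsto_metrizable (measurable_charPartial hφ)
    (tendsto_pi_nhds.2 fun a => tendsto_charPartial hφ h0 a)

lemma charPartial_succ (hφ : Measurable φ) (N : ℕ) (a : ℝ) :
    charPartial φ (N + 1) a =
      ∫ u, Complex.exp (Complex.I * φ (a + u)) * charPartial φ N (a + u) ∂(expMeasure 1) := by
  have : ∀ i, Measurable fun e => φ (a + arrival e i) := fun i => hφ.comp (by fun_prop)
  rw [charPartial, integral_expSeq (by fun_prop) (fun e => (norm_cexp_I_mul _).le)]
  refine integral_congr_ae (ae_of_all _ fun u => ?_)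
  simp only
  rw [charPartial, ← integral_const_mul]
  refine integral_congr_ae (ae_of_all _ fun e => ?_)
  simp only
  rw [← Complex.exp_add, ← mul_add, ← Complex.ofReal_add, Finset.sum_range_succ']
  congr 3
  rw [arrival_seqCons_zero, add_comm]
  simp_rw [arrival_seqCons_succ, add_assoc]

lemma charFull_renewal (hφ : Measurable φ) (h0 : ∀ v, K ≤ v → φ v = 0) (a : ℝ) :
    charFull φ a =
      ∫ u, Complex.exp (Complex.I * φ (a + u)) * charFull φ (a + u) ∂(expMeasure 1) := by
  refine tendsto_nhds_unique ((tendsto_charPartial hφ h0 a).comp (tendsto_add_atTop_nat 1)) ?_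
  simp only [Function.comp_def, charPartial_succ hφ]
  refine tendsto_integral_of_dominated_convergence (fun _ => 1) (fun N => ?_)
    (integrable_const _) (fun N => ae_of_all _ fun u => ?_) (ae_of_all _ fun u => ?_)
  · have h1 : Measurable fun u => φ (a + u) := hφ.comp (by fun_prop)
    have h2 : Measurable fun u => charPartial φ N (a + u) :=
      (measurable_charPartial hφ N).comp (by fun_prop)
    exact Measurable.aestronglyMeasurable (by fun_prop)
  · rw [norm_mul, norm_cexp_I_mul, one_mul]
    exact norm_charPartial_le _ _
  · exact (tendsto_charPartial hφ h0 _).const_mul _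

lemma charFull_eq_one (h0 : ∀ v, K ≤ v → φ v = 0) {a : ℝ} (ha : K ≤ a) : charFull φ a = 1 := by
  have : ∀ᵐ e ∂expSeq, Complex.exp (Complex.I * (∑' i, φ (a + arrival e i) : ℝ)) = 1 := by
    filter_upwards [ae_expSeq_pos] with e he
    have : ∀ i, φ (a + arrival e i) = 0 := fun i => h0 _ (by
      have : 0 ≤ arrival e i := by
        rw [← psum_zero e]; exact (strictMono_psum he).monotone (Nat.zero_le _)
      linarith)
    simp [this]
  rw [charFull, integral_congr_ae this]
  simp

/-- `e^{-a}` times the characteristic functional of the arrivals started from `a`. -/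
def charScaled (φ : ℝ → ℝ) (a : ℝ) : ℂ := (Real.exp (-a) : ℂ) * charFull φ a

/-- Putting v = a + u in the renewal equation turns the density e^(-u) into e^(a - v). The factor
e^(-a) of `charScaled` cancels e^a, leaving an integrand that depends on v alone; the equation can
then be differentiated in a. -/
lemma charScaled_eq_integral (hφ : Measurable φ) (h0 : ∀ v, K ≤ v → φ v = 0) (a : ℝ) :
    charScaled φ a = ∫ v in Set.Ioi a, Complex.exp (Complex.I * φ v) * charScaled φ v := by
  rw [charScaled, charFull_renewal hφ h0, integral_expMeasure, ← integral_const_mul,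
    ← integral_indicator measurableSet_Ioi, ← integral_indicator measurableSet_Ioi,
    ← integral_sub_right_eq_self _ a]
  refine integral_congr_ae (ae_of_all _ fun v => ?_)
  by_cases hv : a < v
  · have e1 : (Complex.exp (-(v : ℂ))) = Complex.exp (-(a : ℂ)) * Complex.exp (a - v) := by
      rw [← Complex.exp_add]; ring_nf
    simp [hv, charScaled, e1]; ring
  · simp [hv]

lemma integrableOn_charScaled (hφ : Measurable φ) (h0 : ∀ v, K ≤ v → φ v = 0) (a : ℝ) :
    IntegrableOn (fun v => Complex.exp (Complex.I * φ v) * charScaled φ v) (Set.Ioi a) := by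
  have hi : IntegrableOn (fun v : ℝ => Real.exp (-v)) (Set.Ioi a) := by
    simpa using integrableOn_exp_mul_Ioi (a := -1) (by norm_num) a
  refine hi.mono' ?_ (ae_of_all _ fun v => ?_)
  · have := measurable_charFull hφ h0
    refine Measurable.aestronglyMeasurable ?_
    unfold charScaled
    fun_prop
  · rw [norm_mul, norm_cexp_I_mul, one_mul, charScaled, norm_mul, Complex.norm_real,
      Real.norm_eq_abs, abs_of_pos (Real.exp_pos _)]
    exact mul_le_of_le_one_right (Real.exp_pos _).le (norm_charFull_le _)

/-- The characteristic functional of a unit rate Poisson process. -/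
lemma charFull_zero (hφ : Measurable φ) (hc : ContinuousOn φ (Set.Ioi 0)) (hK : 0 < K)
    (h0 : ∀ v, K ≤ v → φ v = 0) :
    charFull φ 0 = Complex.exp (∫ v in (0)..K, (Complex.exp (Complex.I * φ v) - 1)) := by
  set ψ : ℝ → ℂ := fun v => Complex.exp (Complex.I * φ v) with hψ
  have hψm : Measurable ψ := by fun_prop
  have hψn : ∀ v, ‖ψ v‖ = 1 := fun v => norm_cexp_I_mul _
  have hψi : ∀ a b, IntervalIntegrable ψ volume a b := fun a b => by
    rw [intervalIntegrable_iff]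
    have : IsFiniteMeasure (volume.restrict (Set.uIoc a b)) := by unfold Set.uIoc; infer_instance
    exact Integrable.of_bound hψm.aestronglyMeasurable 1 (ae_of_all _ fun v => (hψn v).le)
  have hψc : ∀ x, 0 < x → ContinuousAt ψ x := fun x hx => by
    have := hc.continuousAt (Ioi_mem_nhds hx)
    fun_prop
  have hgi : ∀ a b, IntervalIntegrable (fun v => ψ v * charScaled φ v) volume a b := fun a b => by
    rw [intervalIntegrable_iff]
    exact (integrableOn_charScaled hφ h0 (min a b)).mono_set (fun x hx => hx.1)
  have hsm : Measurable (fun v => ψ v * charScaled φ v) := by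
    have := measurable_charFull hφ h0
    unfold charScaled
    fun_prop
  -- A version of `charScaled`, equal to it on [0, ∞), whose continuity is evident. At x > 0 it
  -- solves G' = -ψ G.
  set Gt : ℝ → ℂ := fun a => charScaled φ 0 - ∫ v in (0)..a, ψ v * charScaled φ v with hGt
  have hGt_eq : ∀ a, 0 ≤ a → Gt a = charScaled φ a := fun a ha => by
    rw [hGt]
    simp only
    rw [charScaled_eq_integral hφ h0 0, charScaled_eq_integral hφ h0 a,
      intervalIntegral.integral_of_le ha, ← Set.Ioc_union_Ioi_eq_Ioi ha,
      setIntegral_union (Set.Ioc_disjoint_Ioi le_rfl) measurableSet_Ioi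
        ((integrableOn_charScaled hφ h0 0).mono_set (fun x hx => hx.1))
        (integrableOn_charScaled hφ h0 a)]
    ring
  have hGc : Continuous Gt :=
    continuous_const.sub (intervalIntegral.continuous_primitive hgi 0)
  have hGd : ∀ x, 0 < x → HasDerivAt Gt (-(ψ x * Gt x)) x := fun x hx => by
    have hcs : ContinuousAt (charScaled φ) x := by
      refine hGc.continuousAt.congr ?_
      filter_upwards [Ioi_mem_nhds hx] with y hy using hGt_eq y (le_of_lt hy)
    have := intervalIntegral.integral_hasDerivAt_right (hgi 0 x)
      (hsm.stronglyMeasurable.stronglyMeasurableAtFilter) ((hψc x hx).mul hcs)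
    rw [hGt_eq x hx.le]
    simpa using this.const_sub (charScaled φ 0)
  -- Integrating factor: W is constant on (0, K], and W K is explicit because the characteristic
  -- functional is 1 from K on.
  set W : ℝ → ℂ := fun a => Gt a * Complex.exp (∫ v in (0)..a, ψ v) with hW
  have hWc : Continuous W :=
    hGc.mul (Complex.continuous_exp.comp (intervalIntegral.continuous_primitive hψi 0))
  have hWd : ∀ x, 0 < x → HasDerivAt W 0 x := fun x hx => by
    have h1 := intervalIntegral.integral_hasDerivAt_right (hψi 0 x)
      (hψm.stronglyMeasurable.stronglyMeasurableAtFilter) (hψc x hx)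
    have h2 := (hGd x hx).mul h1.cexp
    have h3 : -(ψ x * Gt x) * Complex.exp (∫ v in (0)..x, ψ v) +
        Gt x * (Complex.exp (∫ v in (0)..x, ψ v) * ψ x) = 0 := by ring
    rw [h3] at h2
    exact h2
  have hWK : ∀ x ∈ Set.Ioc 0 K, W x = W K := fun x hx => by
    refine (constant_of_has_deriv_right_zero hWc.continuousOn (fun y hy => ?_) K
      ⟨hx.2, le_rfl⟩).symm
    exact (hWd y (hx.1.trans_le hy.1)).hasDerivWithinAt
  -- φ need not be continuous at 0, so the derivative is known only on the open half line and the
  -- endpoint is reached by continuity of W.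
  have hW0 : W 0 = W K := by
    refine tendsto_nhds_unique (f := W) (l := 𝓝[>] 0)
      (hWc.continuousAt.tendsto.mono_left nhdsWithin_le_nhds) ?_
    refine tendsto_const_nhds.congr' ?_
    filter_upwards [Ioc_mem_nhdsGT hK] with x hx using (hWK x hx).symm
  have e1 : W 0 = charFull φ 0 := by simp [hW, hGt, charScaled]
  have e2 : W K = Complex.exp (∫ v in (0)..K, (ψ v - 1)) := by
    rw [hW]
    simp only
    rw [hGt_eq K hK.le, charScaled, charFull_eq_one h0 le_rfl, intervalIntegral.integral_sub
      (hψi _ _) intervalIntegrable_const, mul_one, Complex.ofReal_exp, ← Complex.exp_add]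
    congr 1
    simp
    ring
  rw [← e1, hW0, e2]

end CharFunctional

end TrimmedStable

end

/-! ### Jumps of a monotone path as limits of increments. -/

noncomputable section

namespace TrimmedStable

section Path

variable (σ : StieltjesFunction ℝ≥0)

/-- The jump of a monotone right-continuous path. -/
def pathJump (t : ℝ≥0) : ℝ := σ t - Function.leftLim σ t

lemma pathJump_nonneg (t : ℝ≥0) : 0 ≤ pathJump σ t :=
  sub_nonneg.2 (σ.mono.leftLim_le le_rfl)

/-- The jumps are the atoms of the Stieltjes measure of the path, and finitely many atoms weigh no
more than an interval that contains them. -/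
lemma sum_pathJump_le {a b : ℝ≥0} (hab : a ≤ b) (F : Finset ℝ≥0)
    (hF : ∀ t ∈ F, t ∈ Set.Ioc a b) : ∑ t ∈ F, pathJump σ t ≤ σ b - σ a := by
  have h1 : σ.measure (F : Set ℝ≥0) ≤ σ.measure (Set.Ioc a b) := measure_mono fun t ht => hF t ht
  rw [StieltjesFunction.measure_Ioc, ← sum_measure_singleton] at h1
  simp_rw [StieltjesFunction.measure_singleton] at h1
  change ∑ t ∈ F, ENNReal.ofReal (pathJump σ t) ≤ _ at h1
  rw [← ENNReal.ofReal_sum_of_nonneg fun t _ => pathJump_nonneg σ t,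
    ENNReal.ofReal_le_ofReal_iff (sub_nonneg.2 (σ.mono hab))] at h1
  exact h1

lemma pathJump_le {a b t : ℝ≥0} (ht : t ∈ Set.Ioc a b) : pathJump σ t ≤ σ b - σ a := by
  simpa using sum_pathJump_le σ (ht.1.le.trans ht.2) {t} (by simpa using ht)

lemma finite_le_pathJump (a b : ℝ≥0) {ε : ℝ} (hε : 0 < ε) :
    {t | t ∈ Set.Ioc a b ∧ ε ≤ pathJump σ t}.Finite := by
  by_contra hinf
  obtain ⟨n, hn⟩ := exists_nat_gt ((σ b - σ a) / ε)
  obtain ⟨F, hF, hcard⟩ := Set.Infinite.exists_subset_card_eq hinf (n + 1)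
  have hab : a ≤ b := by
    have : (F : Set ℝ≥0).Nonempty := by
      rw [Finset.coe_nonempty, ← Finset.card_pos]; omega
    obtain ⟨t, ht⟩ := this
    exact (hF ht).1.1.le.trans (hF ht).1.2
  have h1 := sum_pathJump_le σ hab F fun t ht => (hF ht).1
  have h2 : (n + 1 : ℝ) * ε ≤ ∑ t ∈ F, pathJump σ t := by
    have := Finset.card_nsmul_le_sum F (pathJump σ) ε fun t ht => (hF ht).2
    rw [hcard, nsmul_eq_mul] at this
    exact_mod_cast this
  rw [div_lt_iff₀ hε] at hn
  linarith

/-- Close to t the path is near its value on the right of t and near its left limit on the left of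
t. An increment within such a neighbourhood is thus nearly the jump at t or nearly zero, according
as (a, b] contains t or not. -/
lemma exists_isOpen_increment (t : ℝ≥0) {η : ℝ} (hη : 0 < η) :
    ∃ O : Set ℝ≥0, IsOpen O ∧ t ∈ O ∧ ∀ a ∈ O, ∀ b ∈ O, a ≤ b →
      |σ b - σ a - Set.indicator (Set.Ioc a b) (pathJump σ) t| ≤ η := by
  have h1 : ∀ᶠ s in 𝓝 t, t ≤ s → σ s < σ t + η / 2 := by
    have := (σ.right_continuous t).eventually_lt_const (lt_add_of_pos_right (σ t) (half_pos hη))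
    exact eventually_nhdsWithin_iff.1 this
  have h2 : ∀ᶠ s in 𝓝 t, s < t → Function.leftLim σ t - η / 2 < σ s := by
    have := (σ.mono.tendsto_leftLim t).eventually_const_lt (sub_lt_self _ (half_pos hη))
    exact eventually_nhdsWithin_iff.1 this
  obtain ⟨O, hO, hOo, htO⟩ := eventually_nhds_iff.1 (h1.and h2)
  refine ⟨O, hOo, htO, fun a ha b hb hab => ?_⟩
  have hΔ : pathJump σ t = σ t - Function.leftLim σ t := rfl
  have hm := σ.mono hab
  rcases le_or_gt t a with hta | hat
  · rw [Set.indicator_of_notMem (by simp [hta]), sub_zero, abs_of_nonneg (by linarith)]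
    have := (hO b hb).1 (hta.trans hab)
    have := σ.mono hta
    linarith
  · rcases le_or_gt t b with htb | hbt
    · rw [Set.indicator_of_mem (by exact ⟨hat, htb⟩), abs_le]
      have e1 := (hO b hb).1 htb
      have e2 := (hO a ha).2 hat
      have e3 := σ.mono htb
      have e4 := σ.mono.le_leftLim hat
      constructor <;> linarith
    · rw [Set.indicator_of_notMem (by simp [hbt]), sub_zero, abs_of_nonneg (by linarith)]
      have e2 := (hO a ha).2 hat
      have e4 := σ.mono.le_leftLim hbt
      linarith

/-- A Lebesgue number of the cover of [0, 1] by the neighbourhoods above: below a uniform mesh, each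
increment is explained by at most one jump up to η. -/
lemma exists_forall_increment {η : ℝ} (hη : 0 < η) :
    ∃ δ > 0, ∀ a b : ℝ≥0, a ≤ b → b ≤ 1 → (b : ℝ) - a < δ → ∃ t,
      |σ b - σ a - Set.indicator (Set.Ioc a b) (pathJump σ) t| ≤ η := by
  choose O hOo htO hO using fun t => exists_isOpen_increment σ t hη
  obtain ⟨δ, hδ, h⟩ := lebesgue_number_lemma_of_metric (isCompact_Icc (a := (0 : ℝ≥0)) (b := 1))
    hOo (fun t _ => Set.mem_iUnion.2 ⟨t, htO t⟩)
  refine ⟨δ, hδ, fun a b hab hb1 hlt => ?_⟩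
  obtain ⟨t, ht⟩ := h a ⟨zero_le, hab.trans hb1⟩
  refine ⟨t, hO t a (ht (Metric.mem_ball_self hδ)) b (ht ?_) hab⟩
  rw [Metric.mem_ball, NNReal.dist_eq, abs_of_nonneg (sub_nonneg.2 (by exact_mod_cast hab))]
  exact hlt

variable {f : ℝ → ℝ} {ε : ℝ}

/-- An increment smaller than ε contributes nothing on either side. Otherwise a single jump accounts
for it up to η, the others are too small to count, and the error ω is multiplied by a quotient that
is at least 1. Bounding by a multiple of the increment makes the errors summable over a partition.
-/
lemma abs_increment_sub_sum_le {a b : ℝ≥0} (hab : a ≤ b) (hε : 0 < ε)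
    (hf0 : ∀ x, x ≤ ε → f x = 0) {η ω : ℝ} (hηε : η < ε) (hω : 0 ≤ ω)
    (hfω : ∀ x ∈ Set.Icc 0 (σ b - σ a), ∀ y ∈ Set.Icc 0 (σ b - σ a), |x - y| ≤ η →
      |f x - f y| ≤ ω)
    {t : ℝ≥0} (ht : |σ b - σ a - Set.indicator (Set.Ioc a b) (pathJump σ) t| ≤ η)
    (E : Finset ℝ≥0) (hE : ∀ s ∈ Set.Ioc a b, s ∈ E ↔ ε ≤ pathJump σ s) :
    |f (σ b - σ a) - ∑ s ∈ E with s ∈ Set.Ioc a b, f (pathJump σ s)| ≤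
      ω * ((σ b - σ a) / ε) := by
  classical
  have hm := sub_nonneg.2 (σ.mono hab)
  rcases lt_or_ge (σ b - σ a) ε with hlt | hge
  · rw [hf0 _ hlt.le, Finset.sum_eq_zero, sub_zero, abs_zero]
    · positivity
    · intro s hs
      exact hf0 _ ((pathJump_le σ (Finset.mem_filter.1 hs).2).trans hlt.le)
  · have htI : t ∈ Set.Ioc a b := by
      by_contra htI
      rw [Set.indicator_of_notMem htI, sub_zero, abs_of_nonneg hm] at ht
      linarith
    rw [Set.indicator_of_mem htI] at ht
    have hsum : ∑ s ∈ E with s ∈ Set.Ioc a b, f (pathJump σ s) = f (pathJump σ t) := by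
      rw [Finset.sum_eq_single t]
      · intro s hs hst
        obtain ⟨hsE, hsI⟩ := Finset.mem_filter.1 hs
        -- Two jumps together do not exceed the increment, which exceeds the jump at t by at most η;
        -- hence the jump at s is at most η < ε.
        have h1 := sum_pathJump_le σ hab {s, t} (by
          intro u hu
          rcases Finset.mem_insert.1 hu with rfl | hu
          · exact hsI
          · rw [Finset.mem_singleton.1 hu]; exact htI)
        rw [Finset.sum_pair hst] at h1
        refine hf0 _ ?_
        have := (abs_le.1 ht).2
        linarith
      · intro htE
        have : ¬ ε ≤ pathJump σ t := fun h => htE (Finset.mem_filter.2 ⟨(hE t htI).2 h, htI⟩)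
        exact hf0 _ (not_le.1 this).le
    rw [hsum]
    refine (hfω _ ⟨hm, le_rfl⟩ _ ⟨pathJump_nonneg σ t, pathJump_le σ htI⟩ ht).trans ?_
    exact le_mul_of_one_le_right hω ((one_le_div hε).2 hge)

/-- Sums over the increments along a fine partition converge to sums over the jumps. -/
lemma tendsto_sum_increments (hf : Continuous f) (hε : 0 < ε) (hf0 : ∀ x, x ≤ ε → f x = 0) :
    Tendsto (fun n : ℕ => ∑ k ∈ Finset.range n, f (σ ((k + 1 : ℕ) / n) - σ ((k : ℕ) / n))) atTop
      (𝓝 (∑ᶠ t ∈ Set.Ioc (0 : ℝ≥0) 1, f (pathJump σ t))) := by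
  classical
  have hfin := finite_le_pathJump σ 0 1 hε
  set E := hfin.toFinset with hE
  have hEmem : ∀ s, s ∈ E ↔ s ∈ Set.Ioc (0 : ℝ≥0) 1 ∧ ε ≤ pathJump σ s := fun s => by simp [hE]
  have hsum : ∑ᶠ t ∈ Set.Ioc (0 : ℝ≥0) 1, f (pathJump σ t) = ∑ t ∈ E, f (pathJump σ t) := by
    refine finsum_mem_eq_sum_of_inter_support_eq _ ?_
    ext t
    simp only [Set.mem_inter_iff, Function.mem_support, Finset.mem_coe, hEmem]
    constructor
    · rintro ⟨h1, h2⟩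
      exact ⟨⟨h1, not_lt.1 fun h => h2 (hf0 _ h.le)⟩, h2⟩
    · rintro ⟨⟨h1, _⟩, h2⟩
      exact ⟨h1, h2⟩
  rw [hsum, Metric.tendsto_atTop]
  intro ρ hρ
  set L := σ 1 - σ 0 with hL
  have hL0 : 0 ≤ L := sub_nonneg.2 (σ.mono zero_le)
  -- The errors telescope to ω L / ε, which must be less than ρ; L + 1 keeps the denominator
  -- positive when L = 0.
  set ω := ρ * ε / (2 * (L + 1)) with hω
  have hω0 : 0 < ω := by positivity
  have huc := isCompact_Icc.uniformContinuousOn_of_continuous (s := Set.Icc 0 L) hf.continuousOn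
  obtain ⟨η', hη'0, hη'⟩ := Metric.uniformContinuousOn_iff.1 huc ω hω0
  set η := min (η' / 2) (ε / 2) with hη
  have hη0 : 0 < η := lt_min (half_pos hη'0) (half_pos hε)
  obtain ⟨δ, hδ, hinc⟩ := exists_forall_increment σ hη0
  obtain ⟨N, hN⟩ := exists_nat_gt (1 / δ)
  refine ⟨max N 1, fun n hn => ?_⟩
  have hn0 : 0 < n := lt_of_lt_of_le one_pos ((le_max_right _ _).trans hn)
  have hnr : (0 : ℝ) < n := by exact_mod_cast hn0
  have hnn : (0 : ℝ≥0) < n := by exact_mod_cast hn0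
  set p : ℕ → ℝ≥0 := fun k => (k : ℝ≥0) / n with hp
  have hpm : Monotone p := fun i j h => by
    simp only [hp]; gcongr
  have hp0 : p 0 = 0 := by simp [hp]
  have hpn : p n = 1 := by simp [hp, hnn.ne']
  have hpw : ∀ k, (p (k + 1) : ℝ) - p k < δ := fun k => by
    have : (p (k + 1) : ℝ) - p k = 1 / n := by simp [hp]; ring
    rw [this, div_lt_comm₀ hnr hδ]
    exact hN.trans_le (by exact_mod_cast (le_max_left _ _).trans hn)
  have hp1 : ∀ k ∈ Finset.range n, p (k + 1) ≤ 1 := fun k hk => by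
    rw [← hpn]; exact hpm (by simpa using hk)
  have hpart : ∑ t ∈ E, f (pathJump σ t) =
      ∑ k ∈ Finset.range n, ∑ s ∈ E with s ∈ Set.Ioc (p k) (p (k + 1)), f (pathJump σ s) := by
    rw [← Finset.sum_biUnion]
    · refine Finset.sum_congr ?_ fun _ _ => rfl
      ext t
      simp only [Finset.mem_biUnion, Finset.mem_filter, Finset.mem_range]
      constructor
      · intro ht
        have ht1 := ((hEmem t).1 ht).1
        have : t ∈ ⋃ k ∈ Finset.range n, Set.Ioc (p k) (p (k + 1)) := by
          have h := hpm.biUnion_Ico_Ioc_map_succ 0 n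
          rw [hp0, hpn] at h
          rw [← h] at ht1
          simpa using ht1
        simp only [Set.mem_iUnion, Finset.mem_range, exists_prop] at this
        obtain ⟨k, hk, hkt⟩ := this
        exact ⟨k, hk, ht, hkt⟩
      · rintro ⟨k, _, ht, _⟩
        exact ht
    · intro i _ j _ hij
      have h := hpm.pairwise_disjoint_on_Ioc_succ hij
      rw [Function.onFun, Finset.disjoint_left]
      intro t hti htj
      exact Set.disjoint_left.1 h (Finset.mem_filter.1 hti).2 (Finset.mem_filter.1 htj).2
  rw [Real.dist_eq, hpart, ← Finset.sum_sub_distrib]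
  refine (Finset.abs_sum_le_sum_abs _ _).trans_lt ?_
  have hbound : ∀ k ∈ Finset.range n, |f (σ (p (k + 1)) - σ (p k)) -
      ∑ s ∈ E with s ∈ Set.Ioc (p k) (p (k + 1)), f (pathJump σ s)| ≤
        ω * ((σ (p (k + 1)) - σ (p k)) / ε) := by
    intro k hk
    obtain ⟨t, ht⟩ := hinc (p k) (p (k + 1)) (hpm (Nat.le_succ k)) (hp1 k hk) (hpw k)
    have hle : σ (p (k + 1)) - σ (p k) ≤ L := by
      have := σ.mono (hp1 k hk)
      have := σ.mono (zero_le (a := p k))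
      linarith
    refine abs_increment_sub_sum_le σ (hpm (Nat.le_succ k)) hε hf0
      ((min_le_right _ _).trans_lt (half_lt_self hε)) hω0.le ?_ ht E ?_
    · intro x hx y hy hxy
      refine (hη' x ⟨hx.1, hx.2.trans hle⟩ y ⟨hy.1, hy.2.trans hle⟩ ?_).le
      rw [Real.dist_eq]
      exact hxy.trans_lt ((min_le_left _ _).trans_lt (half_lt_self hη'0))
    · intro s hs
      rw [hEmem]
      exact and_iff_right ⟨lt_of_le_of_lt zero_le hs.1, hs.2.trans (hp1 k hk)⟩
  refine (Finset.sum_le_sum hbound).trans_lt ?_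
  rw [← Finset.mul_sum, ← Finset.sum_div, Finset.sum_range_sub (fun k => σ (p k)), hpn, hp0, ← hL,
    hω, div_mul_div_comm, div_lt_iff₀ (by positivity)]
  nlinarith [mul_pos hρ hε]

end Path

end TrimmedStable

end

/-! ### Small-time behaviour of the subordinator. -/

noncomputable section

namespace TrimmedStable

section Weierstrass

lemma exp_neg_mem_Icc {x : ℝ} (hx : 0 ≤ x) : Real.exp (-x) ∈ Set.Icc (0 : ℝ) 1 :=
  ⟨(Real.exp_pos _).le, Real.exp_le_one_iff.2 (by linarith)⟩

lemma integrable_exp_weight {μ : Measure ℝ} (h0 : ∀ᵐ x ∂μ, 0 ≤ x)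
    (hi : Integrable (fun x => 1 - Real.exp (-x)) μ) {q : ℝ → ℝ} (hq : Continuous q) :
    Integrable (fun x => (1 - Real.exp (-x)) * q (Real.exp (-x))) μ := by
  obtain ⟨C, hC⟩ := isCompact_Icc.exists_bound_of_continuousOn (s := Set.Icc (0 : ℝ) 1)
    hq.continuousOn
  refine hi.mul_bdd (c := C) (by fun_prop) ?_
  filter_upwards [h0] with x hx using hC _ (exp_neg_mem_Icc hx)

lemma abs_integral_exp_weight_sub_le {μ : Measure ℝ} (h0 : ∀ᵐ x ∂μ, 0 ≤ x)
    (hi : Integrable (fun x => 1 - Real.exp (-x)) μ) {p q : ℝ → ℝ} (hp : Continuous p)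
    (hq : Continuous q) {δ : ℝ} (h : ∀ u ∈ Set.Icc (0 : ℝ) 1, |p u - q u| ≤ δ) :
    |∫ x, (1 - Real.exp (-x)) * p (Real.exp (-x)) ∂μ -
      ∫ x, (1 - Real.exp (-x)) * q (Real.exp (-x)) ∂μ| ≤
      (∫ x, (1 - Real.exp (-x)) ∂μ) * δ := by
  rw [← integral_sub (integrable_exp_weight h0 hi hp) (integrable_exp_weight h0 hi hq),
    ← integral_mul_const, ← Real.norm_eq_abs]
  refine norm_integral_le_of_norm_le (hi.mul_const _) ?_
  filter_upwards [h0] with x hx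
  rw [← mul_sub, norm_mul, Real.norm_eq_abs, Real.norm_eq_abs,
    abs_of_nonneg (by linarith [(exp_neg_mem_Icc hx).2])]
  exact mul_le_mul_of_nonneg_left (h _ (exp_neg_mem_Icc hx))
    (by linarith [(exp_neg_mem_Icc hx).2])

/-- Convergence of the moments in `e^{-x}` implies convergence of the integrals of continuous
functions of `e^{-x}`. -/
lemma tendsto_integral_exp_weight {μ : ℕ → Measure ℝ} {ν : Measure ℝ}
    (hμ0 : ∀ n, ∀ᵐ x ∂(μ n), 0 ≤ x) (hν0 : ∀ᵐ x ∂ν, 0 ≤ x)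
    (hμi : ∀ n, Integrable (fun x => 1 - Real.exp (-x)) (μ n))
    (hνi : Integrable (fun x => 1 - Real.exp (-x)) ν)
    (hk : ∀ k : ℕ, Tendsto (fun n => ∫ x, (1 - Real.exp (-x)) * Real.exp (-x) ^ k ∂(μ n)) atTop
      (𝓝 (∫ x, (1 - Real.exp (-x)) * Real.exp (-x) ^ k ∂ν)))
    {q : ℝ → ℝ} (hq : Continuous q) :
    Tendsto (fun n => ∫ x, (1 - Real.exp (-x)) * q (Real.exp (-x)) ∂(μ n)) atTop
      (𝓝 (∫ x, (1 - Real.exp (-x)) * q (Real.exp (-x)) ∂ν)) := by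
  have hpoly : ∀ p : Polynomial ℝ,
      Tendsto (fun n => ∫ x, (1 - Real.exp (-x)) * p.eval (Real.exp (-x)) ∂(μ n)) atTop
      (𝓝 (∫ x, (1 - Real.exp (-x)) * p.eval (Real.exp (-x)) ∂ν)) := by
    intro p
    have key : ∀ ρ : Measure ℝ, (∀ᵐ x ∂ρ, 0 ≤ x) → Integrable (fun x => 1 - Real.exp (-x)) ρ →
        ∫ x, (1 - Real.exp (-x)) * p.eval (Real.exp (-x)) ∂ρ =
        ∑ k ∈ Finset.range (p.natDegree + 1),
          p.coeff k * ∫ x, (1 - Real.exp (-x)) * Real.exp (-x) ^ k ∂ρ := by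
      intro ρ hρ0 hρi
      simp_rw [Polynomial.eval_eq_sum_range, Finset.mul_sum]
      rw [integral_finsetSum]
      · refine Finset.sum_congr rfl fun k _ => ?_
        rw [← integral_const_mul]
        refine integral_congr_ae (ae_of_all _ fun x => by simp only; ring)
      · intro k _
        exact integrable_exp_weight hρ0 hρi (q := fun u => p.coeff k * u ^ k) (by fun_prop)
    rw [key ν hν0 hνi]
    simp_rw [key _ (hμ0 _) (hμi _)]
    exact tendsto_finsetSum _ fun k _ => (hk k).const_mul _
  have hmass : Tendsto (fun n => ∫ x, (1 - Real.exp (-x)) ∂(μ n)) atTop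
      (𝓝 (∫ x, (1 - Real.exp (-x)) ∂ν)) := by simpa using hk 0
  set M := ∫ x, (1 - Real.exp (-x)) ∂ν with hM
  have hM0 : 0 ≤ M := integral_nonneg_of_ae (by
    filter_upwards [hν0] with x hx
    simpa using hx)
  rw [Metric.tendsto_atTop]
  intro ρ hρ
  -- The weighted masses are eventually at most M + 1, so replacing q by a polynomial within δ costs
  -- at most ρ / 4 for each of the two measures, and the polynomial itself a third ρ / 4.
  set δ := ρ / (4 * (M + 1)) with hδ
  have hδ0 : 0 < δ := by positivity
  obtain ⟨p, hp⟩ := exists_polynomial_near_of_continuousOn 0 1 q hq.continuousOn δ hδ0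
  obtain ⟨N1, hN1⟩ := Metric.tendsto_atTop.1 (hpoly p) (ρ / 4) (by positivity)
  obtain ⟨N2, hN2⟩ := Metric.tendsto_atTop.1 hmass 1 one_pos
  refine ⟨max N1 N2, fun n hn => ?_⟩
  have h1 := hN1 n ((le_max_left _ _).trans hn)
  have h2 := hN2 n ((le_max_right _ _).trans hn)
  rw [Real.dist_eq] at h1 h2 ⊢
  have h3 := abs_integral_exp_weight_sub_le (hμ0 n) (hμi n) p.continuous hq
    (fun u hu => (hp u hu).le)
  have h4 := abs_integral_exp_weight_sub_le hν0 hνi p.continuous hq (fun u hu => (hp u hu).le)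
  have h5 : (∫ x, (1 - Real.exp (-x)) ∂(μ n)) * δ ≤ (M + 1) * δ :=
    mul_le_mul_of_nonneg_right (by linarith [(abs_lt.1 h2).2]) hδ0.le
  have h6 : (M + 1) * δ = ρ / 4 := by rw [hδ]; field_simp
  have h7 : M * δ ≤ ρ / 4 := by rw [← h6]; nlinarith
  rw [abs_lt] at h1 ⊢
  rw [abs_le] at h3 h4
  constructor <;> linarith [h1.1, h1.2, h3.1, h3.2, h4.1, h4.2]

end Weierstrass

section Levy

variable {α c : ℝ}

/-- The Lévy measure `c α x^{-α-1} dx` on `(0, ∞)`. -/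
def levyMeasure (α c : ℝ) : Measure ℝ :=
  (volume.restrict (Set.Ioi 0)).withDensity fun x => ENNReal.ofReal (c * α * x ^ (-α - 1))

lemma levyDensity_nonneg (hα0 : 0 < α) (hc : 0 < c) {x : ℝ} (hx : 0 < x) :
    0 ≤ c * α * x ^ (-α - 1) := by positivity

lemma integral_levyMeasure {E : Type*} [NormedAddCommGroup E] [NormedSpace ℝ E]
    (hα0 : 0 < α) (hc : 0 < c) (h : ℝ → E) :
    ∫ x, h x ∂(levyMeasure α c) = ∫ x in Set.Ioi 0, (c * α * x ^ (-α - 1)) • h x := by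
  rw [levyMeasure, integral_withDensity_eq_integral_toReal_smul (by fun_prop)
    (ae_of_all _ fun x => by simp)]
  refine setIntegral_congr_fun measurableSet_Ioi fun x hx => ?_
  rw [ENNReal.toReal_ofReal (levyDensity_nonneg hα0 hc hx)]

lemma laplaceExponent_eq (hα0 : 0 < α) (hc : 0 < c) (l : ℝ) :
    laplaceExponent α c l = ∫ x, (1 - Real.exp (-l * x)) ∂(levyMeasure α c) := by
  rw [integral_levyMeasure hα0 hc, laplaceExponent]
  exact integral_congr_ae (ae_of_all _ fun x => mul_comm _ _)

lemma ae_levyMeasure_pos : ∀ᵐ x ∂(levyMeasure α c), 0 < x := by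
  refine (withDensity_absolutelyContinuous _ _).ae_le ?_
  exact ae_restrict_mem measurableSet_Ioi

/-- On (0, 1] the bound 1 - e^(-x) ≤ x leaves x^(-α), integrable as α < 1; on (1, ∞) the density
x^(-α-1) is itself integrable as α > 0. -/
lemma integrable_levyMeasure (hα0 : 0 < α) (hα1 : α < 1) (hc : 0 < c) :
    Integrable (fun x => 1 - Real.exp (-x)) (levyMeasure α c) := by
  rw [levyMeasure, integrable_withDensity_iff (by fun_prop) (ae_of_all _ fun x => by simp)]
  have hm : Measurable fun x : ℝ =>
      (1 - Real.exp (-x)) * (ENNReal.ofReal (c * α * x ^ (-α - 1))).toReal := by fun_prop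
  rw [← IntegrableOn, ← Set.Ioc_union_Ioi_eq_Ioi zero_le_one]
  refine IntegrableOn.union ?_ ?_
  · have h1 : IntegrableOn (fun x : ℝ => c * α * x ^ (-α)) (Set.Ioc 0 1) := by
      refine Integrable.const_mul ?_ _
      have := intervalIntegral.intervalIntegrable_rpow' (a := 0) (b := 1) (r := -α) (by linarith)
      rwa [intervalIntegrable_iff_integrableOn_Ioc_of_le zero_le_one] at this
    refine h1.mono' hm.aestronglyMeasurable ?_
    filter_upwards [ae_restrict_mem measurableSet_Ioc] with x hx
    rw [ENNReal.toReal_ofReal (levyDensity_nonneg hα0 hc hx.1), Real.norm_eq_abs, abs_of_nonneg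
      (mul_nonneg (by linarith [(exp_neg_mem_Icc hx.1.le).2]) (levyDensity_nonneg hα0 hc hx.1))]
    have e1 : x ^ (-α) = x * x ^ (-α - 1) := by
      rw [Real.rpow_sub_one hx.1.ne', mul_div_cancel₀ _ hx.1.ne']
    rw [e1]
    have e2 : 1 - Real.exp (-x) ≤ x := by linarith [Real.add_one_le_exp (-x)]
    calc _ ≤ x * (c * α * x ^ (-α - 1)) :=
          mul_le_mul_of_nonneg_right e2 (levyDensity_nonneg hα0 hc hx.1)
      _ = _ := by ring
  · have h1 : IntegrableOn (fun x : ℝ => c * α * x ^ (-α - 1)) (Set.Ioi 1) :=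
      Integrable.const_mul (integrableOn_Ioi_rpow_of_lt (by linarith) one_pos) _
    refine h1.mono' hm.aestronglyMeasurable ?_
    filter_upwards [ae_restrict_mem measurableSet_Ioi] with x hx
    have hx0 : 0 < x := lt_trans one_pos hx
    rw [ENNReal.toReal_ofReal (levyDensity_nonneg hα0 hc hx0), Real.norm_eq_abs, abs_of_nonneg
      (mul_nonneg (by linarith [(exp_neg_mem_Icc hx0.le).2]) (levyDensity_nonneg hα0 hc hx0))]
    exact mul_le_of_le_one_left (levyDensity_nonneg hα0 hc hx0)
      (by linarith [(exp_neg_mem_Icc hx0.le).1])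

lemma tendsto_nat_mul_exp_neg_div_sub (a b : ℝ) :
    Tendsto (fun n : ℕ => (n : ℝ) * (Real.exp (-(a / n)) - Real.exp (-(b / n)))) atTop
      (𝓝 (b - a)) := by
  have h : HasDerivAt (fun t : ℝ => Real.exp (-(a * t)) - Real.exp (-(b * t))) (b - a) 0 := by
    have h1 : ∀ a : ℝ, HasDerivAt (fun t : ℝ => Real.exp (-(a * t))) (-a) 0 := fun a => by
      have := (((hasDerivAt_id (0 : ℝ)).const_mul a).neg).exp
      simpa using this
    have h2 := (h1 a).sub (h1 b)
    rw [show -a - -b = b - a by ring] at h2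
    exact h2
  have h2 := (hasDerivAt_iff_tendsto_slope_zero.1 h).comp
    (tendsto_inv_atTop_nhdsGT_zero.comp tendsto_natCast_atTop_atTop |>.mono_right
      (nhdsWithin_mono _ fun x (hx : (0 : ℝ) < x) => hx.ne'))
  refine h2.congr fun n => ?_
  simp [div_eq_mul_inv]

/-- Small-time behaviour of the subordinator: `n P(S_{1/n} ∈ dx)` converges to the Lévy measure. -/
lemma tendsto_small_time {Ω : Type*} [MeasurableSpace Ω] {P : Measure Ω} [IsProbabilityMeasure P]
    (hα0 : 0 < α) (hα1 : α < 1) (hc : 0 < c) {S : ℝ≥0 → Ω → ℝ}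
    (hS : IsStableSubordinator S α c P) {q : ℝ → ℝ} (hq : Continuous q) :
    Tendsto (fun n : ℕ => (n : ℝ) * ∫ ω, (1 - Real.exp (-S (1 / n) ω)) *
        q (Real.exp (-S (1 / n) ω)) ∂P) atTop
      (𝓝 (∫ x, (1 - Real.exp (-x)) * q (Real.exp (-x)) ∂(levyMeasure α c))) := by
  have hnn : ∀ t ω, 0 ≤ S t ω := fun t ω => by
    rw [← hS.zero ω]; exact hS.mono ω zero_le
  set μ : ℕ → Measure ℝ := fun n => (n : ℝ≥0∞) • P.map (S (1 / n)) with hμ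
  have hint : ∀ (n : ℕ) (h : ℝ → ℝ), Measurable h → ∫ x, h x ∂(μ n) =
      (n : ℝ) * ∫ ω, h (S (1 / n) ω) ∂P := fun n h hh => by
    rw [hμ]
    simp only
    rw [integral_smul_measure, integral_map (hS.measurable _).aemeasurable
      hh.aestronglyMeasurable]
    simp
  have hμ0 : ∀ n, ∀ᵐ x ∂(μ n), 0 ≤ x := fun n => by
    refine Measure.ae_smul_measure ?_ _
    exact (ae_map_iff (hS.measurable _).aemeasurable measurableSet_Ici).2 (ae_of_all _ (hnn _))
  have hμi : ∀ n, Integrable (fun x => 1 - Real.exp (-x)) (μ n) := fun n => by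
    have : IsProbabilityMeasure (P.map (S (1 / n))) :=
      Measure.isProbabilityMeasure_map (hS.measurable _).aemeasurable
    have : IsFiniteMeasure (μ n) := by
      rw [hμ]; exact Measure.smul_finite _ (by simp)
    refine Integrable.of_bound (by fun_prop) 1 ?_
    filter_upwards [hμ0 n] with x hx
    have := exp_neg_mem_Icc hx
    rw [Real.norm_eq_abs, abs_le]
    constructor <;> linarith [this.1, this.2]
  have hlap : ∀ (n k : ℕ), ∫ ω, Real.exp (-S (1 / n) ω) ^ k ∂P =
      Real.exp (-(laplaceExponent α c k / n)) := fun n k => by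
    have e : ∀ ω, Real.exp (-S (1 / n) ω) ^ k = Real.exp (-(k : ℝ) * S (1 / n) ω) := fun ω => by
      rw [← Real.exp_nat_mul]; ring_nf
    simp_rw [e]
    -- The Laplace transform is given only at positive arguments, so k = 0 is treated apart.
    rcases Nat.eq_zero_or_pos k with rfl | hk
    · simp [laplaceExponent]
    · rw [hS.laplace _ _ (by exact_mod_cast hk)]
      congr 1
      push_cast
      ring
  have hexpi : ∀ (t : ℝ≥0) (k : ℕ), Integrable (fun ω => Real.exp (-S t ω) ^ k) P := fun t k => by
    have := hS.measurable t
    refine Integrable.of_bound (by fun_prop) 1 (ae_of_all _ fun ω => ?_)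
    rw [Real.norm_eq_abs, abs_of_nonneg (by positivity)]
    exact pow_le_one₀ (Real.exp_pos _).le (exp_neg_mem_Icc (hnn _ _)).2
  have hν0 : ∀ᵐ x ∂(levyMeasure α c), 0 ≤ x := ae_levyMeasure_pos.mono fun x hx => hx.le
  have hνi := integrable_levyMeasure hα0 hα1 hc
  have := tendsto_integral_exp_weight hμ0 hν0 hμi hνi (fun k => ?_) hq
  · refine this.congr fun n => ?_
    rw [hint n _ (by fun_prop)]
  · have hνk : ∀ k : ℕ, Integrable (fun x => 1 - Real.exp (-x) ^ k) (levyMeasure α c) := by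
      intro k
      induction k with
      | zero => simp
      | succ k ih =>
        have := ih.add (integrable_exp_weight hν0 hνi (q := fun u => u ^ k) (by fun_prop))
        refine this.congr (ae_of_all _ fun x => ?_)
        simp only [Pi.add_apply]
        ring
    -- The weight times e^(-kx) is e^(-kx) - e^(-(k+1)x). Its Lévy integral is a difference of
    -- Laplace exponents, which is also the derivative at t = 0 of the difference of Laplace
    -- transforms of S_t.
    have hlim : ∫ x, (1 - Real.exp (-x)) * Real.exp (-x) ^ k ∂(levyMeasure α c) =
        laplaceExponent α c (k + 1 : ℕ) - laplaceExponent α c k := by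
      have e : ∀ k : ℕ, laplaceExponent α c k = ∫ x, (1 - Real.exp (-x) ^ k)
          ∂(levyMeasure α c) := fun k => by
        rw [laplaceExponent_eq hα0 hc]
        refine integral_congr_ae (ae_of_all _ fun x => ?_)
        simp only
        rw [← Real.exp_nat_mul]; ring_nf
      rw [e, e, ← integral_sub (hνk _) (hνk _)]
      refine integral_congr_ae (ae_of_all _ fun x => ?_)
      simp only
      ring
    rw [hlim]
    refine (tendsto_nat_mul_exp_neg_div_sub _ _).congr fun n => ?_
    rw [hint n _ (by fun_prop), ← hlap, ← hlap, ← integral_sub (hexpi _ _) (hexpi _ _)]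
    congr 1
    refine integral_congr_ae (ae_of_all _ fun ω => ?_)
    simp only
    ring

end Levy

end TrimmedStable

end

/-! ### The characteristic functionals of the jumps and of the Poisson points. -/

noncomputable section

namespace TrimmedStable

/-- Vanishing near and beyond u = 1 removes the singularity. Together with `one_sub_exp_mul_div`
this brings test functions that vanish for small x into the weighted form required by
`tendsto_small_time`. -/
lemma continuous_div_one_sub {H : ℝ → ℝ} (hH : Continuous H) {ε : ℝ} (hε : 0 < ε)
    (h0 : ∀ u, Real.exp (-ε) ≤ u → H u = 0) : Continuous fun u => H u / (1 - u) := by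
  rw [continuous_iff_continuousAt]
  intro u
  rcases lt_or_ge u 1 with hu | hu
  · exact hH.continuousAt.div (by fun_prop) (by linarith)
  · have h1 : Real.exp (-ε) < u := lt_of_lt_of_le (Real.exp_lt_one_iff.2 (by linarith)) hu
    refine (continuousAt_const (y := (0 : ℝ))).congr ?_
    filter_upwards [Ioi_mem_nhds h1] with v hv
    rw [h0 v (le_of_lt hv), zero_div]

lemma one_sub_exp_mul_div {H : ℝ → ℝ} {ε : ℝ} (hε : 0 < ε)
    (h0 : ∀ u, Real.exp (-ε) ≤ u → H u = 0) (x : ℝ) :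
    (1 - Real.exp (-x)) * (H (Real.exp (-x)) / (1 - Real.exp (-x))) = H (Real.exp (-x)) := by
  by_cases hx : 1 - Real.exp (-x) = 0
  · rw [hx, zero_mul, h0]
    have : Real.exp (-ε) < 1 := Real.exp_lt_one_iff.2 (by linarith)
    linarith
  · rw [mul_div_cancel₀ _ hx]

lemma cexp_I_sub_one (y : ℝ) : Complex.exp (Complex.I * y) - 1 =
    ((Real.cos y - 1 : ℝ) : ℂ) + ((Real.sin y : ℝ) : ℂ) * Complex.I := by
  rw [mul_comm, Complex.exp_mul_I]
  push_cast
  ring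

lemma integral_cexp_I_sub_one {X : Type*} [MeasurableSpace X] {μ : Measure X} {y : X → ℝ}
    (h1 : Integrable (fun x => Real.cos (y x) - 1) μ) (h2 : Integrable (fun x => Real.sin (y x)) μ) :
    ∫ x, (Complex.exp (Complex.I * y x) - 1) ∂μ =
      ((∫ x, (Real.cos (y x) - 1) ∂μ : ℝ) : ℂ) +
        ((∫ x, Real.sin (y x) ∂μ : ℝ) : ℂ) * Complex.I := by
  simp_rw [cexp_I_sub_one]
  rw [integral_add h1.ofReal (h2.ofReal.mul_const _), integral_mul_const]
  simp only [integral_complex_ofReal]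

section Subordinator

variable {Ω : Type*} [MeasurableSpace Ω] {P : Measure Ω}
  {α c : ℝ} {S : ℝ≥0 → Ω → ℝ} {φ : ℝ → ℝ} {ε : ℝ}

lemma tendsto_small_time_cexp [IsProbabilityMeasure P] (hα0 : 0 < α) (hα1 : α < 1) (hc : 0 < c)
    (hS : IsStableSubordinator S α c P) (hφ : Continuous φ) (hε : 0 < ε)
    (h0 : ∀ u, Real.exp (-ε) ≤ u → φ u = 0) :
    Tendsto (fun n : ℕ => (n : ℂ) *
      ∫ ω, (Complex.exp (Complex.I * φ (Real.exp (-S (1 / n) ω))) - 1) ∂P) atTop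
      (𝓝 (∫ x, (Complex.exp (Complex.I * φ (Real.exp (-x))) - 1) ∂(levyMeasure α c))) := by
  have hν0 : ∀ᵐ x ∂(levyMeasure α c), 0 ≤ x := ae_levyMeasure_pos.mono fun x hx => hx.le
  have hνi := integrable_levyMeasure hα0 hα1 hc
  have key : ∀ H : ℝ → ℝ, Continuous H → (∀ u, Real.exp (-ε) ≤ u → H u = 0) →
      Tendsto (fun n : ℕ => (n : ℝ) * ∫ ω, H (Real.exp (-S (1 / n) ω)) ∂P) atTop
        (𝓝 (∫ x, H (Real.exp (-x)) ∂(levyMeasure α c))) ∧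
      Integrable (fun x => H (Real.exp (-x))) (levyMeasure α c) := by
    intro H hH hH0
    have hq := continuous_div_one_sub hH hε hH0
    have h1 := tendsto_small_time hα0 hα1 hc hS hq
    have h2 := integrable_exp_weight hν0 hνi hq
    simp only [one_sub_exp_mul_div hε hH0] at h1 h2
    exact ⟨h1, h2⟩
  obtain ⟨hcos, hcosi⟩ := key (fun u => Real.cos (φ u) - 1) (by fun_prop)
    (fun u hu => by simp [h0 u hu])
  obtain ⟨hsin, hsini⟩ := key (fun u => Real.sin (φ u)) (by fun_prop)
    (fun u hu => by simp [h0 u hu])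
  rw [integral_cexp_I_sub_one hcosi hsini]
  have hL := ((Complex.continuous_ofReal.tendsto _).comp hcos).add
    (((Complex.continuous_ofReal.tendsto _).comp hsin).mul_const Complex.I)
  refine hL.congr fun n => ?_
  have hm := hS.measurable (1 / n)
  have hm' : Measurable fun ω => φ (Real.exp (-S (1 / n) ω)) := hφ.measurable.comp (by fun_prop)
  rw [integral_cexp_I_sub_one]
  · simp only [Function.comp]
    push_cast
    ring
  · refine Integrable.of_bound (by fun_prop) 2 (ae_of_all _ fun ω => ?_)
    rw [Real.norm_eq_abs, abs_le]
    constructor <;> linarith [Real.cos_le_one (φ (Real.exp (-S (1 / n) ω))),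
      Real.neg_one_le_cos (φ (Real.exp (-S (1 / n) ω)))]
  · refine Integrable.of_bound (by fun_prop) 1 (ae_of_all _ fun ω => ?_)
    exact Real.abs_sin_le_one _

/-- The n increments over a mesh 1/n are independent and, by stationarity, all distributed as
S_{1/n}. -/
lemma integral_cexp_sum_increments (hS : IsStableSubordinator S α c P) {f : ℝ → ℝ}
    (hf : Measurable f) {n : ℕ} (hn : 0 < n) :
    ∫ ω, Complex.exp (Complex.I * (∑ k ∈ Finset.range n,
      f (S ((k + 1 : ℕ) / n) ω - S ((k : ℕ) / n) ω) : ℝ)) ∂P =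
      (∫ ω, Complex.exp (Complex.I * f (S (1 / n) ω)) ∂P) ^ n := by
  have hnn : (n : ℝ≥0) ≠ 0 := by exact_mod_cast hn.ne'
  have hmono : Monotone fun i : Fin (n + 1) => ((i : ℕ) : ℝ≥0) / n := fun i j h => by
    have : ((i : ℕ) : ℝ≥0) ≤ (j : ℕ) := by exact_mod_cast h
    simp only
    gcongr
  have hind := hS.indepIncrements n _ hmono
  have hg : Measurable fun x : ℝ => Complex.exp (Complex.I * f x) := by fun_prop
  have hind2 := hind.comp (fun _ => fun x : ℝ => Complex.exp (Complex.I * f x)) (fun _ => hg)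
  have hm := hS.measurable
  have hprod := hind2.integral_fun_prod_eq_prod_integral (fun i =>
    (hg.comp ((hm _).sub (hm _))).aestronglyMeasurable)
  have e1 : ∀ ω, Complex.exp (Complex.I * (∑ k ∈ Finset.range n,
      f (S ((k + 1 : ℕ) / n) ω - S ((k : ℕ) / n) ω) : ℝ)) =
      ∏ i : Fin n, ((fun x : ℝ => Complex.exp (Complex.I * f x)) ∘
        fun ω => S (((i.succ : Fin (n + 1)) : ℕ) / n) ω -
          S (((i.castSucc : Fin (n + 1)) : ℕ) / n) ω) ω := by
    intro ω
    rw [← Fin.sum_univ_eq_sum_range (fun k => f (S ((k + 1 : ℕ) / n) ω - S ((k : ℕ) / n) ω)),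
      Complex.ofReal_sum, Finset.mul_sum, Complex.exp_sum]
    rfl
  simp_rw [e1]
  rw [hprod]
  have e2 : ∀ i : Fin n, ∫ ω, ((fun x : ℝ => Complex.exp (Complex.I * f x)) ∘
        fun ω => S (((i.succ : Fin (n + 1)) : ℕ) / n) ω -
          S (((i.castSucc : Fin (n + 1)) : ℕ) / n) ω) ω ∂P =
      ∫ ω, Complex.exp (Complex.I * f (S (1 / n) ω)) ∂P := by
    intro i
    have hst := (hS.stationary (((i : ℕ) : ℝ≥0) / n) (1 / n)).comp hg
    have e3 : ((i : ℕ) : ℝ≥0) / n + 1 / n = ((i.succ : Fin (n + 1)) : ℕ) / n := by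
      rw [Fin.val_succ]; push_cast; ring
    rw [e3] at hst
    exact hst.integral_eq
  rw [Finset.prod_congr rfl fun i _ => e2 i, Finset.prod_const, Finset.card_univ, Fintype.card_fin]

/-- The path of the subordinator, as a monotone right-continuous function. -/
def IsStableSubordinator.path (hS : IsStableSubordinator S α c P) (ω : Ω) : StieltjesFunction ℝ≥0 :=
  ⟨fun t => S t ω, hS.mono ω, hS.rightContinuous ω⟩

/-- The sum of `f` over the jumps up till time `1`. -/
def jumpSum (S : ℝ≥0 → Ω → ℝ) (f : ℝ → ℝ) (ω : Ω) : ℝ :=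
  ∑ᶠ t ∈ Set.Ioc (0 : ℝ≥0) 1, f (jump S t ω)

lemma tendsto_jumpSum (hS : IsStableSubordinator S α c P) {f : ℝ → ℝ} (hf : Continuous f)
    (hε : 0 < ε) (h0 : ∀ x, x ≤ ε → f x = 0) (ω : Ω) :
    Tendsto (fun n : ℕ => ∑ k ∈ Finset.range n, f (S ((k + 1 : ℕ) / n) ω - S ((k : ℕ) / n) ω))
      atTop (𝓝 (jumpSum S f ω)) :=
  tendsto_sum_increments (hS.path ω) hf hε h0

lemma measurable_jumpSum (hS : IsStableSubordinator S α c P) {f : ℝ → ℝ} (hf : Continuous f)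
    (hε : 0 < ε) (h0 : ∀ x, x ≤ ε → f x = 0) : Measurable (jumpSum S f) := by
  refine measurable_of_tendsto_metrizable (fun n => ?_)
    (tendsto_pi_nhds.2 (tendsto_jumpSum hS hf hε h0))
  have := hS.measurable
  refine Finset.measurable_sum _ fun k _ => hf.measurable.comp (by fun_prop)

/-- The characteristic functional of the jumps of the subordinator. -/
lemma integral_cexp_jumpSum [IsProbabilityMeasure P] (hα0 : 0 < α) (hα1 : α < 1) (hc : 0 < c)
    (hS : IsStableSubordinator S α c P) (hφ : Continuous φ) (hε : 0 < ε)
    (h0 : ∀ u, Real.exp (-ε) ≤ u → φ u = 0) :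
    ∫ ω, Complex.exp (Complex.I * jumpSum S (fun x => φ (Real.exp (-x))) ω) ∂P =
      Complex.exp (∫ x, (Complex.exp (Complex.I * φ (Real.exp (-x))) - 1)
        ∂(levyMeasure α c)) := by
  set f : ℝ → ℝ := fun x => φ (Real.exp (-x)) with hf
  have hfc : Continuous f := by fun_prop
  have hf0 : ∀ x, x ≤ ε → f x = 0 := fun x hx => h0 _ (Real.exp_le_exp.2 (by linarith))
  have hm := hS.measurable
  have h1 : Tendsto (fun n : ℕ => ∫ ω, Complex.exp (Complex.I * (∑ k ∈ Finset.range n,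
      f (S ((k + 1 : ℕ) / n) ω - S ((k : ℕ) / n) ω) : ℝ)) ∂P) atTop
      (𝓝 (∫ ω, Complex.exp (Complex.I * jumpSum S f ω) ∂P)) := by
    refine tendsto_integral_of_dominated_convergence (fun _ => 1) (fun n => ?_)
      (integrable_const _) (fun n => ae_of_all _ fun ω => (norm_cexp_I_mul _).le)
      (ae_of_all _ fun ω => ?_)
    · have : ∀ k : ℕ, Measurable fun ω => f (S ((k + 1 : ℕ) / n) ω - S ((k : ℕ) / n) ω) :=
        fun k => hfc.measurable.comp (by fun_prop)
      exact Measurable.aestronglyMeasurable (by fun_prop)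
    · exact (Continuous.tendsto (f := fun y : ℝ => Complex.exp (Complex.I * y))
        (by fun_prop) _).comp (tendsto_jumpSum hS hfc hε hf0 ω)
  refine tendsto_nhds_unique h1 ?_
  -- Each factor is 1 + z_n / n with z_n = n E(e^(if(S_{1/n})) - 1), and z_n converges to the Lévy
  -- integral.
  refine (Complex.tendsto_one_add_pow_exp_of_tendsto
    (tendsto_small_time_cexp hα0 hα1 hc hS hφ hε h0)).congr' ?_
  filter_upwards [eventually_gt_atTop 0] with n hn
  rw [integral_cexp_sum_increments hS hfc.measurable hn, integral_sub]
  · simp [hf]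
  · have : Measurable fun ω => φ (Real.exp (-S (1 / n) ω)) := hφ.measurable.comp (by fun_prop)
    exact Integrable.of_bound (Measurable.aestronglyMeasurable (by fun_prop)) 1
      (ae_of_all _ fun ω => (norm_cexp_I_mul _).le)
  · exact integrable_const _

end Subordinator

section Reference

variable {α c : ℝ} {φ : ℝ → ℝ} {ε : ℝ}

/-- The tail Λ(x, ∞) is c x^(-α), so v = c x^(-α) carries the Lévy measure to Lebesgue measure on
(0, ∞). -/
lemma integral_levyMeasure_comp (hα0 : 0 < α) (hc : 0 < c) (h : ℝ → ℂ) :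
    ∫ x, h x ∂(levyMeasure α c) = ∫ v in Set.Ioi 0, h ((v / c) ^ (-1 / α)) := by
  have h1 := integral_comp_rpow_Ioi (fun y => h (y ^ (-1 / α))) (p := -α) (by linarith)
  have h2 := integral_comp_mul_left_Ioi (fun y => h (y ^ (-1 / α))) 0 (b := c⁻¹) (by positivity)
  rw [mul_zero, inv_inv] at h2
  simp_rw [div_eq_inv_mul _ c]
  rw [h2, ← h1, integral_levyMeasure hα0 hc, ← integral_smul]
  refine setIntegral_congr_fun measurableSet_Ioi fun x hx => ?_
  have hx0 : (0 : ℝ) < x := hx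
  have e : (x ^ (-α)) ^ (-1 / α) = x := by
    rw [← Real.rpow_mul hx0.le, show -α * (-1 / α) = 1 by field_simp, Real.rpow_one]
  rw [e, abs_neg, abs_of_pos hα0, smul_smul, mul_assoc]

/-- The points of a Poisson process with intensity the Lévy measure, in decreasing order. -/
def refPoint (α c : ℝ) (e : ℕ → ℝ) (i : ℕ) : ℝ := (arrival e i / c) ^ (-1 / α)

/-- An instance of `charFull_zero`. The map from arrivals to points is decreasing, so a test
function killing points up to ε becomes a function of the arrivals killing everything from K = c
ε^(-α) on. The value is the one found for the jumps in `integral_cexp_jumpSum`. -/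
lemma integral_cexp_refPoint (hα0 : 0 < α) (hc : 0 < c) (hφ : Continuous φ) (hε : 0 < ε)
    (h0 : ∀ u, Real.exp (-ε) ≤ u → φ u = 0) :
    ∫ e, Complex.exp (Complex.I * (∑' i, φ (Real.exp (-refPoint α c e i)) : ℝ)) ∂expSeq =
      Complex.exp (∫ x, (Complex.exp (Complex.I * φ (Real.exp (-x))) - 1)
        ∂(levyMeasure α c)) := by
  set ψ : ℝ → ℝ := fun v => φ (Real.exp (-(v / c) ^ (-1 / α))) with hψ
  set K : ℝ := c * ε ^ (-α) with hK
  have hK0 : 0 < K := by positivity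
  have hψm : Measurable ψ := hφ.measurable.comp (by fun_prop)
  have hψc : ContinuousOn ψ (Set.Ioi 0) := by
    refine hφ.comp_continuousOn (Real.continuous_exp.comp_continuousOn (ContinuousOn.neg ?_))
    refine ContinuousOn.rpow_const (by fun_prop) fun v hv => Or.inl ?_
    have : (0 : ℝ) < v := hv
    positivity
  have hψ0 : ∀ v, K ≤ v → ψ v = 0 := fun v hv => by
    refine h0 _ (Real.exp_le_exp.2 (neg_le_neg ?_))
    have h1 : ε ^ (-α) ≤ v / c := by rw [le_div_iff₀ hc, mul_comm]; exact hv
    have h2 := Real.rpow_le_rpow_of_nonpos (z := -1 / α) (by positivity) h1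
      (div_nonpos_of_nonpos_of_nonneg (by norm_num) hα0.le)
    rwa [← Real.rpow_mul hε.le, show -α * (-1 / α) = 1 by field_simp, Real.rpow_one] at h2
  have h1 := charFull_zero hψm hψc hK0 hψ0
  rw [integral_levyMeasure_comp hα0 hc]
  simp only [charFull, zero_add] at h1
  refine h1.trans ?_
  congr 1
  rw [intervalIntegral.integral_of_le hK0.le]
  refine (setIntegral_eq_of_subset_of_forall_sdiff_eq_zero measurableSet_Ioi
    (fun x hx => hx.1) fun v hv => ?_).symm
  have : K ≤ v := by
    by_contra! h
    exact hv.2 ⟨hv.1, h.le⟩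
  change Complex.exp (Complex.I * ψ v) - 1 = 0
  rw [hψ0 v this]
  simp

end Reference

end TrimmedStable

end

/-! ### Ordered points recovered from sums over points. -/

noncomputable section

namespace TrimmedStable

/-- Continuous approximations, as functions of `e^{-x}`, of the indicator of `(y, ∞)`. -/
def ramp (y : ℝ) (n : ℕ) (u : ℝ) : ℝ := max 0 (min 1 (n * (Real.exp (-y) - u) - 1))

lemma continuous_ramp (y : ℝ) (n : ℕ) : Continuous (ramp y n) := by unfold ramp; fun_prop

lemma ramp_nonneg (y : ℝ) (n : ℕ) (u : ℝ) : 0 ≤ ramp y n u := le_max_left _ _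

lemma ramp_le_one (y : ℝ) (n : ℕ) (u : ℝ) : ramp y n u ≤ 1 :=
  max_le zero_le_one (min_le_left _ _)

/-- The summand -1 in `ramp` serves this purpose: it kills small x even at y = 0, where e^(-y) - u
is at most 1/(n+1) in this range. Sums of ramps over points then have finitely many nonzero terms.
-/
lemma ramp_eq_zero {y : ℝ} (hy : 0 ≤ y) (n : ℕ) {u : ℝ}
    (hu : Real.exp (-(1 / (n + 1 : ℝ))) ≤ u) : ramp y n u = 0 := by
  refine max_eq_left ((min_le_right _ _).trans ?_)
  have h1 : Real.exp (-y) ≤ 1 := (exp_neg_mem_Icc hy).2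
  have h2 : 1 - 1 / (n + 1 : ℝ) ≤ u := by linarith [Real.add_one_le_exp (-(1 / (n + 1 : ℝ)))]
  have h3 : (n : ℝ) * (Real.exp (-y) - u) ≤ n * (1 / (n + 1 : ℝ)) :=
    mul_le_mul_of_nonneg_left (by linarith) (Nat.cast_nonneg n)
  have h4 : (n : ℝ) * (1 / (n + 1 : ℝ)) ≤ 1 := by
    rw [mul_one_div, div_le_one (by positivity)]; linarith
  linarith

lemma ramp_mono (y : ℝ) (u : ℝ) : Monotone fun n => ramp y n u := by
  intro i j hij
  have hij' : (i : ℝ) ≤ j := by exact_mod_cast hij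
  unfold ramp
  rcases le_or_gt u (Real.exp (-y)) with h | h
  · have : 0 ≤ Real.exp (-y) - u := by linarith
    simp only
    gcongr
  · have : min 1 (i * (Real.exp (-y) - u) - 1) ≤ 0 := by
      refine (min_le_right _ _).trans ?_
      have : (i : ℝ) * (Real.exp (-y) - u) ≤ 0 :=
        mul_nonpos_of_nonneg_of_nonpos (Nat.cast_nonneg i) (by linarith)
      linarith
    simp only
    rw [max_eq_left this]
    exact le_max_left _ _

lemma lt_of_ramp_ne_zero {y x : ℝ} {n : ℕ} (h : ramp y n (Real.exp (-x)) ≠ 0) : y < x := by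
  by_contra! hxy
  refine h (max_eq_left ((min_le_right _ _).trans ?_))
  have h1 : Real.exp (-y) ≤ Real.exp (-x) := Real.exp_le_exp.2 (by linarith)
  have : (n : ℝ) * (Real.exp (-y) - Real.exp (-x)) ≤ 0 :=
    mul_nonpos_of_nonneg_of_nonpos (Nat.cast_nonneg n) (by linarith)
  linarith

lemma eventually_ramp_eq_one {y x : ℝ} (h : y < x) :
    ∀ᶠ n : ℕ in atTop, ramp y n (Real.exp (-x)) = 1 := by
  have h1 : 0 < Real.exp (-y) - Real.exp (-x) := sub_pos.2 (Real.exp_lt_exp.2 (by linarith))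
  filter_upwards [(tendsto_natCast_atTop_atTop.atTop_mul_const h1).eventually_ge_atTop 2] with n hn
  unfold ramp
  rw [min_eq_left (by linarith), max_eq_right zero_le_one]

section Count

variable {ι : Type*} {s : Set ι} {x : ι → ℝ} {y : ℝ}

/-- The ramps increase to the indicator of (y, ∞). On any i chosen points above y they are
eventually all 1, so the sum passes i - 1; conversely each term is at most 1 and lives above y, so a
sum beyond i - 1 needs at least i points. -/
lemma le_encard_iff_exists_lt_finsum_ramp
    (hfin : ∀ n : ℕ, (s ∩ Function.support fun t => ramp y n (Real.exp (-x t))).Finite) (i : ℕ) :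
    (i : ℕ∞) ≤ Set.encard {t | t ∈ s ∧ y < x t} ↔
      ∃ n : ℕ, (i : ℝ) - 1 < ∑ᶠ t ∈ s, ramp y n (Real.exp (-x t)) := by
  have hsum : ∀ n, ∑ᶠ t ∈ s, ramp y n (Real.exp (-x t)) =
      ∑ t ∈ (hfin n).toFinset, ramp y n (Real.exp (-x t)) := fun n => by
    refine finsum_mem_eq_sum_of_inter_support_eq _ ?_
    ext t; simp +contextual
  constructor
  · intro h
    obtain ⟨F, hF, hcard⟩ := Set.exists_subset_encard_eq h
    have hFfin : F.Finite := Set.finite_of_encard_eq_coe hcard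
    have h1 : ∀ᶠ n : ℕ in atTop, ∀ t ∈ F, ramp y n (Real.exp (-x t)) = 1 :=
      (hFfin.eventually_all).2 fun t ht => eventually_ramp_eq_one (hF ht).2
    obtain ⟨n, hn⟩ := h1.exists
    refine ⟨n, ?_⟩
    have hsub : hFfin.toFinset ⊆ (hfin n).toFinset := by
      intro t ht
      rw [Set.Finite.mem_toFinset] at ht ⊢
      exact ⟨(hF ht).1, by simp [hn t ht]⟩
    have h2 : ∑ t ∈ hFfin.toFinset, ramp y n (Real.exp (-x t)) = i := by
      rw [Finset.sum_congr rfl fun t ht => hn t (hFfin.mem_toFinset.1 ht)]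
      rw [hFfin.encard_eq_coe_toFinset_card] at hcard
      simp only [Finset.sum_const, nsmul_eq_mul, mul_one]
      exact_mod_cast hcard
    have h3 := Finset.sum_le_sum_of_subset_of_nonneg hsub
      (f := fun t => ramp y n (Real.exp (-x t))) fun t _ _ => ramp_nonneg _ _ _
    rw [hsum]
    linarith
  · rintro ⟨n, hn⟩
    rw [hsum] at hn
    have h1 : ∑ t ∈ (hfin n).toFinset, ramp y n (Real.exp (-x t)) ≤ (hfin n).toFinset.card := by
      have := Finset.sum_le_card_nsmul (hfin n).toFinset
        (fun t => ramp y n (Real.exp (-x t))) 1 fun t _ => ramp_le_one _ _ _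
      simpa using this
    have h2 : i ≤ (hfin n).toFinset.card := by
      have : (i : ℝ) < (hfin n).toFinset.card + 1 := by linarith
      have : i < (hfin n).toFinset.card + 1 := by exact_mod_cast this
      omega
    calc (i : ℕ∞) ≤ ((hfin n).toFinset.card : ℕ∞) := by exact_mod_cast h2
      _ = Set.encard (s ∩ Function.support fun t => ramp y n (Real.exp (-x t))) := by
          rw [(hfin n).encard_eq_coe_toFinset_card]
      _ ≤ Set.encard {t | t ∈ s ∧ y < x t} :=
          Set.encard_le_encard fun t ht => ⟨ht.1, lt_of_ramp_ne_zero ht.2⟩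

lemma finsum_ramp_mono
    (hfin : ∀ n : ℕ, (s ∩ Function.support fun t => ramp y n (Real.exp (-x t))).Finite) :
    Monotone fun n : ℕ => ∑ᶠ t ∈ s, ramp y n (Real.exp (-x t)) := by
  intro i j hij
  have h : ∀ n ≤ j, ∑ᶠ t ∈ s, ramp y n (Real.exp (-x t)) =
      ∑ t ∈ (hfin j).toFinset, ramp y n (Real.exp (-x t)) := fun n hn => by
    refine finsum_mem_eq_sum_of_inter_support_eq _ ?_
    ext t
    simp only [Set.mem_inter_iff, Function.mem_support, Set.Finite.coe_toFinset]
    constructor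
    · rintro ⟨h1, h2⟩
      refine ⟨⟨h1, fun h0 => h2 (le_antisymm ?_ (ramp_nonneg _ _ _))⟩, h2⟩
      rw [← h0]; exact ramp_mono y _ hn
    · rintro ⟨⟨h1, _⟩, h2⟩
      exact ⟨h1, h2⟩
  simp only
  rw [h i hij, h j le_rfl]
  exact Finset.sum_le_sum fun t _ => ramp_mono y _ hij

end Count

section OrderedJumps

lemma orderedJump_nonneg {Ω : Type*} {S : ℝ≥0 → Ω → ℝ} (i : ℕ) (ω : Ω) : 0 ≤ orderedJump S i ω :=
  Real.sSup_nonneg fun _ hx => hx.1.le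

variable {Ω : Type*} [MeasurableSpace Ω] {P : Measure Ω} {α c : ℝ} {S : ℝ≥0 → Ω → ℝ}

/-- Among i jumps above y the smallest is again above y and is admissible in the supremum. The
supremum is finite because no jump exceeds S_1 - S_0; this uses i ≥ 1. -/
lemma lt_orderedJump_iff (hS : IsStableSubordinator S α c P) {i : ℕ} (hi : 1 ≤ i) {y : ℝ}
    (hy : 0 ≤ y) (ω : Ω) : y < orderedJump S i ω ↔
      (i : ℕ∞) ≤ Set.encard {t : ℝ≥0 | t ∈ Set.Ioc (0 : ℝ≥0) 1 ∧ y < jump S t ω} := by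
  set A := {x : ℝ | 0 < x ∧
    (i : ℕ∞) ≤ Set.encard {t : ℝ≥0 | t ∈ Set.Ioc (0 : ℝ≥0) 1 ∧ x ≤ jump S t ω}} with hA
  have hbdd : BddAbove A := by
    refine ⟨S 1 ω - S 0 ω, fun x hx => ?_⟩
    have h1 : (1 : ℕ∞) ≤ Set.encard {t : ℝ≥0 | t ∈ Set.Ioc (0 : ℝ≥0) 1 ∧ x ≤ jump S t ω} :=
      le_trans (by exact_mod_cast hi) hx.2
    obtain ⟨t, ht⟩ := Set.one_le_encard_iff_nonempty.1 h1
    exact ht.2.trans (pathJump_le (hS.path ω) ht.1)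
  change y < sSup A ↔ _
  constructor
  · intro h
    have hne : A.Nonempty := by
      by_contra hne
      rw [Set.not_nonempty_iff_eq_empty.1 hne, Real.sSup_empty] at h
      linarith
    obtain ⟨x, hx, hyx⟩ := exists_lt_of_lt_csSup hne h
    exact hx.2.trans (Set.encard_le_encard fun t ht => ⟨ht.1, hyx.trans_le ht.2⟩)
  · intro h
    obtain ⟨F, hF, hcard⟩ := Set.exists_subset_encard_eq h
    have hFfin : F.Finite := Set.finite_of_encard_eq_coe hcard
    have hne : F.Nonempty := by
      rw [← Set.one_le_encard_iff_nonempty, hcard]; exact_mod_cast hi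
    obtain ⟨t, htF, ht⟩ := Set.exists_min_image F (fun t => jump S t ω) hFfin hne
    refine (hF htF).2.trans_le (le_csSup hbdd ⟨hy.trans_lt (hF htF).2, ?_⟩)
    rw [← hcard]
    exact Set.encard_le_encard fun s hs => ⟨(hF hs).1, ht s hs⟩

lemma finite_support_jump (hS : IsStableSubordinator S α c P) {ε : ℝ} (hε : 0 < ε) {f : ℝ → ℝ}
    (h0 : ∀ x, x ≤ ε → f x = 0) (ω : Ω) :
    (Set.Ioc (0 : ℝ≥0) 1 ∩ Function.support fun t => f (jump S t ω)).Finite := by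
  refine (finite_le_pathJump (hS.path ω) 0 1 hε).subset fun t ht => ⟨ht.1, ?_⟩
  by_contra! h
  exact ht.2 (h0 _ h.le)

lemma ramp_exp_eq_zero {y : ℝ} (hy : 0 ≤ y) (n : ℕ) (x : ℝ) (hx : x ≤ 1 / (n + 1 : ℝ)) :
    ramp y n (Real.exp (-x)) = 0 := ramp_eq_zero hy n (Real.exp_le_exp.2 (by linarith))

lemma lt_orderedJump_iff_exists (hS : IsStableSubordinator S α c P) {i : ℕ} (hi : 1 ≤ i) {y : ℝ}
    (hy : 0 ≤ y) (ω : Ω) : y < orderedJump S i ω ↔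
      ∃ n : ℕ, (i : ℝ) - 1 < jumpSum S (fun x => ramp y n (Real.exp (-x))) ω := by
  rw [lt_orderedJump_iff hS hi hy, le_encard_iff_exists_lt_finsum_ramp]
  · rfl
  · intro n
    exact finite_support_jump hS (ε := 1 / (n + 1 : ℝ)) (by positivity) (ramp_exp_eq_zero hy n) ω

lemma measurable_jumpSum_ramp (hS : IsStableSubordinator S α c P) {y : ℝ} (hy : 0 ≤ y) (n : ℕ) :
    Measurable (jumpSum S fun x => ramp y n (Real.exp (-x))) :=
  measurable_jumpSum hS ((continuous_ramp y n).comp (by fun_prop))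
    (ε := 1 / (n + 1 : ℝ)) (by positivity) (ramp_exp_eq_zero hy n)

lemma measurable_orderedJump (hS : IsStableSubordinator S α c P) (i : ℕ) :
    Measurable (orderedJump S i) := by
  rcases Nat.eq_zero_or_pos i with rfl | hi
  -- For i = 0 every positive x is admissible, and the supremum of an unbounded set is 0 by
  -- convention.
  · have : orderedJump S 0 = fun _ => 0 := by
      funext ω
      refine Real.sSup_of_not_bddAbove ?_
      have : {x : ℝ | 0 < x ∧ ((0 : ℕ) : ℕ∞) ≤
          Set.encard {t : ℝ≥0 | t ∈ Set.Ioc (0 : ℝ≥0) 1 ∧ x ≤ jump S t ω}} = Set.Ioi 0 := by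
        ext x; simp
      rw [this]
      exact not_bddAbove_Ioi 0
    rw [this]
    exact measurable_const
  · refine measurable_of_Ioi fun y => ?_
    rcases lt_or_ge y 0 with hy | hy
    · have : orderedJump S i ⁻¹' Set.Ioi y = Set.univ := by
        ext ω; simpa using hy.trans_le (orderedJump_nonneg i ω)
      rw [this]
      exact MeasurableSet.univ
    · have : orderedJump S i ⁻¹' Set.Ioi y =
          ⋃ n : ℕ, jumpSum S (fun x => ramp y n (Real.exp (-x))) ⁻¹' Set.Ioi ((i : ℝ) - 1) := by
        ext ω
        simp only [Set.mem_preimage, Set.mem_Ioi, Set.mem_iUnion]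
        exact lt_orderedJump_iff_exists hS hi hy ω
      rw [this]
      exact MeasurableSet.iUnion fun n => measurable_jumpSum_ramp hS hy n measurableSet_Ioi

end OrderedJumps

section ReferencePoints

variable {α c : ℝ}

lemma arrival_pos {e : ℕ → ℝ} (he : ∀ n, 0 < e n) (i : ℕ) : 0 < arrival e i := by
  rw [← psum_zero e]; exact strictMono_psum he (Nat.succ_pos i)

lemma refPoint_strictAnti (hα0 : 0 < α) (hc : 0 < c) {e : ℕ → ℝ} (he : ∀ n, 0 < e n) :
    StrictAnti (refPoint α c e) := by
  intro i j hij
  refine Real.rpow_lt_rpow_of_neg (div_pos (arrival_pos he i) hc) ?_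
    (div_neg_of_neg_of_pos (by norm_num) hα0)
  exact div_lt_div_of_pos_right (strictMono_psum he (Nat.succ_lt_succ hij)) hc

lemma refPoint_pos (hc : 0 < c) {e : ℕ → ℝ} (he : ∀ n, 0 < e n) (i : ℕ) :
    0 < refPoint α c e i := Real.rpow_pos_of_pos (div_pos (arrival_pos he i) hc) _

lemma tendsto_refPoint (hα0 : 0 < α) (hc : 0 < c) {e : ℕ → ℝ}
    (he : Tendsto (psum e) atTop atTop) : Tendsto (refPoint α c e) atTop (𝓝 0) := by
  have h1 : Tendsto (fun i => arrival e i / c) atTop atTop :=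
    (he.comp (tendsto_add_atTop_nat 1)).atTop_div_const hc
  have h2 := (tendsto_rpow_neg_atTop (y := 1 / α) (by positivity)).comp h1
  refine h2.congr fun i => ?_
  simp [refPoint, neg_div]

@[fun_prop] lemma measurable_refPoint : Measurable (refPoint α c) := by
  refine measurable_pi_iff.2 fun i => ?_
  unfold refPoint; fun_prop

lemma finite_support_refPoint (hα0 : 0 < α) (hc : 0 < c) {e : ℕ → ℝ}
    (he : Tendsto (psum e) atTop atTop) {f : ℝ → ℝ} {ε : ℝ} (hε : 0 < ε)
    (h0 : ∀ x, x ≤ ε → f x = 0) : (Function.support fun i => f (refPoint α c e i)).Finite := by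
  have h1 := (tendsto_refPoint hα0 hc he).eventually_lt_const hε
  obtain ⟨N, hN⟩ := eventually_atTop.1 h1
  refine (Set.finite_lt_nat N).subset fun i hi => ?_
  by_contra! h
  exact hi (h0 _ (hN i (not_lt.1 h)).le)

/-- The sum of `f` over the points of the reference Poisson process. -/
def refSum (α c : ℝ) (f : ℝ → ℝ) (e : ℕ → ℝ) : ℝ := ∑' i, f (refPoint α c e i)

lemma aemeasurable_refSum (hα0 : 0 < α) (hc : 0 < c) {f : ℝ → ℝ} (hf : Measurable f) {ε : ℝ}
    (hε : 0 < ε) (h0 : ∀ x, x ≤ ε → f x = 0) : AEMeasurable (refSum α c f) expSeq := by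
  refine aemeasurable_of_tendsto_metrizable_ae atTop
    (f := fun N e => ∑ i ∈ Finset.range N, f (refPoint α c e i)) (fun N => ?_) ?_
  · refine (Finset.measurable_sum _ fun i _ => hf.comp ?_).aemeasurable
    exact (measurable_pi_apply i).comp measurable_refPoint
  · filter_upwards [ae_tendsto_psum] with e he
    exact (summable_of_hasFiniteSupport
      (finite_support_refPoint hα0 hc he hε h0)).hasSum.tendsto_sum_nat

/-- The points decrease strictly, so the one of index j exceeds y exactly when at least j + 1 of
them do, and the counting criterion applies. -/
lemma lt_refPoint_iff (hα0 : 0 < α) (hc : 0 < c) {e : ℕ → ℝ} (hpos : ∀ n, 0 < e n)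
    (he : Tendsto (psum e) atTop atTop) (j : ℕ) {y : ℝ} (hy : 0 ≤ y) :
    y < refPoint α c e j ↔
      ∃ n : ℕ, ((j + 1 : ℕ) : ℝ) - 1 < refSum α c (fun x => ramp y n (Real.exp (-x))) e := by
  have hfin := fun n : ℕ => finite_support_refPoint hα0 hc he (ε := 1 / (n + 1 : ℝ))
    (by positivity) (ramp_exp_eq_zero hy n)
  have h1 := le_encard_iff_exists_lt_finsum_ramp (s := Set.univ) (x := refPoint α c e) (y := y)
    (by simpa using hfin) (j + 1)
  have h2 : ∀ n : ℕ, refSum α c (fun x => ramp y n (Real.exp (-x))) e =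
      ∑ᶠ t ∈ (Set.univ : Set ℕ), ramp y n (Real.exp (-refPoint α c e t)) := fun n => by
    rw [finsum_mem_univ, refSum, tsum_eq_finsum (hfin n)]
  simp_rw [h2]
  rw [← h1]
  simp only [Set.mem_univ, true_and]
  have hanti := refPoint_strictAnti hα0 hc hpos
  constructor
  · intro h
    calc ((j + 1 : ℕ) : ℕ∞) = ((Finset.range (j + 1) : Finset ℕ) : Set ℕ).encard := by
          rw [Set.encard_coe_eq_coe_finsetCard, Finset.card_range]
      _ ≤ _ := Set.encard_le_encard fun i hi => by
          have : i ≤ j := by simpa [Nat.lt_succ_iff] using hi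
          exact h.trans_le (hanti.antitone this)
  · intro h
    by_contra! hle
    have h3 : Set.encard {i | y < refPoint α c e i} ≤ ((Finset.range j : Finset ℕ) : Set ℕ).encard :=
      Set.encard_le_encard fun i hi => by
        rw [Finset.coe_range]
        by_contra! hij
        exact absurd hi (not_lt.2 ((hanti.antitone (not_lt.1 hij)).trans hle))
    rw [Set.encard_coe_eq_coe_finsetCard, Finset.card_range] at h3
    have := h.trans h3
    have : j + 1 ≤ j := by exact_mod_cast this
    omega

end ReferencePoints

end TrimmedStable

end

/-! ### Equality in law of the ordered jumps and the ordered Poisson points. -/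

noncomputable section

namespace TrimmedStable

section JointLaw

variable {Ω : Type*} [MeasurableSpace Ω] {P : Measure Ω} {α c : ℝ} {S : ℝ≥0 → Ω → ℝ}

lemma finsum_mem_sum_mul {ι κ : Type*} {s : Set ι} (t : Finset κ) (a : κ → ℝ) (f : κ → ι → ℝ)
    (hfin : ∀ j, (s ∩ Function.support (f j)).Finite) :
    ∑ᶠ i ∈ s, ∑ j ∈ t, a j * f j i = ∑ j ∈ t, a j * ∑ᶠ i ∈ s, f j i := by
  classical
  set E : Finset ι := t.biUnion fun j => (hfin j).toFinset with hE
  have hsub : ∀ j ∈ t, s ∩ Function.support (f j) ⊆ E := fun j hj i hi => by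
    simp only [hE, Finset.mem_coe, Finset.mem_biUnion, Set.Finite.mem_toFinset]
    exact ⟨j, hj, hi⟩
  have hEs : ∀ i ∈ E, i ∈ s := fun i hi => by
    simp only [hE, Finset.mem_biUnion, Set.Finite.mem_toFinset] at hi
    obtain ⟨j, _, hj⟩ := hi
    exact hj.1
  have key : ∀ g : ι → ℝ, s ∩ Function.support g ⊆ E → ∑ᶠ i ∈ s, g i = ∑ i ∈ E, g i := by
    intro g hg
    refine finsum_mem_eq_sum_of_inter_support_eq _ ?_
    ext i
    exact ⟨fun h => ⟨hg h, h.2⟩, fun h => ⟨hEs i h.1, h.2⟩⟩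
  rw [key, Finset.sum_comm]
  · refine Finset.sum_congr rfl fun j hj => ?_
    rw [key _ (hsub j hj), Finset.mul_sum]
  · rintro i ⟨his, hi⟩
    obtain ⟨j, hj, hne⟩ := Finset.exists_ne_zero_of_sum_ne_zero hi
    exact hsub j hj ⟨his, right_ne_zero_of_mul hne⟩

/-- The sums over the jumps have the same joint law as the sums over the reference points. -/
lemma map_jumpSum_eq [IsProbabilityMeasure P] (hα0 : 0 < α) (hα1 : α < 1) (hc : 0 < c)
    (hS : IsStableSubordinator S α c P) {ι : Type} [Fintype ι] {φ : ι → ℝ → ℝ}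
    (hφ : ∀ j, Continuous (φ j)) {ε : ℝ} (hε : 0 < ε)
    (h0 : ∀ j u, Real.exp (-ε) ≤ u → φ j u = 0) :
    P.map (fun ω => WithLp.toLp 2 fun j => jumpSum S (fun x => φ j (Real.exp (-x))) ω) =
      expSeq.map
        (fun e => WithLp.toLp 2 fun j => refSum α c (fun x => φ j (Real.exp (-x))) e) := by
  have h0' : ∀ j x, x ≤ ε → φ j (Real.exp (-x)) = 0 := fun j x hx =>
    h0 j _ (Real.exp_le_exp.2 (by linarith))
  have hm1 : Measurable fun ω => WithLp.toLp 2 fun j =>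
      jumpSum S (fun x => φ j (Real.exp (-x))) ω :=
    (PiLp.continuous_toLp 2 _).measurable.comp (measurable_pi_iff.2 fun j =>
      measurable_jumpSum hS ((hφ j).comp (by fun_prop)) hε (h0' j))
  have hm2 : AEMeasurable (fun e => WithLp.toLp 2 fun j =>
      refSum α c (fun x => φ j (Real.exp (-x))) e) expSeq :=
    (PiLp.continuous_toLp 2 _).measurable.comp_aemeasurable (aemeasurable_pi_iff.2 fun j =>
      aemeasurable_refSum hα0 hc ((hφ j).measurable.comp (by fun_prop)) hε (h0' j))
  have := Measure.isProbabilityMeasure_map hm1.aemeasurable (μ := P)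
  have := Measure.isProbabilityMeasure_map hm2
  refine Measure.ext_of_charFun ?_
  ext a
  -- A linear form in the vector of sums is the sum of the single function ∑ a_j φ_j, so the scalar
  -- characteristic functionals determine the joint law.
  have ha1 : Continuous fun u => ∑ j, a j * φ j u := by fun_prop
  have ha0 : ∀ u, Real.exp (-ε) ≤ u → ∑ j, a j * φ j u = 0 := fun u hu =>
    Finset.sum_eq_zero fun j _ => by rw [h0 j u hu, mul_zero]
  have key := (integral_cexp_jumpSum hα0 hα1 hc hS ha1 hε ha0).trans
    (integral_cexp_refPoint hα0 hc ha1 hε ha0).symm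
  rw [charFun_apply, charFun_apply, integral_map hm1.aemeasurable (by fun_prop),
    integral_map hm2 (by fun_prop)]
  convert key using 1
  · refine integral_congr_ae (ae_of_all _ fun ω => ?_)
    simp only [PiLp.inner_apply]
    rw [mul_comm Complex.I]
    congr 3
    rw [jumpSum, finsum_mem_sum_mul]
    · refine Finset.sum_congr rfl fun j _ => ?_
      simp [jumpSum]
    · exact fun j => finite_support_jump hS hε (h0' j) ω
  · refine integral_congr_ae ?_
    filter_upwards [ae_tendsto_psum] with e he
    simp only [PiLp.inner_apply]
    rw [mul_comm Complex.I]
    congr 3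
    have hs : ∀ j, Summable fun i => φ j (Real.exp (-refPoint α c e i)) := fun j =>
      summable_of_hasFiniteSupport (finite_support_refPoint hα0 hc he hε (h0' j))
    rw [Summable.tsum_finsetSum fun j _ => (hs j).mul_left _]
    refine Finset.sum_congr rfl fun j _ => ?_
    rw [tsum_mul_left]
    simp [refSum]

/-- Each event is, up to a null set, an increasing union over n of events depending on finitely many
ramp sums, whose joint laws agree by `map_jumpSum_eq`. -/
lemma measure_forall_lt_orderedJump [IsProbabilityMeasure P] (hα0 : 0 < α) (hα1 : α < 1)
    (hc : 0 < c) (hS : IsStableSubordinator S α c P) (t : Finset ℕ) (y : ℕ → ℝ)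
    (hy : ∀ j ∈ t, 0 ≤ y j) :
    P {ω | ∀ j ∈ t, y j < orderedJump S (j + 1) ω} =
      expSeq {e | ∀ j ∈ t, y j < refPoint α c e j} := by
  set X : ℕ → ℕ → Ω → ℝ := fun n j => jumpSum S (fun x => ramp (y j) n (Real.exp (-x))) with hX
  set Z : ℕ → ℕ → (ℕ → ℝ) → ℝ := fun n j => refSum α c (fun x => ramp (y j) n (Real.exp (-x)))
    with hZ
  have hXm : ∀ j ∈ t, ∀ ω, Monotone fun n => X n j ω := fun j hj ω => finsum_ramp_mono fun n =>
    finite_support_jump hS (ε := 1 / (n + 1 : ℝ)) (by positivity) (ramp_exp_eq_zero (hy j hj) n) ω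
  have hZm : ∀ j ∈ t, ∀ e, Tendsto (psum e) atTop atTop → Monotone fun n => Z n j e := by
    intro j hj e he
    have hfin := fun n : ℕ => finite_support_refPoint hα0 hc he (ε := 1 / (n + 1 : ℝ))
      (by positivity) (ramp_exp_eq_zero (hy j hj) n)
    have := finsum_ramp_mono (s := Set.univ) (x := refPoint α c e) (y := y j) (by simpa using hfin)
    refine fun a b hab => ?_
    have h := this hab
    simp only [finsum_mem_univ] at h
    simp only [hZ, refSum]
    rwa [tsum_eq_finsum (hfin a), tsum_eq_finsum (hfin b)]
  -- By monotonicity in n, the finitely many witnesses may be replaced by their maximum.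
  have hmono : ∀ {a : ℕ → ℕ → ℝ}, (∀ j ∈ t, Monotone fun n => a n j) →
      ((∀ j ∈ t, ∃ n, ((j + 1 : ℕ) : ℝ) - 1 < a n j) ↔
        ∃ n, ∀ j ∈ t, ((j + 1 : ℕ) : ℝ) - 1 < a n j) := by
    intro a ha
    refine ⟨fun h => ?_, fun ⟨n, hn⟩ j hj => ⟨n, hn j hj⟩⟩
    choose! k hk using h
    exact ⟨t.sup k, fun j hj => (hk j hj).trans_le (ha j hj (Finset.le_sup hj))⟩
  have hL : {ω | ∀ j ∈ t, y j < orderedJump S (j + 1) ω} =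
      ⋃ n, {ω | ∀ j ∈ t, ((j + 1 : ℕ) : ℝ) - 1 < X n j ω} := by
    ext ω
    simp only [Set.mem_ofPred_eq, Set.mem_iUnion]
    rw [← hmono fun j hj => hXm j hj ω]
    exact forall₂_congr fun j hj => lt_orderedJump_iff_exists hS (Nat.succ_pos j) (hy j hj) ω
  have hR : {e | ∀ j ∈ t, y j < refPoint α c e j} =ᵐ[expSeq]
      ⋃ n, ({e | Tendsto (psum e) atTop atTop} ∩
        {e | ∀ j ∈ t, ((j + 1 : ℕ) : ℝ) - 1 < Z n j e} : Set (ℕ → ℝ)) := by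
    filter_upwards [ae_expSeq_pos, ae_tendsto_psum] with e hpos he
    refine propext ?_
    change (∀ j ∈ t, y j < refPoint α c e j) ↔ e ∈ ⋃ n, _
    simp only [Set.mem_ofPred_eq, Set.mem_iUnion, Set.mem_inter_iff, he, true_and]
    rw [← hmono fun j hj => hZm j hj e he]
    exact forall₂_congr fun j hj => lt_refPoint_iff hα0 hc hpos he j (hy j hj)
  rw [hL, measure_congr hR, Monotone.measure_iUnion, Monotone.measure_iUnion]
  · congr 1
    funext n
    have hinter : expSeq ({e | Tendsto (psum e) atTop atTop} ∩
        {e | ∀ j ∈ t, ((j + 1 : ℕ) : ℝ) - 1 < Z n j e}) =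
        expSeq {e | ∀ j ∈ t, ((j + 1 : ℕ) : ℝ) - 1 < Z n j e} := by
      refine measure_congr ?_
      filter_upwards [ae_tendsto_psum] with e he
      exact propext ⟨fun h => h.2, fun h => ⟨he, h⟩⟩
    rw [hinter]
    have hlaw := map_jumpSum_eq hα0 hα1 hc hS (ι := t) (φ := fun j => ramp (y j) n)
      (fun j => continuous_ramp _ _) (ε := 1 / (n + 1 : ℝ)) (by positivity)
      (fun j u hu => ramp_eq_zero (hy j j.2) n hu)
    set B : Set (EuclideanSpace ℝ t) := {v | ∀ j : t, (((j : ℕ) + 1 : ℕ) : ℝ) - 1 < v j} with hB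
    have hBm : MeasurableSet B := by
      have : B = ⋂ j : t, {v | (((j : ℕ) + 1 : ℕ) : ℝ) - 1 < v j} := by ext; simp [hB]
      rw [this]
      exact MeasurableSet.iInter fun j => measurableSet_lt measurable_const (by fun_prop)
    have h1 := congrArg (fun μ => μ B) hlaw
    rw [Measure.map_apply_of_aemeasurable _ hBm, Measure.map_apply_of_aemeasurable _ hBm] at h1
    · convert h1 using 2
      · ext ω; simp [hB, hX]
      · ext e; simp [hB, hZ]
    · exact (PiLp.continuous_toLp 2 _).measurable.comp_aemeasurable (aemeasurable_pi_iff.2 fun j =>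
        aemeasurable_refSum hα0 hc ((continuous_ramp _ _).measurable.comp (by fun_prop))
          (ε := 1 / (n + 1 : ℝ)) (by positivity) (ramp_exp_eq_zero (hy j j.2) n))
    · exact (PiLp.continuous_toLp 2 _).measurable.comp_aemeasurable (aemeasurable_pi_iff.2 fun j =>
        (measurable_jumpSum_ramp hS (hy j j.2) n).aemeasurable)
  · intro a b hab e he
    exact ⟨he.1, fun j hj => (he.2 j hj).trans_le (hZm j hj e he.1 hab)⟩
  · intro a b hab ω hω j hj
    exact (hω j hj).trans_le (hXm j hj ω hab)

/-- The ordered jumps have the same law as the ordered points of a Poisson process whose intensity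
is the Lévy measure. -/
lemma map_orderedJump [IsProbabilityMeasure P] (hα0 : 0 < α) (hα1 : α < 1)
    (hc : 0 < c) (hS : IsStableSubordinator S α c P) :
    P.map (fun ω j => orderedJump S (j + 1) ω) = expSeq.map (refPoint α c) := by
  have hm : Measurable fun ω (j : ℕ) => orderedJump S (j + 1) ω :=
    measurable_pi_iff.2 fun j => measurable_orderedJump hS _
  have := Measure.isProbabilityMeasure_map hm.aemeasurable (μ := P)
  have := Measure.isProbabilityMeasure_map (μ := expSeq)
    (measurable_refPoint (α := α) (c := c)).aemeasurable
  set π : ℕ → Set (Set (ℕ → ℝ)) := fun j => Set.preimage (fun v => v j) '' Set.range Set.Ioi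
    with hπ
  have hgen : (MeasurableSpace.pi : MeasurableSpace (ℕ → ℝ)) =
      MeasurableSpace.generateFrom (piiUnionInter π Set.univ) := by
    refine le_antisymm ?_ ?_
    · refine iSup_le fun j => ?_
      rw [show (Real.measurableSpace : MeasurableSpace ℝ) = borel ℝ from BorelSpace.measurable_eq,
        borel_eq_generateFrom_Ioi, MeasurableSpace.comap_generateFrom]
      exact MeasurableSpace.generateFrom_mono (subset_piiUnionInter (π := π) (Set.mem_univ j))
    · refine MeasurableSpace.generateFrom_le fun A hA => ?_
      obtain ⟨t, -, f, hf, rfl⟩ := hA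
      refine Finset.measurableSet_biInter _ fun j hj => ?_
      obtain ⟨_, ⟨y, rfl⟩, h⟩ := hf j hj
      rw [← h]
      exact measurable_pi_apply j measurableSet_Ioi
  have hpi : IsPiSystem (piiUnionInter π Set.univ) :=
    isPiSystem_piiUnionInter _ (fun j => IsPiSystem.comap isPiSystem_Ioi _) _
  refine ext_of_generate_finite _ hgen hpi (fun A hA => ?_) (by simp)
  obtain ⟨t, -, f, hf, rfl⟩ := hA
  have hf' : ∀ j ∈ t, ∃ y, (fun v : ℕ → ℝ => v j) ⁻¹' Set.Ioi y = f j := fun j hj => by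
    obtain ⟨_, ⟨y, rfl⟩, h⟩ := hf j hj
    exact ⟨y, h⟩
  choose! y hy using hf'
  have hmeas : MeasurableSet (⋂ j ∈ t, f j) :=
    Finset.measurableSet_biInter _ fun j hj => by
      rw [← hy j hj]; exact measurable_pi_apply j measurableSet_Ioi
  rw [Measure.map_apply hm hmeas, Measure.map_apply measurable_refPoint hmeas]
  -- Negative thresholds are met automatically by nonnegative sequences and are dropped, the
  -- counting criterion being available only for y ≥ 0.
  have key := measure_forall_lt_orderedJump hα0 hα1 hc hS (t.filter fun j => 0 ≤ y j) y
    (fun j hj => (Finset.mem_filter.1 hj).2)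
  have hneg : ∀ v : ℕ → ℝ, (∀ j, 0 ≤ v j) → (v ∈ ⋂ j ∈ t, f j ↔
      ∀ j ∈ t.filter fun j => 0 ≤ y j, y j < v j) := by
    intro v hv
    simp only [Set.mem_iInter, Finset.mem_filter]
    refine ⟨fun h j hj => ?_, fun h j hj => ?_⟩
    · have := h j hj.1
      rw [← hy j hj.1] at this
      exact this
    · rw [← hy j hj]
      rcases lt_or_ge (y j) 0 with h0 | h0
      · exact h0.trans_le (hv j)
      · exact h j ⟨hj, h0⟩
  refine Eq.trans ?_ (key.trans ?_)
  · congr 1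
    ext ω
    exact hneg _ fun j => orderedJump_nonneg _ _
  · refine measure_congr ?_
    filter_upwards [ae_expSeq_pos] with e he
    exact propext (hneg _ fun j => (refPoint_pos hc he j).le).symm

end JointLaw

end TrimmedStable

end

/-! ### The law of the ratios and its size-biased Mecke formula. -/

noncomputable section

namespace TrimmedStable

/-- The sum of a sequence of nonnegative numbers. -/
def total (s : ℕ → ℝ) : ℝ := (∑' i, ENNReal.ofReal (s i)).toReal

@[fun_prop] lemma measurable_total : Measurable total := by unfold total; fun_prop

lemma total_eq_tsum {s : ℕ → ℝ} (hs : ∀ i, 0 ≤ s i) : total s = ∑' i, s i := by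
  rw [total, ENNReal.tsum_toReal_eq fun i => ENNReal.ofReal_ne_top]
  exact tsum_congr fun i => ENNReal.toReal_ofReal (hs i)

/-- Strictly decreasing summable sequences of positive numbers. -/
structure IsGood (s : ℕ → ℝ) : Prop where
  lt : ∀ i, s (i + 1) < s i
  pos : ∀ i, 0 < s i
  ne_top : ∑' i, ENNReal.ofReal (s i) ≠ ∞

lemma measurableSet_isGood : MeasurableSet {s : ℕ → ℝ | IsGood s} := by
  have : {s : ℕ → ℝ | IsGood s} = (⋂ i, {s | s (i + 1) < s i}) ∩ (⋂ i, {s | 0 < s i}) ∩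
      {s | ∑' i, ENNReal.ofReal (s i) = ∞}ᶜ := by
    ext s
    simp only [Set.mem_inter_iff, Set.mem_iInter, Set.mem_ofPred_eq, Set.mem_compl_iff]
    exact ⟨fun h => ⟨⟨h.lt, h.pos⟩, h.ne_top⟩, fun h => ⟨h.1.1, h.1.2, h.2⟩⟩
  rw [this]
  refine ((MeasurableSet.iInter fun i => ?_).inter (MeasurableSet.iInter fun i => ?_)).inter ?_
  · exact measurableSet_lt (by fun_prop) (by fun_prop)
  · exact measurableSet_lt (by fun_prop) (by fun_prop)
  · exact (measurableSet_eq_fun (by fun_prop) measurable_const).compl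

namespace IsGood

variable {s : ℕ → ℝ}

lemma strictAnti (h : IsGood s) : StrictAnti s := strictAnti_nat_of_succ_lt h.lt

lemma summable (h : IsGood s) : Summable s := by
  have := ENNReal.summable_toReal h.ne_top
  exact this.congr fun i => ENNReal.toReal_ofReal (h.pos i).le

lemma total_eq (h : IsGood s) : total s = ∑' i, s i := total_eq_tsum fun i => (h.pos i).le

lemma total_pos (h : IsGood s) : 0 < total s := by
  rw [h.total_eq]
  exact h.summable.tsum_pos (fun i => (h.pos i).le) 0 (h.pos 0)

lemma ofReal_total (h : IsGood s) : ENNReal.ofReal (total s) = ∑' i, ENNReal.ofReal (s i) := by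
  rw [total, ENNReal.ofReal_toReal h.ne_top]

lemma skip (h : IsGood s) (j : ℕ) : IsGood (skip j s) where
  lt i := h.strictAnti (by split_ifs <;> omega)
  pos i := h.pos _
  ne_top := by
    have hinj : Function.Injective fun n : ℕ => if n < j then n else n + 1 := by
      intro a b hab
      simp only at hab
      split_ifs at hab <;> omega
    exact ne_top_of_le_ne_top h.ne_top
      (ENNReal.tsum_comp_le_tsum_of_injective hinj fun i => ENNReal.ofReal (s i))

lemma range_skip (h : IsGood s) (j : ℕ) :
    Set.range (TrimmedStable.skip j s) = Set.range s \ {s j} := by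
  ext x
  simp only [Set.mem_range, Set.mem_sdiff, Set.mem_singleton_iff]
  constructor
  · rintro ⟨i, rfl⟩
    refine ⟨⟨_, rfl⟩, fun he => ?_⟩
    have := h.strictAnti.injective he
    split_ifs at this <;> omega
  · rintro ⟨⟨i, rfl⟩, hne⟩
    have hij : i ≠ j := fun h => hne (by rw [h])
    rcases lt_or_gt_of_ne hij with hlt | hgt
    · exact ⟨i, by simp [TrimmedStable.skip, hlt]⟩
    · refine ⟨i - 1, ?_⟩
      have h1 : ¬ (i - 1 < j) := by omega
      have h2 : i - 1 + 1 = i := by omega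
      simp [TrimmedStable.skip, h1, h2]

/-- The entries being distinct, sums over indices can be read as sums over sets of values, and
skipping the index j deletes exactly the value `s j`. -/
lemma total_eq_add (h : IsGood s) (j : ℕ) :
    total s = s j + total (TrimmedStable.skip j s) := by
  rw [h.total_eq, (h.skip j).total_eq, h.summable.tsum_eq_add_tsum_ite j]
  congr 1
  set f : ℝ → ℝ := (Set.range s \ {s j}).indicator id with hf
  have h1 : ∀ n, (if n = j then 0 else s n) = f (s n) := fun n => by
    by_cases hn : n = j
    · simp [hf, hn]
    · have : s n ≠ s j := fun he => hn (h.strictAnti.injective he)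
      simp [hf, hn, this]
  have h2 : ∀ n, TrimmedStable.skip j s n = f (TrimmedStable.skip j s n) := fun n => by
    have : TrimmedStable.skip j s n ∈ Set.range s \ {s j} := by
      rw [← h.range_skip]; exact ⟨n, rfl⟩
    rw [hf, Set.indicator_of_mem this]; rfl
  simp_rw [h1]
  rw [tsum_congr h2, h.strictAnti.injective.tsum_eq, (h.skip j).strictAnti.injective.tsum_eq]
  · rw [h.range_skip]; exact Set.support_indicator_subset
  · exact Set.support_indicator_subset.trans fun _ hx => hx.1

end IsGood

/-- The law of the ratios of the smaller points to the point number `m + 1` of a Poisson process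
with intensity the Lévy measure. -/
def nu (α : ℝ) (m : ℕ) : Measure (ℕ → ℝ) := expSeq.map fun e i => arrivalRatio m e i ^ (-1 / α)

variable {α c : ℝ}

lemma measurable_arrivalRatio_rpow (m : ℕ) :
    Measurable fun e i => arrivalRatio m e i ^ (-1 / α) :=
  measurable_pi_iff.2 fun i => ((measurable_pi_apply i).comp (measurable_arrivalRatio m)).pow_const _

instance (m : ℕ) : IsProbabilityMeasure (nu α m) :=
  Measure.isProbabilityMeasure_map (measurable_arrivalRatio_rpow m).aemeasurable

/-- The scale c cancels in the quotients, so only α and the index matter. Indices start at 0: `nu α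
m` belongs to r = m + 1. -/
lemma map_jumpRatio {Ω : Type*} [MeasurableSpace Ω] {P : Measure Ω} [IsProbabilityMeasure P]
    {S : ℝ≥0 → Ω → ℝ} (hα0 : 0 < α) (hα1 : α < 1) (hc : 0 < c)
    (hS : IsStableSubordinator S α c P) (m : ℕ) :
    P.map (fun ω i => jumpRatio S (m + 1) (i + 1) ω) = nu α m := by
  have hg : Measurable fun (v : ℕ → ℝ) (i : ℕ) => v (m + 1 + i) / v m :=
    measurable_pi_iff.2 fun i => by fun_prop
  have hm : Measurable fun ω (j : ℕ) => orderedJump S (j + 1) ω :=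
    measurable_pi_iff.2 fun j => measurable_orderedJump hS _
  have h := congrArg (fun μ => μ.map fun (v : ℕ → ℝ) (i : ℕ) => v (m + 1 + i) / v m)
    (map_orderedJump hα0 hα1 hc hS)
  rw [Measure.map_map hg hm, Measure.map_map hg measurable_refPoint] at h
  refine Eq.trans ?_ (h.trans (Measure.map_congr ?_))
  · rfl
  · filter_upwards [ae_expSeq_pos] with e he
    funext i
    simp only [Function.comp, refPoint, arrivalRatio]
    rw [← Real.div_rpow (div_pos (arrival_pos he _) hc).le (div_pos (arrival_pos he _) hc).le,
      div_div_div_cancel_right₀ hc.ne']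

lemma Theta_of_mem {x : ℝ} (hx : x ∈ Set.Ioo (0 : ℝ) 1) : Theta α x = α * x ^ (-α) :=
  Set.indicator_of_mem hx _

lemma Theta_of_notMem {x : ℝ} (hx : x ∉ Set.Ioo (0 : ℝ) 1) : Theta α x = 0 :=
  Set.indicator_of_notMem hx _

lemma Theta_nonneg (hα0 : 0 < α) (x : ℝ) : 0 ≤ Theta α x := by
  refine Set.indicator_nonneg (fun y hy => ?_) x
  have := hy.1
  positivity

@[fun_prop] lemma measurable_Theta : Measurable (Theta α) := by
  unfold Theta
  exact Measurable.indicator (by fun_prop) measurableSet_Ioo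

lemma image_rpow_neg_Ioo (hα0 : 0 < α) :
    (fun x : ℝ => x ^ (-α)) '' Set.Ioo 0 1 = Set.Ioi 1 := by
  ext y
  constructor
  · rintro ⟨x, hx, rfl⟩
    exact Real.one_lt_rpow_of_pos_of_lt_one_of_neg hx.1 hx.2 (by linarith)
  · intro hy
    have hy1 : 1 < y := hy
    have hy0 : 0 < y := lt_trans one_pos hy1
    refine ⟨y ^ (-1 / α), ⟨Real.rpow_pos_of_pos hy0 _, ?_⟩, ?_⟩
    · exact Real.rpow_lt_one_of_one_lt_of_neg hy1 (div_neg_of_neg_of_pos (by norm_num) hα0)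
    · simp only
      rw [← Real.rpow_mul hy0.le, show -1 / α * -α = 1 by field_simp, Real.rpow_one]

/-- The Mecke formula for the ratios, in size-biased form. -/
lemma lintegral_tsum_nu (hα0 : 0 < α) (m : ℕ) {K : ℝ → (ℕ → ℝ) → ℝ≥0∞}
    (hK : Measurable (Function.uncurry K)) :
    ∫⁻ s, (∑' j, ENNReal.ofReal (s j) * K (s j) (skip j s)) ∂(nu α m) =
      (m + 1) * ∫⁻ x, ENNReal.ofReal (Theta α x) * ∫⁻ s, K x s ∂(nu α (m + 1)) := by
  have hK1 : ∀ {γ : Type} [MeasurableSpace γ] {f : γ → ℝ} {g : γ → ℕ → ℝ}, Measurable f →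
      Measurable g → Measurable fun c => K (f c) (g c) :=
    fun hf hg => hK.comp (hf.prodMk hg)
  have hL : Measurable fun s : ℕ → ℝ => ∑' j, ENNReal.ofReal (s j) * K (s j) (skip j s) :=
    Measurable.tsum fun j => Measurable.mul (by fun_prop)
      (hK1 (by fun_prop) (by fun_prop))
  have hpow : Measurable fun (v : ℕ → ℝ) (i : ℕ) => v i ^ (-1 / α) :=
    measurable_pi_iff.2 fun i => by fun_prop
  rw [nu, lintegral_map hL (measurable_arrivalRatio_rpow m)]
  have h1 := lintegral_tsum_arrivalRatio m (K := fun y v => ENNReal.ofReal (y ^ (-1 / α)) *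
    K (y ^ (-1 / α)) fun i => v i ^ (-1 / α))
    (Measurable.mul (by fun_prop) (hK1 (by fun_prop) (hpow.comp measurable_snd)))
  refine Eq.trans ?_ (h1.trans ?_)
  · rfl
  congr 1
  -- In y = x^(-α) the Jacobian is α x^(-α-1), and the size-biasing factor y^(-1/α) = x completes it
  -- to Θ(x).
  rw [← image_rpow_neg_Ioo hα0, lintegral_image_eq_lintegral_abs_deriv_mul
    (f' := fun x => -α * x ^ (-α - 1)) measurableSet_Ioo, ← lintegral_indicator measurableSet_Ioo]
  · refine lintegral_congr fun x => ?_
    by_cases hx : x ∈ Set.Ioo (0 : ℝ) 1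
    · rw [Set.indicator_of_mem hx]
      have hx0 : 0 < x := hx.1
      have e : (x ^ (-α)) ^ (-1 / α) = x := by
        rw [← Real.rpow_mul hx0.le, show -α * (-1 / α) = 1 by field_simp, Real.rpow_one]
      rw [e, lintegral_const_mul _ (hK1 measurable_const (measurable_arrivalRatio_rpow _)),
        ← mul_assoc, ← ENNReal.ofReal_mul (abs_nonneg _), nu,
        lintegral_map (f := fun s => K x s) (hK1 measurable_const measurable_id) (measurable_arrivalRatio_rpow _)]
      congr 2
      rw [Theta_of_mem hx, abs_mul, abs_neg, abs_of_pos hα0,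
        abs_of_pos (Real.rpow_pos_of_pos hx0 _), mul_assoc, Real.rpow_sub_one hx0.ne',
        div_mul_cancel₀ _ hx0.ne']
    · rw [Set.indicator_of_notMem hx, Theta_of_notMem hx]
      simp
  · intro x hx
    exact (Real.hasDerivAt_rpow_const (Or.inl hx.1.ne')).hasDerivWithinAt
  · intro x hx y hy hxy
    exact Real.rpow_left_injOn (by linarith : -α ≠ 0) hx.1.le hy.1.le hxy

lemma integral_Theta (hα0 : 0 < α) (hα1 : α < 1) :
    ∫⁻ x, ENNReal.ofReal (Theta α x) = ENNReal.ofReal (α / (1 - α)) := by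
  have h1 : ∀ x, ENNReal.ofReal (Theta α x) =
      (Set.Ioo (0 : ℝ) 1).indicator (fun x => ENNReal.ofReal (α * x ^ (-α))) x := fun x => by
    by_cases hx : x ∈ Set.Ioo (0 : ℝ) 1
    · rw [Theta_of_mem hx, Set.indicator_of_mem hx]
    · rw [Theta_of_notMem hx, Set.indicator_of_notMem hx, ENNReal.ofReal_zero]
  simp_rw [h1]
  rw [lintegral_indicator measurableSet_Ioo, restrict_Ioo_eq_restrict_Ioc,
    ← ofReal_integral_eq_lintegral_ofReal]
  · rw [← intervalIntegral.integral_of_le zero_le_one, intervalIntegral.integral_const_mul,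
      integral_rpow (Or.inl (by linarith))]
    rw [Real.one_rpow, Real.zero_rpow (by linarith), show -α + 1 = 1 - α by ring]
    congr 1
    ring
  · refine Integrable.const_mul ?_ _
    have := intervalIntegral.intervalIntegrable_rpow' (a := 0) (b := 1) (r := -α) (by linarith)
    rwa [intervalIntegrable_iff_integrableOn_Ioc_of_le zero_le_one] at this
  · filter_upwards [ae_restrict_mem measurableSet_Ioc] with x hx
    have := hx.1
    positivity

/-- The Mecke formula with K = 1. A finite mean gives almost sure summability, and its growth with m
later tells the densities g_k apart. -/
lemma lintegral_tsum_ofReal_nu (hα0 : 0 < α) (hα1 : α < 1) (m : ℕ) :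
    ∫⁻ s, (∑' j, ENNReal.ofReal (s j)) ∂(nu α m) = (m + 1) * ENNReal.ofReal (α / (1 - α)) := by
  have := lintegral_tsum_nu hα0 m (K := fun _ _ => 1) measurable_const
  simpa [integral_Theta hα0 hα1] using this

lemma ae_nu_isGood (hα0 : 0 < α) (hα1 : α < 1) (m : ℕ) : ∀ᵐ s ∂(nu α m), IsGood s := by
  have h1 : ∀ᵐ s ∂(nu α m), ∑' j, ENNReal.ofReal (s j) < ∞ := by
    refine ae_lt_top (by fun_prop) ?_
    rw [lintegral_tsum_ofReal_nu hα0 hα1]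
    exact ENNReal.mul_ne_top (by finiteness) ENNReal.ofReal_ne_top
  have h2 := ae_of_ae_map (measurable_arrivalRatio_rpow m).aemeasurable h1
  rw [nu, ae_map_iff (measurable_arrivalRatio_rpow m).aemeasurable measurableSet_isGood]
  filter_upwards [h2, ae_expSeq_pos] with e he hpos
  have hr : ∀ i, 0 < arrivalRatio m e i := fun i => div_pos (arrival_pos hpos _) (arrival_pos hpos _)
  refine ⟨fun i => ?_, fun i => Real.rpow_pos_of_pos (hr i) _, he.ne⟩
  refine Real.rpow_lt_rpow_of_neg (hr i) ?_ (div_neg_of_neg_of_pos (by norm_num) hα0)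
  exact div_lt_div_of_pos_right (strictMono_psum hpos (by omega)) (arrival_pos hpos m)

end TrimmedStable

end

/-! ### Size-biased picks and the remaining ratios. -/

noncomputable section

namespace TrimmedStable

/-- Remove the entry `x` from a decreasing sequence. -/
def removeValue (x : ℝ) (s : ℕ → ℝ) : ℕ → ℝ := fun i => if x < s i then s i else s (i + 1)

lemma measurable_removeValue {β : Type*} {_ : MeasurableSpace β} {f : β → ℝ} {g : β → ℕ → ℝ}
    (hf : Measurable f) (hg : Measurable g) : Measurable fun b => removeValue (f b) (g b) := by
  refine measurable_pi_iff.2 fun i => ?_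
  have := measurable_pi_iff.1 hg
  exact Measurable.ite (measurableSet_lt hf (this i)) (this i) (this (i + 1))

/-- Picks are given by value, not by index. Removal by value is measurable jointly in the value and
the sequence, and agrees with skipping the corresponding index. -/
lemma IsGood.removeValue_eq {s : ℕ → ℝ} (h : IsGood s) (j : ℕ) :
    removeValue (s j) s = TrimmedStable.skip j s := by
  funext i
  simp only [removeValue, TrimmedStable.skip, h.strictAnti.lt_iff_gt]
  split_ifs <;> rfl

/-- The restriction of P to A and the measure with density P(A | m) agree on m, by the defining
property of the conditional expectation; nonnegative m-measurable functions therefore have equal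
integrals, without any integrability. -/
lemma setLIntegral_eq_of_condExp {Ω : Type*} {m mΩ : MeasurableSpace Ω} {P : Measure Ω}
    [IsProbabilityMeasure P] (hm : m ≤ mΩ) {A : Set Ω} (hA : MeasurableSet A) {w : Ω → ℝ}
    (hw : P⟦A | m⟧ =ᵐ[P] w) {f : Ω → ℝ≥0∞} (hf : Measurable[m] f) :
    ∫⁻ ω in A, f ω ∂P = ∫⁻ ω, ENNReal.ofReal (w ω) * f ω ∂P := by
  set k : Ω → ℝ := P⟦A | m⟧ with hk
  have hkm : Measurable[m] k := stronglyMeasurable_condExp.measurable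
  have hkm' : Measurable k := hkm.mono hm le_rfl
  have hki : Integrable k P := integrable_condExp
  have hA1 : Integrable (A.indicator fun _ => (1 : ℝ)) P := (integrable_const 1).indicator hA
  have hk0 : 0 ≤ᵐ[P] k := condExp_nonneg (ae_of_all _ fun ω =>
    Set.indicator_nonneg (fun _ _ => zero_le_one) ω)
  have hmeas : (P.restrict A).trim hm = (P.withDensity fun ω => ENNReal.ofReal (k ω)).trim hm := by
    refine @Measure.ext Ω m _ _ fun B hB => ?_
    have hB' := hm B hB
    rw [trim_measurableSet_eq hm hB, trim_measurableSet_eq hm hB, Measure.restrict_apply hB',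
      withDensity_apply _ hB', ← ofReal_integral_eq_lintegral_ofReal hki.integrableOn
        (ae_restrict_of_ae hk0), setIntegral_condExp hm hA1 hB, setIntegral_indicator hA]
    simp [Measure.real, ENNReal.ofReal_toReal]
  have hf' : Measurable f := hf.mono hm le_rfl
  rw [← lintegral_trim hm hf, hmeas, lintegral_trim hm hf,
    lintegral_withDensity_eq_lintegral_mul _ (by fun_prop) hf']
  refine lintegral_congr_ae ?_
  filter_upwards [hw] with ω hω
  simp [hω]

section Subordinator

variable {Ω : Type*}

/-- The sequence of ratios. -/
def ratioSeq (S : ℝ≥0 → Ω → ℝ) (r : ℕ) (ω : Ω) : ℕ → ℝ := fun i => jumpRatio S r (i + 1) ω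

/-- The ratios that remain after `n` picks, in decreasing order. -/
def remainingSeq (S : ℝ≥0 → Ω → ℝ) (r : ℕ) (Jt : ℕ → Ω → ℝ) : ℕ → Ω → ℕ → ℝ
  | 0 => ratioSeq S r
  | n + 1 => fun ω => removeValue (Jt n ω) (remainingSeq S r Jt n ω)

variable {S : ℝ≥0 → Ω → ℝ} {r : ℕ} {Jt : ℕ → Ω → ℝ}

lemma residualSum_eq (n : ℕ) (ω : Ω) :
    residualSum S r Jt n ω = ratioSum S r ω - ∑ l ∈ Finset.range n, Jt l ω := by
  induction n with
  | zero => simp [residualSum]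
  | succ n ih =>
    change residualSum S r Jt n ω - Jt n ω = _
    rw [ih, Finset.sum_range_succ]; ring

lemma measurable_pickSigma_ratioSeq (n : ℕ) :
    Measurable[pickSigma S r Jt n] (ratioSeq S r) :=
  measurable_fst.comp (comap_measurable (fun ω =>
    ((fun i : ℕ => jumpRatio S r (i + 1) ω), (fun l : Fin n => Jt l ω))))

lemma measurable_pickSigma_pick {n l : ℕ} (h : l < n) : Measurable[pickSigma S r Jt n] (Jt l) :=
  ((measurable_pi_apply (⟨l, h⟩ : Fin n)).comp measurable_snd).comp (comap_measurable (fun ω =>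
    ((fun i : ℕ => jumpRatio S r (i + 1) ω), (fun l : Fin n => Jt l ω))))

lemma measurable_pickSigma_ratioSum (n : ℕ) :
    Measurable[pickSigma S r Jt n] (ratioSum S r) := by
  have : Measurable fun s : ℕ → ℝ => ∑' i, s i := Measurable.tsum fun i => measurable_pi_apply i
  exact this.comp (measurable_pickSigma_ratioSeq n)

lemma measurable_pickSigma_remainingSeq {n k : ℕ} (h : n ≤ k) :
    Measurable[pickSigma S r Jt k] (remainingSeq S r Jt n) := by
  induction n with
  | zero => exact measurable_pickSigma_ratioSeq k
  | succ n ih =>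
    exact measurable_removeValue (measurable_pickSigma_pick h) (ih (Nat.le_of_succ_le h))

lemma measurable_pickSigma_residualSum {n k : ℕ} (h : n ≤ k) :
    Measurable[pickSigma S r Jt k] (residualSum S r Jt n) := by
  induction n with
  | zero => exact measurable_pickSigma_ratioSum k
  | succ n ih => exact (ih (Nat.le_of_succ_le h)).sub (measurable_pickSigma_pick h)

variable [MeasurableSpace Ω] {P : Measure Ω} {α c : ℝ}

lemma measurable_jumpRatio (hS : IsStableSubordinator S α c P) (r i : ℕ) :
    Measurable (jumpRatio S r i) :=
  (measurable_orderedJump hS _).div (measurable_orderedJump hS _)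

lemma measurable_ratioSeq (hS : IsStableSubordinator S α c P) (r : ℕ) : Measurable (ratioSeq S r) :=
  measurable_pi_iff.2 fun _ => measurable_jumpRatio hS _ _

lemma pickSigma_le (hS : IsStableSubordinator S α c P)
    (hJt : IsSizeBiasedPermutation S r Jt P) (n : ℕ) :
    pickSigma S r Jt n ≤ (inferInstance : MeasurableSpace Ω) :=
  ((measurable_ratioSeq hS r).prodMk
    (measurable_pi_iff.2 fun l : Fin n => hJt.measurable l)).comap_le

variable [IsProbabilityMeasure P] {m : ℕ}

lemma ae_isGood_ratioSeq (hα0 : 0 < α) (hα1 : α < 1) (hc : 0 < c)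
    (hS : IsStableSubordinator S α c P) (m : ℕ) : ∀ᵐ ω ∂P, IsGood (ratioSeq S (m + 1) ω) := by
  refine ae_of_ae_map (measurable_ratioSeq hS (m + 1)).aemeasurable ?_
  have := map_jumpRatio hα0 hα1 hc hS m
  change P.map (ratioSeq S (m + 1)) = nu α m at this
  rw [this]
  exact ae_nu_isGood hα0 hα1 m

/-- Invariants kept along the picks: each pick is one of the remaining entries, so its removal skips
one index and lowers the total by the value picked. The residual sum is thus a function of the
remaining sequence. -/
lemma ae_remainingSeq (hα0 : 0 < α) (hα1 : α < 1) (hc : 0 < c)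
    (hS : IsStableSubordinator S α c P) (hJt : IsSizeBiasedPermutation S (m + 1) Jt P) :
    ∀ᵐ ω ∂P, IsGood (ratioSeq S (m + 1) ω) ∧ ∀ n, IsGood (remainingSeq S (m + 1) Jt n ω) ∧
      Set.range (remainingSeq S (m + 1) Jt n ω) =
        {x | x ∈ Set.range (ratioSeq S (m + 1) ω) ∧ ∀ l < n, x ≠ Jt l ω} ∧
      total (remainingSeq S (m + 1) Jt n ω) = residualSum S (m + 1) Jt n ω ∧
      Jt n ω ∈ Set.range (remainingSeq S (m + 1) Jt n ω) := by
  filter_upwards [ae_isGood_ratioSeq hα0 hα1 hc hS m, ae_all_iff.2 hJt.mem] with ω hgood hmem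
  refine ⟨hgood, fun n => ?_⟩
  have hmem' : ∀ n, Jt n ω ∈ {x | x ∈ Set.range (ratioSeq S (m + 1) ω) ∧ ∀ l < n, x ≠ Jt l ω} := by
    intro n
    obtain ⟨j, hj, hjn, hjl⟩ := hmem n
    obtain ⟨i, rfl⟩ := Nat.exists_eq_add_of_le' hj
    exact ⟨⟨i, hjn.symm⟩, fun l hl => hjn ▸ hjl l hl⟩
  suffices h : IsGood (remainingSeq S (m + 1) Jt n ω) ∧
      Set.range (remainingSeq S (m + 1) Jt n ω) =
        {x | x ∈ Set.range (ratioSeq S (m + 1) ω) ∧ ∀ l < n, x ≠ Jt l ω} ∧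
      total (remainingSeq S (m + 1) Jt n ω) = residualSum S (m + 1) Jt n ω from
    ⟨h.1, h.2.1, h.2.2, h.2.1 ▸ hmem' n⟩
  induction n with
  | zero =>
    refine ⟨hgood, ?_, hgood.total_eq⟩
    ext x; simp [remainingSeq]
  | succ n ih =>
    obtain ⟨h1, h2, h3⟩ := ih
    have h4 : Jt n ω ∈ Set.range (remainingSeq S (m + 1) Jt n ω) := h2 ▸ hmem' n
    obtain ⟨j, hj⟩ := h4
    have h5 : remainingSeq S (m + 1) Jt (n + 1) ω =
        skip j (remainingSeq S (m + 1) Jt n ω) := by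
      change removeValue (Jt n ω) (remainingSeq S (m + 1) Jt n ω) = _
      rw [← hj, h1.removeValue_eq]
    rw [h5]
    refine ⟨h1.skip j, ?_, ?_⟩
    · rw [h1.range_skip, h2, hj]
      ext x
      simp only [Set.mem_sdiff, Set.mem_ofPred_eq, Set.mem_singleton_iff, Nat.lt_succ_iff_lt_or_eq]
      constructor
      · rintro ⟨⟨ha, hb⟩, hc⟩
        exact ⟨ha, fun l hl => hl.elim (hb l) fun h => h ▸ hc⟩
      · rintro ⟨ha, hb⟩
        exact ⟨⟨ha, fun l hl => hb l (Or.inl hl)⟩, hb n (Or.inr rfl)⟩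
    · change _ = residualSum S (m + 1) Jt n ω - Jt n ω
      rw [← h3, h1.total_eq_add j, ← hj]
      ring

/-- The ratios being distinct, exactly one of the events "the pick is the ratio of index i" occurs
almost surely; each is integrated with its conditional probability given the past. The weights of
ratios already picked vanish, which leaves a sum over the remaining sequence. -/
lemma lintegral_pick (hα0 : 0 < α) (hα1 : α < 1) (hc : 0 < c)
    (hS : IsStableSubordinator S α c P) (hJt : IsSizeBiasedPermutation S (m + 1) Jt P) (n : ℕ)
    {E : Type*} [MeasurableSpace E] {Z : Ω → E} (hZ : Measurable[pickSigma S (m + 1) Jt n] Z)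
    {Ψ : E → ℝ → ℝ≥0∞} (hΨ : Measurable (Function.uncurry Ψ)) :
    ∫⁻ ω, Ψ (Z ω) (Jt n ω) ∂P =
      ∫⁻ ω, (∑' j, ENNReal.ofReal (remainingSeq S (m + 1) Jt n ω j / residualSum S (m + 1) Jt n ω) *
        Ψ (Z ω) (remainingSeq S (m + 1) Jt n ω j)) ∂P := by
  have hle := pickSigma_le hS hJt n
  have hf : ∀ i, Measurable[pickSigma S (m + 1) Jt n] fun ω =>
      Ψ (Z ω) (jumpRatio S (m + 1) (i + 1) ω) := fun i =>
    hΨ.comp (hZ.prodMk ((measurable_pi_apply i).comp (measurable_pickSigma_ratioSeq n)))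
  have hA : ∀ i, MeasurableSet {ω | Jt n ω = jumpRatio S (m + 1) (i + 1) ω} := fun i =>
    measurableSet_eq_fun (hJt.measurable n) (measurable_jumpRatio hS _ _)
  have hgood := ae_remainingSeq hα0 hα1 hc hS hJt
  have h1 : ∫⁻ ω, Ψ (Z ω) (Jt n ω) ∂P =
      ∫⁻ ω, (∑' i, {ω | Jt n ω = jumpRatio S (m + 1) (i + 1) ω}.indicator
        (fun ω => Ψ (Z ω) (jumpRatio S (m + 1) (i + 1) ω)) ω) ∂P := by
    refine lintegral_congr_ae ?_
    filter_upwards [hgood] with ω ⟨hg, h⟩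
    obtain ⟨-, hr, -, hmem⟩ := h n
    rw [hr] at hmem
    obtain ⟨⟨i, hi⟩, -⟩ := hmem
    rw [tsum_eq_single i]
    · rw [Set.indicator_of_mem (by exact hi.symm), ← hi]; rfl
    · intro i' hne
      refine Set.indicator_of_notMem (fun hmem => hne ?_) _
      refine hg.strictAnti.injective ?_
      rw [hi]; exact hmem.symm
  have hwm : ∀ i, Measurable fun ω => ENNReal.ofReal (pickWeight S (m + 1) Jt n (i + 1) ω) := by
    intro i
    refine ENNReal.measurable_ofReal.comp (Measurable.div ?_ ?_)
    · refine Measurable.ite ?_ (measurable_jumpRatio hS _ _) measurable_const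
      have : {ω | ∀ l < n, jumpRatio S (m + 1) (i + 1) ω ≠ Jt l ω} =
          ⋂ l ∈ Finset.range n, {ω | jumpRatio S (m + 1) (i + 1) ω = Jt l ω}ᶜ := by
        ext ω; simp
      rw [this]
      exact Finset.measurableSet_biInter _ fun l _ =>
        (measurableSet_eq_fun (measurable_jumpRatio hS _ _) (hJt.measurable l)).compl
    · exact ((measurable_pickSigma_ratioSum n).mono hle le_rfl).sub
        (Finset.measurable_sum _ fun l _ => hJt.measurable l)
  rw [h1, lintegral_tsum fun i =>
    (((hf i).mono hle le_rfl).indicator (hA i)).aemeasurable]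
  have h2 : ∀ i, ∫⁻ ω, {ω | Jt n ω = jumpRatio S (m + 1) (i + 1) ω}.indicator
        (fun ω => Ψ (Z ω) (jumpRatio S (m + 1) (i + 1) ω)) ω ∂P =
      ∫⁻ ω, ENNReal.ofReal (pickWeight S (m + 1) Jt n (i + 1) ω) *
        Ψ (Z ω) (jumpRatio S (m + 1) (i + 1) ω) ∂P := fun i => by
    rw [lintegral_indicator (hA i)]
    exact setLIntegral_eq_of_condExp hle (hA i) (hJt.condProb n (i + 1) (Nat.succ_pos i)) (hf i)
  simp_rw [h2]
  have hwf : ∀ i, Measurable fun ω => ENNReal.ofReal (pickWeight S (m + 1) Jt n (i + 1) ω) *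
      Ψ (Z ω) (jumpRatio S (m + 1) (i + 1) ω) := fun i => (hwm i).mul ((hf i).mono hle le_rfl)
  rw [← lintegral_tsum fun i => (hwf i).aemeasurable]
  refine lintegral_congr_ae ?_
  filter_upwards [hgood] with ω ⟨hg, h⟩
  obtain ⟨hgn, hr, -, -⟩ := h n
  set R := remainingSeq S (m + 1) Jt n ω with hR
  -- Written as a function of the value, the summand allows the sum over all ratios to be reindexed
  -- by the remaining ones.
  set F : ℝ → ℝ≥0∞ := (Set.range R).indicator fun x =>
    ENNReal.ofReal (x / residualSum S (m + 1) Jt n ω) * Ψ (Z ω) x with hF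
  have e1 : ∀ i, ENNReal.ofReal (pickWeight S (m + 1) Jt n (i + 1) ω) *
        Ψ (Z ω) (jumpRatio S (m + 1) (i + 1) ω) = F (ratioSeq S (m + 1) ω i) := by
    intro i
    have hiff : ratioSeq S (m + 1) ω i ∈ Set.range R ↔
        ∀ l < n, jumpRatio S (m + 1) (i + 1) ω ≠ Jt l ω := by
      rw [hr]; exact ⟨fun h => h.2, fun h => ⟨⟨i, rfl⟩, h⟩⟩
    rw [pickWeight, ← residualSum_eq, hF]
    by_cases hi : ratioSeq S (m + 1) ω i ∈ Set.range R
    · rw [Set.indicator_of_mem hi, if_pos (hiff.1 hi)]; rfl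
    · rw [Set.indicator_of_notMem hi, if_neg (mt hiff.2 hi)]; simp
  have e2 : ∀ j, ENNReal.ofReal (R j / residualSum S (m + 1) Jt n ω) * Ψ (Z ω) (R j) =
      F (R j) := fun j => by
    rw [hF, Set.indicator_of_mem (Set.mem_range_self j)]
  rw [tsum_congr e1, tsum_congr e2, hg.strictAnti.injective.tsum_eq,
    hgn.strictAnti.injective.tsum_eq]
  · exact Set.support_indicator_subset
  · refine Set.support_indicator_subset.trans ?_
    rw [hr]; exact fun x hx => hx.1

end Subordinator

end TrimmedStable

end

/-! ### Joint law of the residual sums and the remaining ratios. -/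

noncomputable section

namespace TrimmedStable

/-- Append a real number to a real tuple. -/
def snocR {n : ℕ} (τ : Fin n → ℝ) (t : ℝ) : Fin (n + 1) → ℝ := Fin.snoc τ t

section snocR

variable {n : ℕ} (τ : Fin n → ℝ) (t : ℝ)

@[simp] lemma snocR_castSucc (i : Fin n) : snocR τ t i.castSucc = τ i := by simp [snocR]

@[simp] lemma snocR_last : snocR τ t (Fin.last n) = t := by simp [snocR]

lemma eq_snocR (v : Fin (n + 1) → ℝ) : v = snocR (fun i => v i.castSucc) (v (Fin.last n)) := by
  funext i
  induction i using Fin.lastCases <;> simp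

lemma measurable_snocR {β : Type*} {_ : MeasurableSpace β} {f : β → Fin n → ℝ} {g : β → ℝ}
    (hf : Measurable f) (hg : Measurable g) : Measurable fun b => snocR (f b) (g b) := by
  refine measurable_pi_iff.2 fun i => ?_
  induction i using Fin.lastCases with
  | last => simpa using hg
  | cast i => simpa using measurable_pi_iff.1 hf i

lemma lintegral_snocR {F : (Fin (n + 1) → ℝ) → ℝ≥0∞} (hF : Measurable F) :
    ∫⁻ v, F v = ∫⁻ τ : Fin n → ℝ, ∫⁻ t : ℝ, F (snocR τ t) := by
  have h := (volume_preserving_piFinSuccAbove (fun _ : Fin (n + 1) => ℝ) (Fin.last n)).symm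
  have h' : Measurable fun p => F ((MeasurableEquiv.piFinSuccAbove (fun _ : Fin (n + 1) => ℝ)
      (Fin.last n)).symm p) := hF.comp h.measurable
  rw [← h.lintegral_comp hF, Measure.volume_eq_prod, lintegral_prod_symm' _ h']
  refine lintegral_congr fun τ => lintegral_congr fun t => ?_
  congr 1
  change Fin.insertNth (α := fun _ => ℝ) (Fin.last n) t τ = _
  rw [Fin.insertNth_last']
  rfl

end snocR

/-- The product of the factors `Θ (t_i - t_{i+1}) / t_i`. -/
def chainWeight (α : ℝ) (n : ℕ) (t : Fin (n + 1) → ℝ) : ℝ≥0∞ :=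
  ∏ i : Fin n, ENNReal.ofReal (Theta α (t i.castSucc - t i.succ) / t i.castSucc)

lemma measurable_chainWeight (α : ℝ) (n : ℕ) : Measurable (chainWeight α n) := by
  refine Finset.measurable_prod _ fun i _ => ENNReal.measurable_ofReal.comp ?_
  exact (measurable_Theta.comp (f := fun t : Fin (n + 1) → ℝ => t i.castSucc - t i.succ)
    (by fun_prop)).div (measurable_pi_apply _)

lemma chainWeight_snocR (α : ℝ) {n : ℕ} (τ : Fin n → ℝ) (t u : ℝ) :
    chainWeight α (n + 1) (snocR (snocR τ t) u) =
      chainWeight α n (snocR τ t) * ENNReal.ofReal (Theta α (t - u) / t) := by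
  rw [chainWeight, Fin.prod_univ_castSucc, chainWeight]
  simp [← Fin.castSucc_succ]

variable {Ω : Type*} [MeasurableSpace Ω] {P : Measure Ω} {α c : ℝ}
  {S : ℝ≥0 → Ω → ℝ} {m : ℕ} {Jt : ℕ → Ω → ℝ}

lemma measurable_residualSum {r : ℕ} (hS : IsStableSubordinator S α c P)
    (hJt : IsSizeBiasedPermutation S r Jt P) (n : ℕ) : Measurable (residualSum S r Jt n) :=
  (measurable_pickSigma_residualSum le_rfl).mono (pickSigma_le hS hJt n) le_rfl

/-- One pick, in density form. The Mecke formula separates the picked value x from the rest s; the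
sum before the pick is t = x + `total s`, and the translation from x to t produces Θ(t - `total s`)
/ t, the next factor of the chain weight. -/
lemma lintegral_size_biased_nu (hα0 : 0 < α) (hα1 : α < 1) (m : ℕ) {n : ℕ} (τ : Fin n → ℝ)
    {Ψ : (Fin (n + 1) → ℝ) → (ℕ → ℝ) → ℝ≥0∞} (hΨ : Measurable (Function.uncurry Ψ)) :
    ∫⁻ s, chainWeight α n (snocR τ (total s)) * (∑' j, ENNReal.ofReal (s j / total s) *
        Ψ (snocR τ (total s)) (removeValue (s j) s)) ∂nu α m =
      (m + 1) * ∫⁻ s, (∫⁻ t, chainWeight α (n + 1) (snocR (snocR τ t) (total s)) *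
        Ψ (snocR τ t) s) ∂nu α (m + 1) := by
  set K : ℝ → (ℕ → ℝ) → ℝ≥0∞ := fun x s => ENNReal.ofReal (1 / (x + total s)) *
    (chainWeight α n (snocR τ (x + total s)) * Ψ (snocR τ (x + total s)) s) with hK
  have hsn : Measurable fun p : ℝ × (ℕ → ℝ) => snocR τ (p.1 + total p.2) :=
    measurable_snocR measurable_const (by fun_prop)
  have hKm : Measurable (Function.uncurry K) :=
    (ENNReal.measurable_ofReal.comp (by fun_prop)).mul
      (((measurable_chainWeight α n).comp hsn).mul (hΨ.comp (hsn.prodMk measurable_snd)))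
  have h1 : ∫⁻ s, chainWeight α n (snocR τ (total s)) * (∑' j, ENNReal.ofReal (s j / total s) *
        Ψ (snocR τ (total s)) (removeValue (s j) s)) ∂nu α m =
      ∫⁻ s, (∑' j, ENNReal.ofReal (s j) * K (s j) (skip j s)) ∂nu α m := by
    refine lintegral_congr_ae ?_
    filter_upwards [ae_nu_isGood hα0 hα1 m] with s hs
    rw [← ENNReal.tsum_mul_left]
    refine tsum_congr fun j => ?_
    rw [hK, hs.removeValue_eq]
    simp only
    rw [← hs.total_eq_add j, div_eq_mul_one_div, ENNReal.ofReal_mul (hs.pos j).le]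
    ring
  rw [h1, lintegral_tsum_nu hα0 m hKm]
  congr 1
  have h2 : ∀ x, ENNReal.ofReal (Theta α x) * ∫⁻ s, K x s ∂nu α (m + 1) =
      ∫⁻ s, ENNReal.ofReal (Theta α x) * K x s ∂nu α (m + 1) := fun x =>
    (lintegral_const_mul _ hKm.of_uncurry_left).symm
  simp_rw [h2]
  have hTK : Measurable fun p : ℝ × (ℕ → ℝ) => ENNReal.ofReal (Theta α p.1) * K p.1 p.2 :=
    (ENNReal.measurable_ofReal.comp (measurable_Theta.comp measurable_fst)).mul hKm
  rw [lintegral_lintegral_swap hTK.aemeasurable]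
  refine lintegral_congr fun s => ?_
  rw [← lintegral_sub_right_eq_self _ (total s)]
  refine lintegral_congr fun t => ?_
  rw [hK, chainWeight_snocR, div_eq_mul_one_div, ENNReal.ofReal_mul (Theta_nonneg hα0 _)]
  simp only [sub_add_cancel]
  ring

/-- The central induction. The residual sum T_n is the total of the remaining sequence, so only the
earlier sums are separate integration variables. -/
theorem lintegral_residualSum_remainingSeq [IsProbabilityMeasure P] (hα0 : 0 < α) (hα1 : α < 1) (hc : 0 < c)
    (hS : IsStableSubordinator S α c P) (hJt : IsSizeBiasedPermutation S (m + 1) Jt P) (n : ℕ)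
    {Ψ : (Fin n → ℝ) → (ℕ → ℝ) → ℝ≥0∞} (hΨ : Measurable (Function.uncurry Ψ)) :
    ∫⁻ ω, Ψ (fun i => residualSum S (m + 1) Jt i ω) (remainingSeq S (m + 1) Jt n ω) ∂P =
      (m + 1).ascFactorial n * ∫⁻ s, (∫⁻ τ, chainWeight α n (snocR τ (total s)) * Ψ τ s)
        ∂nu α (m + n) := by
  induction n with
  | zero =>
    have h := map_jumpRatio hα0 hα1 hc hS m
    change P.map (ratioSeq S (m + 1)) = nu α (m + 0) at h
    have hm : Measurable fun s : ℕ → ℝ => ∫⁻ τ, chainWeight α 0 (snocR τ (total s)) * Ψ τ s := by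
      refine Measurable.lintegral_prod_left ?_
      exact ((measurable_chainWeight α 0).comp
        (measurable_snocR measurable_fst (by fun_prop))).mul hΨ
    rw [Nat.ascFactorial_zero, Nat.cast_one, one_mul, ← h,
      lintegral_map hm (measurable_ratioSeq hS (m + 1))]
    refine lintegral_congr fun ω => ?_
    rw [lintegral_unique]
    simp [chainWeight, volume_pi]
    congr 1
    exact Subsingleton.elim _ _
  | succ n ih =>
    set T := residualSum S (m + 1) Jt with hT
    set R := remainingSeq S (m + 1) Jt with hR
    have hTsnoc : ∀ ω, (fun i : Fin (n + 1) => T i ω) = snocR (fun i : Fin n => T i ω) (T n ω) :=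
      fun ω => eq_snocR _
    -- The conditional mean of Ψ over the next pick, as a function of the past sums and the
    -- remaining sequence.
    set Φ : (Fin n → ℝ) → (ℕ → ℝ) → ℝ≥0∞ := fun τ s => ∑' j, ENNReal.ofReal (s j / total s) *
        Ψ (snocR τ (total s)) (removeValue (s j) s) with hΦ
    have hsn : Measurable fun p : (Fin n → ℝ) × (ℕ → ℝ) => snocR p.1 (total p.2) :=
      measurable_snocR measurable_fst (by fun_prop)
    have hΦm : Measurable (Function.uncurry Φ) := by
      refine Measurable.tsum fun j => ?_
      have a1 : Measurable fun p : (Fin n → ℝ) × (ℕ → ℝ) =>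
        ENNReal.ofReal (p.2 j / total p.2) := by fun_prop
      have a2 : Measurable fun p : (Fin n → ℝ) × (ℕ → ℝ) => removeValue (p.2 j) p.2 :=
        measurable_removeValue (by fun_prop) measurable_snd
      have a3 : Measurable fun p : (Fin n → ℝ) × (ℕ → ℝ) =>
        Ψ (snocR p.1 (total p.2)) (removeValue (p.2 j) p.2) := hΨ.comp (hsn.prodMk a2)
      exact a1.mul a3
    have hZ1 : Measurable[pickSigma S (m + 1) Jt n] fun ω (i : Fin (n + 1)) => T i ω :=
      @measurable_pi_lambda _ _ _ (pickSigma S (m + 1) Jt n) _ _ fun i =>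
        measurable_pickSigma_residualSum (Nat.lt_succ_iff.1 i.2)
    have hZ : Measurable[pickSigma S (m + 1) Jt n] fun ω =>
        ((fun i : Fin (n + 1) => T i ω), R n ω) :=
      hZ1.prodMk (measurable_pickSigma_remainingSeq le_rfl)
    have hΨr : Measurable (Function.uncurry fun (z : (Fin (n + 1) → ℝ) × (ℕ → ℝ)) (x : ℝ) =>
        Ψ z.1 (removeValue x z.2)) := by
      have a1 : Measurable fun p : ((Fin (n + 1) → ℝ) × (ℕ → ℝ)) × ℝ => removeValue p.2 p.1.2 :=
        measurable_removeValue measurable_snd (by fun_prop)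
      exact hΨ.comp ((measurable_fst.comp measurable_fst).prodMk a1)
    have hpick := lintegral_pick hα0 hα1 hc hS hJt n hZ hΨr
    have hR1 : ∀ ω, R (n + 1) ω = removeValue (Jt n ω) (R n ω) := fun _ => rfl
    have h1 : ∫⁻ ω, Ψ (fun i : Fin (n + 1) => T i ω) (R (n + 1) ω) ∂P =
        ∫⁻ ω, Φ (fun i : Fin n => T i ω) (R n ω) ∂P := by
      simp_rw [hR1]
      rw [hpick]
      refine lintegral_congr_ae ?_
      filter_upwards [ae_remainingSeq hα0 hα1 hc hS hJt] with ω ⟨_, h⟩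
      obtain ⟨-, -, ht, -⟩ := h n
      simp only [hΦ, hTsnoc, ← hT, ← hR] at ht ⊢
      rw [ht]
    rw [h1, ih hΦm]
    have hsw : Measurable fun p : (ℕ → ℝ) × (Fin n → ℝ) =>
        chainWeight α n (snocR p.2 (total p.1)) * Φ p.2 p.1 := by
      clear_value Φ
      have a1 : Measurable fun p : (ℕ → ℝ) × (Fin n → ℝ) => Φ p.2 p.1 :=
        hΦm.comp (measurable_snd.prodMk measurable_fst)
      have a2 : Measurable fun p : (ℕ → ℝ) × (Fin n → ℝ) => snocR p.2 (total p.1) :=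
        measurable_snocR measurable_snd (by fun_prop)
      have a3 : Measurable fun p : (ℕ → ℝ) × (Fin n → ℝ) =>
        chainWeight α n (snocR p.2 (total p.1)) := (measurable_chainWeight α n).comp a2
      exact a3.mul a1
    rw [lintegral_lintegral_swap hsw.aemeasurable]
    have hM : Measurable fun p : ((Fin n → ℝ) × (ℕ → ℝ)) × ℝ =>
        chainWeight α (n + 1) (snocR (snocR p.1.1 p.2) (total p.1.2)) *
          Ψ (snocR p.1.1 p.2) p.1.2 := by
      have a1 : Measurable fun p : ((Fin n → ℝ) × (ℕ → ℝ)) × ℝ => snocR p.1.1 p.2 :=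
        measurable_snocR (by fun_prop) (by fun_prop)
      exact ((measurable_chainWeight α _).comp (measurable_snocR a1 (by fun_prop))).mul
        (hΨ.comp (a1.prodMk (by fun_prop)))
    set G : (Fin n → ℝ) → (ℕ → ℝ) → ℝ≥0∞ := fun τ s =>
      ∫⁻ t, chainWeight α (n + 1) (snocR (snocR τ t) (total s)) * Ψ (snocR τ t) s with hG
    have hGm : Measurable fun p : (Fin n → ℝ) × (ℕ → ℝ) => G p.1 p.2 := hM.lintegral_prod_right'
    have hGs : ∀ s, ∫⁻ τ, G τ s = ∫⁻ τ, chainWeight α (n + 1) (snocR τ (total s)) * Ψ τ s := by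
      intro s
      have hF : Measurable fun τ : Fin (n + 1) → ℝ =>
          chainWeight α (n + 1) (snocR τ (total s)) * Ψ τ s :=
        ((measurable_chainWeight α _).comp (measurable_snocR measurable_id measurable_const)).mul
          (hΨ.comp (measurable_id.prodMk measurable_const))
      exact (lintegral_snocR hF).symm
    have hstep : ∀ τ, ∫⁻ s, chainWeight α n (snocR τ (total s)) * Φ τ s ∂nu α (m + n) =
        (↑(m + n) + 1) * ∫⁻ s, G τ s ∂nu α (m + n + 1) :=
      fun τ => lintegral_size_biased_nu hα0 hα1 (m + n) τ hΨ
    rw [lintegral_congr hstep]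
    clear_value G
    have hGi : Measurable fun τ => ∫⁻ s, G τ s ∂nu α (m + n + 1) := hGm.lintegral_prod_right'
    rw [lintegral_const_mul _ hGi, lintegral_lintegral_swap hGm.aemeasurable,
      Nat.ascFactorial_succ, ← mul_assoc, lintegral_congr hGs]
    congr 1
    push_cast; ring

end TrimmedStable

end

/-! ### Existence and positivity of the densities. -/

noncomputable section

namespace TrimmedStable

variable {α c : ℝ}

/-- The law of the sum of the ratios. -/
def sumLaw (α : ℝ) (m : ℕ) : Measure ℝ := (nu α m).map total

instance (m : ℕ) : IsProbabilityMeasure (sumLaw α m) :=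
  Measure.isProbabilityMeasure_map measurable_total.aemeasurable

/-- The density of the sum of the ratios. -/
def sumDensity (α : ℝ) (m : ℕ) (t : ℝ) : ℝ := ((sumLaw α m).rnDeriv volume t).toReal

@[fun_prop] lemma measurable_sumDensity (α : ℝ) (m : ℕ) : Measurable (sumDensity α m) :=
  (Measure.measurable_rnDeriv _ _).ennreal_toReal

lemma sumDensity_nonneg (α : ℝ) (m : ℕ) (t : ℝ) : 0 ≤ sumDensity α m t := ENNReal.toReal_nonneg

section Subordinator

variable {Ω : Type*} [MeasurableSpace Ω] {P : Measure Ω} {S : ℝ≥0 → Ω → ℝ}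

lemma measurable_ratioSum (hS : IsStableSubordinator S α c P) (r : ℕ) :
    Measurable (ratioSum S r) := by
  have : Measurable fun s : ℕ → ℝ => ∑' i, s i := Measurable.tsum fun i => measurable_pi_apply i
  exact this.comp (measurable_ratioSeq hS r)

lemma map_ratioSum [IsProbabilityMeasure P] (hα0 : 0 < α) (hα1 : α < 1) (hc : 0 < c)
    (hS : IsStableSubordinator S α c P) (m : ℕ) : P.map (ratioSum S (m + 1)) = sumLaw α m := by
  have h : P.map (ratioSeq S (m + 1)) = nu α m := map_jumpRatio hα0 hα1 hc hS m
  rw [sumLaw, ← h, Measure.map_map measurable_total (measurable_ratioSeq hS _)]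
  refine Measure.map_congr ?_
  filter_upwards [ae_isGood_ratioSeq hα0 hα1 hc hS m] with ω hω
  exact hω.total_eq.symm

lemma ratioSumDensity_eq [IsProbabilityMeasure P] (hα0 : 0 < α) (hα1 : α < 1) (hc : 0 < c)
    (hS : IsStableSubordinator S α c P) (m : ℕ) :
    ratioSumDensity S P (m + 1) = sumDensity α m := by
  funext t
  rw [ratioSumDensity, map_ratioSum hα0 hα1 hc hS, sumDensity]

end Subordinator

lemma lintegral_sumLaw {F : ℝ → ℝ≥0∞} (hF : Measurable F) (m : ℕ) :
    ∫⁻ t, F t ∂sumLaw α m = ∫⁻ s, F (total s) ∂nu α m :=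
  lintegral_map hF measurable_total

/-- The one-pick identity for functions of the sum before the pick: the pick probabilities s_j / t
then add up to 1. It expresses the law of index m through that of index m + 1. -/
lemma lintegral_sumLaw_eq (hα0 : 0 < α) (hα1 : α < 1) (m : ℕ) {F : ℝ → ℝ≥0∞} (hF : Measurable F) :
    ∫⁻ t, F t ∂sumLaw α m =
      (m + 1) * ∫⁻ s, (∫⁻ t, ENNReal.ofReal (Theta α (t - s) / t) * F t) ∂sumLaw α (m + 1) := by
  have hm : Measurable fun s => ∫⁻ t, ENNReal.ofReal (Theta α (t - s) / t) * F t := by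
    refine Measurable.lintegral_prod_right ?_
    refine Measurable.mul (ENNReal.measurable_ofReal.comp ?_) (hF.comp measurable_snd)
    fun_prop
  rw [lintegral_sumLaw hF, lintegral_sumLaw hm]
  have h := lintegral_size_biased_nu hα0 hα1 m (n := 0) Fin.elim0 (Ψ := fun τ _ => F (τ 0))
    (hF.comp (by fun_prop))
  have h0 : ∀ t, snocR Fin.elim0 t 0 = t := fun t => snocR_last Fin.elim0 t
  have h1 : ∀ t u, chainWeight α 1 (snocR (snocR Fin.elim0 t) u) =
      ENNReal.ofReal (Theta α (t - u) / t) := fun t u => by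
    rw [chainWeight_snocR]; simp [chainWeight]
  simp only [h0, h1] at h
  rw [← h]
  refine lintegral_congr_ae ?_
  filter_upwards [ae_nu_isGood hα0 hα1 m] with s hs
  have : ∀ j, ENNReal.ofReal (s j / total s) = ENNReal.ofReal (s j) / ENNReal.ofReal (total s) :=
    fun j => ENNReal.ofReal_div_of_pos hs.total_pos
  simp_rw [ENNReal.tsum_mul_right, this, div_eq_mul_inv, ENNReal.tsum_mul_right]
  rw [← hs.ofReal_total, ENNReal.mul_inv_cancel (by simpa using hs.total_pos) ENNReal.ofReal_ne_top]
  simp [chainWeight]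

lemma ae_sumLaw_pos (hα0 : 0 < α) (hα1 : α < 1) (m : ℕ) : ∀ᵐ t ∂sumLaw α m, 0 < t := by
  rw [sumLaw, ae_map_iff measurable_total.aemeasurable measurableSet_Ioi]
  filter_upwards [ae_nu_isGood hα0 hα1 m] with s hs using hs.total_pos

/-- In the preceding identity the sum before the pick is integrated against Lebesgue measure. -/
lemma sumLaw_absolutelyContinuous (hα0 : 0 < α) (hα1 : α < 1) (m : ℕ) :
    sumLaw α m ≪ volume := by
  refine Measure.AbsolutelyContinuous.mk fun N hN h0 => ?_
  rw [← lintegral_indicator_one hN,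
    lintegral_sumLaw_eq hα0 hα1 m (measurable_one.indicator hN)]
  have : ∀ s, ∫⁻ t, ENNReal.ofReal (Theta α (t - s) / t) * N.indicator 1 t = 0 := fun s => by
    rw [← lintegral_zero (μ := (volume : Measure ℝ))]
    refine lintegral_congr_ae ?_
    filter_upwards [measure_eq_zero_iff_ae_notMem.1 h0] with t ht
    simp [ht]
  simp [this]

lemma sumLaw_eq_withDensity (hα0 : 0 < α) (hα1 : α < 1) (m : ℕ) :
    sumLaw α m = volume.withDensity fun t => ENNReal.ofReal (sumDensity α m t) := by
  refine (Measure.withDensity_rnDeriv_eq _ _ (sumLaw_absolutelyContinuous hα0 hα1 m)).symm.trans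
    (withDensity_congr_ae ?_)
  filter_upwards [Measure.rnDeriv_lt_top (sumLaw α m) volume] with t ht
  rw [sumDensity, ENNReal.ofReal_toReal ht.ne]

lemma lintegral_sumLaw_density (hα0 : 0 < α) (hα1 : α < 1) (m : ℕ) {F : ℝ → ℝ≥0∞}
    (hF : Measurable F) :
    ∫⁻ t, F t ∂sumLaw α m = ∫⁻ t, ENNReal.ofReal (sumDensity α m t) * F t := by
  rw [sumLaw_eq_withDensity hα0 hα1, lintegral_withDensity_eq_lintegral_mul _ (by fun_prop) hF]
  rfl

lemma ae_sumDensity_eq (hα0 : 0 < α) (hα1 : α < 1) (m : ℕ) :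
    ∀ᵐ t, ENNReal.ofReal (sumDensity α m t) = (m + 1) *
      ∫⁻ s, ENNReal.ofReal (Theta α (t - s) / t) ∂sumLaw α (m + 1) := by
  have hm : Measurable fun t => (m + 1 : ℝ≥0∞) *
      ∫⁻ s, ENNReal.ofReal (Theta α (t - s) / t) ∂sumLaw α (m + 1) := by
    refine Measurable.const_mul (Measurable.lintegral_prod_right ?_) _
    refine ENNReal.measurable_ofReal.comp ?_
    fun_prop
  refine ae_eq_of_forall_setLIntegral_eq_of_sigmaFinite (by fun_prop) hm fun A hA _ => ?_
  rw [← withDensity_apply _ hA, ← sumLaw_eq_withDensity hα0 hα1, ← lintegral_indicator_one hA,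
    lintegral_sumLaw_eq hα0 hα1 m (measurable_one.indicator hA), lintegral_const_mul' _ _ (by simp)]
  congr 1
  have hj : Measurable fun p : ℝ × ℝ => ENNReal.ofReal (Theta α (p.1 - p.2) / p.1) := by
    refine ENNReal.measurable_ofReal.comp ?_
    fun_prop
  rw [lintegral_lintegral_swap (μ := volume.restrict A)
    (f := fun t s => ENNReal.ofReal (Theta α (t - s) / t)) hj.aemeasurable]
  refine lintegral_congr fun s => ?_
  rw [← lintegral_indicator hA]
  refine lintegral_congr fun t => ?_
  by_cases ht : t ∈ A <;> simp [ht]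

lemma ae_restrict_of_ae_expMeasure {p : ℝ → Prop} (h : ∀ᵐ u ∂expMeasure 1, p u) :
    ∀ᵐ u ∂volume.restrict (Set.Ioi 0), p u := by
  obtain ⟨N, hN, hNm, hN0⟩ := exists_measurable_superset_of_null (ae_iff.1 h)
  have h1 := lintegral_expMeasure (N.indicator 1) (measurable_one.indicator hNm)
  have h2 : Measurable fun u : ℝ => ENNReal.ofReal (Real.exp (-u)) * N.indicator 1 u :=
    Measurable.mul (by fun_prop) (measurable_one.indicator hNm)
  rw [lintegral_indicator_one hNm, hN0, eq_comm, lintegral_eq_zero_iff h2] at h1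
  filter_upwards [h1] with u hu
  by_contra hp
  have : u ∈ N := hN hp
  simp only [Set.indicator_of_mem this, Pi.one_apply, mul_one, Pi.zero_apply,
    ENNReal.ofReal_eq_zero] at hu
  exact absurd hu (not_le.2 (Real.exp_pos _))

/-- The ratios are ((u + Γ_j) / u)^(-1/α) with u the first arrival and the Γ_j independent of u.
They tend to 0 as u does, dominated by their values at a fixed u, so their sum becomes arbitrarily
small. -/
lemma sumLaw_zero_Iio_pos (hα0 : 0 < α) (hα1 : α < 1) {ε : ℝ} (hε : 0 < ε) :
    0 < sumLaw α 0 (Set.Iio ε) := by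
  rw [pos_iff_ne_zero]
  intro h0
  set ρ : ℝ → (ℕ → ℝ) → ℕ → ℝ := fun u e j => ((u + arrival e j) / u) ^ (-1 / α) with hρ
  have h1 : ∀ᵐ s ∂nu α 0, ε ≤ total s ∧ IsGood s := by
    have := ae_of_ae_map measurable_total.aemeasurable (measure_eq_zero_iff_ae_notMem.1 h0)
    filter_upwards [this, ae_nu_isGood hα0 hα1 0] with s hs hg
    exact ⟨not_lt.1 hs, hg⟩
  have h2 := ae_of_ae_map (measurable_arrivalRatio_rpow 0).aemeasurable h1
  rw [← expSeq_eq_map] at h2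
  have h3 := Measure.ae_ae_of_ae_prod (ae_of_ae_map (by fun_prop) h2)
  have h4 : ∀ᵐ u ∂volume.restrict (Set.Ioi 0), ∀ᵐ e ∂expSeq, ε ≤ total (ρ u e) ∧ IsGood (ρ u e) := by
    filter_upwards [ae_restrict_of_ae_expMeasure h3] with u hu
    filter_upwards [hu] with e he
    have : (fun i => arrivalRatio 0 (seqCons u e) i ^ (-1 / α)) = ρ u e := by
      funext i
      rw [hρ, arrivalRatio, arrival_seqCons_zero, zero_add, add_comm 1 i, arrival_seqCons_succ]
    rwa [this] at he
  have h5 : ∀ k : ℕ, ∃ u : ℝ, u ∈ Set.Ioo (0 : ℝ) (1 / (k + 1)) ∧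
      ∀ᵐ e ∂expSeq, ε ≤ total (ρ u e) ∧ IsGood (ρ u e) := by
    intro k
    have hsub : Set.Ioo (0 : ℝ) (1 / (k + 1)) ⊆ Set.Ioi 0 := fun x hx => hx.1
    have := ae_restrict_of_ae_restrict_of_subset hsub h4
    have hne : (ae (volume.restrict (Set.Ioo (0 : ℝ) (1 / (k + 1))))).NeBot := by
      rw [ae_neBot, Ne, Measure.restrict_eq_zero, Real.volume_Ioo]
      have : (0 : ℝ) < 1 / (k + 1) := by positivity
      simpa using this
    obtain ⟨u, hu, hu'⟩ := (this.and (ae_restrict_mem measurableSet_Ioo)).exists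
    exact ⟨u, hu', hu⟩
  choose u hu hue using h5
  obtain ⟨e, he, hpos⟩ := ((ae_all_iff.2 hue).and ae_expSeq_pos).exists
  have hu0 : Tendsto u atTop (𝓝 0) :=
    squeeze_zero (fun k => (hu k).1.le) (fun k => (hu k).2.le) tendsto_one_div_add_atTop_nhds_zero_nat
  have ha : ∀ j, 0 < arrival e j := fun j => arrival_pos hpos j
  have hexp : -1 / α < 0 := div_neg_of_neg_of_pos (by norm_num) hα0
  have hlim : Tendsto (fun k => ∑' j, ρ (u k) e j) atTop (𝓝 (∑' _ : ℕ, (0 : ℝ))) := by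
    refine tendsto_tsum_of_dominated_convergence (he 0).2.summable (fun j => ?_) ?_
    · have h6 : Tendsto (fun k => (u k + arrival e j) / u k) atTop atTop := by
        have : Tendsto (fun k => (u k)⁻¹) atTop atTop :=
          tendsto_inv_nhdsGT_zero.comp (tendsto_nhdsWithin_iff.2
            ⟨hu0, Eventually.of_forall fun k => (hu k).1⟩)
        have h7 : Tendsto (fun k => u k + arrival e j) atTop (𝓝 (0 + arrival e j)) :=
          hu0.add_const _
        rw [zero_add] at h7
        exact h7.pos_mul_atTop (ha j) this
      have h8 := (tendsto_rpow_neg_atTop (y := 1 / α) (by positivity)).comp h6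
      simpa only [hρ, neg_div, Function.comp_def] using h8
    · filter_upwards [hu0.eventually_le_const (hu 0).1] with k hk j
      rw [Real.norm_of_nonneg ((he k).2.pos j).le]
      have p0 := (hu 0).1
      have pk := (hu k).1
      refine Real.rpow_le_rpow_of_nonpos (div_pos (add_pos p0 (ha j)) p0) ?_ hexp.le
      rw [add_div, add_div, div_self p0.ne', div_self pk.ne']
      have := div_le_div_of_nonneg_left (ha j).le pk hk
      linarith
  rw [tsum_zero] at hlim
  have hle : ∀ k, ε ≤ ∑' j, ρ (u k) e j := fun k => (he k).2.total_eq ▸ (he k).1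
  exact absurd (ge_of_tendsto' hlim hle) (not_le.2 hε)

/-- A pick only lowers the sum: if the law of index m + 1 did not charge (-∞, ε), neither would that
of index m. -/
lemma sumLaw_Iio_pos (hα0 : 0 < α) (hα1 : α < 1) (m : ℕ) {ε : ℝ} (hε : 0 < ε) :
    0 < sumLaw α m (Set.Iio ε) := by
  induction m with
  | zero => exact sumLaw_zero_Iio_pos hα0 hα1 hε
  | succ m ih =>
    rw [pos_iff_ne_zero] at ih ⊢
    refine fun h0 => ih ?_
    rw [← lintegral_indicator_one measurableSet_Iio,
      lintegral_sumLaw_eq hα0 hα1 m (measurable_one.indicator measurableSet_Iio), mul_eq_zero]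
    right
    rw [← lintegral_zero (μ := sumLaw α (m + 1))]
    refine lintegral_congr_ae ?_
    filter_upwards [measure_eq_zero_iff_ae_notMem.1 h0] with s hs
    rw [← lintegral_zero (μ := (volume : Measure ℝ))]
    refine lintegral_congr fun t => ?_
    by_cases ht : t < ε
    · have : t - s ∉ Set.Ioo (0 : ℝ) 1 := fun h => by
        have h1 := h.1
        have h2 := not_lt.1 (show ¬ s < ε from hs)
        linarith
      simp [Theta_of_notMem this]
    · simp [ht]

/-- The density at t is an average of Θ(t - s) / t over s under the law of next index, and this
kernel is positive for s in (t - 1, t). -/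
lemma ae_sumDensity_pos_of_sumLaw_pos (hα0 : 0 < α) (hα1 : α < 1) (m : ℕ) :
    ∀ᵐ t, 0 < t → 0 < sumLaw α (m + 1) (Set.Ioo (t - 1) t) → 0 < sumDensity α m t := by
  filter_upwards [ae_sumDensity_eq hα0 hα1 m] with t ht h0 hpos
  rw [← ENNReal.ofReal_pos, ht, pos_iff_ne_zero, Ne, mul_eq_zero, not_or]
  refine ⟨by simp, fun h => hpos.ne' ?_⟩
  have hm : Measurable fun s => ENNReal.ofReal (Theta α (t - s) / t) :=
    ENNReal.measurable_ofReal.comp (by fun_prop)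
  rw [lintegral_eq_zero_iff hm] at h
  rw [measure_eq_zero_iff_ae_notMem]
  filter_upwards [h] with s hs hmem
  have h1 : t - s ∈ Set.Ioo (0 : ℝ) 1 := ⟨by linarith [hmem.2], by linarith [hmem.1]⟩
  have h2 : 0 < Theta α (t - s) / t := by
    rw [Theta_of_mem h1]
    have := Real.rpow_pos_of_pos h1.1 (-α)
    positivity
  rw [Pi.zero_apply, ENNReal.ofReal_eq_zero] at hs
  linarith

/-- Induction in unit steps, for all m at once. For t < 1 the interval contains (0, t), which has
positive mass. Positivity up to n + 1 at index m + 1 makes the density of index m positive on (0, n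
+ 1), a set that meets (t - 1, t) in an interval whenever 0 < t < n + 2. -/
lemma sumLaw_Ioo_pos (hα0 : 0 < α) (hα1 : α < 1) (n m : ℕ) {t : ℝ} (ht : t ∈ Set.Ioo (0 : ℝ) (n + 1)) :
    0 < sumLaw α m (Set.Ioo (t - 1) t) := by
  induction n generalizing m t with
  | zero =>
    have h := sumLaw_Iio_pos hα0 hα1 m ht.1
    refine h.trans_le (measure_mono_ae ?_)
    filter_upwards [ae_sumLaw_pos hα0 hα1 m] with s hs h
    have := ht.2
    norm_num at this
    exact ⟨by linarith, h⟩
  | succ n ih =>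
    have h1 : ∀ᵐ s, s ∈ Set.Ioo (0 : ℝ) (n + 1) → 0 < sumDensity α m s := by
      filter_upwards [ae_sumDensity_pos_of_sumLaw_pos hα0 hα1 m] with s hs h
      exact hs h.1 (ih (m + 1) h)
    rw [pos_iff_ne_zero]
    intro h0
    set I := Set.Ioo (max (t - 1) 0) (min t (n + 1)) with hI
    have hIsub : I ⊆ Set.Ioo (t - 1) t := fun s hs =>
      ⟨(le_max_left _ _).trans_lt hs.1, hs.2.trans_le (min_le_left _ _)⟩
    have h2 : sumLaw α m I = 0 := measure_mono_null hIsub h0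
    rw [sumLaw_eq_withDensity hα0 hα1, withDensity_apply _ measurableSet_Ioo,
      lintegral_eq_zero_iff (by fun_prop)] at h2
    have hlt : max (t - 1) 0 < min t (n + 1) := by
      have h3 := ht.2
      push_cast at h3
      exact max_lt (lt_min (by linarith) (by linarith)) (lt_min ht.1 (by positivity))
    have hne : (ae (volume.restrict I)).NeBot := by
      rw [ae_neBot, Ne, Measure.restrict_eq_zero, Real.volume_Ioo]
      simpa only [ENNReal.ofReal_eq_zero, not_le, sub_pos] using hlt
    obtain ⟨s, ⟨hs1, hs2⟩, hs3⟩ := ((h2.and (ae_restrict_of_ae h1)).and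
      (ae_restrict_mem measurableSet_Ioo)).exists
    have := hs2 ⟨(le_max_right _ _).trans_lt hs3.1, hs3.2.trans_le (min_le_right _ _)⟩
    rw [Pi.zero_apply, ENNReal.ofReal_eq_zero] at hs1
    linarith

lemma ae_sumDensity_pos (hα0 : 0 < α) (hα1 : α < 1) (m : ℕ) :
    ∀ᵐ t, 0 < t → 0 < sumDensity α m t := by
  filter_upwards [ae_sumDensity_pos_of_sumLaw_pos hα0 hα1 m] with t ht h0
  obtain ⟨n, hn⟩ := exists_nat_gt t
  exact ht h0 (sumLaw_Ioo_pos hα0 hα1 n (m + 1) ⟨h0, by linarith⟩)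

lemma ae_sumDensity_eq_zero (hα0 : 0 < α) (hα1 : α < 1) (m : ℕ) :
    ∀ᵐ t, t ≤ 0 → sumDensity α m t = 0 := by
  have h : ∫⁻ t in Set.Iic 0, ENNReal.ofReal (sumDensity α m t) = 0 := by
    rw [← withDensity_apply _ measurableSet_Iic, ← sumLaw_eq_withDensity hα0 hα1,
      measure_eq_zero_iff_ae_notMem]
    filter_upwards [ae_sumLaw_pos hα0 hα1 m] with t ht using not_le.2 ht
  rw [lintegral_eq_zero_iff (by fun_prop)] at h
  filter_upwards [(ae_restrict_iff' measurableSet_Iic).1 h] with t ht h0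
  have := ht h0
  rw [Pi.zero_apply, ENNReal.ofReal_eq_zero] at this
  exact this.antisymm (sumDensity_nonneg α m t)

lemma lintegral_ofReal_sumLaw (hα0 : 0 < α) (hα1 : α < 1) (m : ℕ) :
    ∫⁻ t, ENNReal.ofReal t ∂sumLaw α m = (m + 1) * ENNReal.ofReal (α / (1 - α)) := by
  rw [lintegral_sumLaw (by fun_prop), ← lintegral_tsum_ofReal_nu hα0 hα1]
  refine lintegral_congr_ae ?_
  filter_upwards [ae_nu_isGood hα0 hα1 m] with s hs using hs.ofReal_total

end TrimmedStable

end

/-! ### Joint and transition densities, and the Markov property. -/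

noncomputable section

namespace TrimmedStable

variable {α c : ℝ}

section CondDistrib

variable {Ω E : Type*} [MeasurableSpace Ω] [MeasurableSpace E] {P : Measure Ω}
  [IsProbabilityMeasure P] {X : Ω → E} {Y : Ω → ℝ}

/-- Uniqueness of disintegration, once the densities q x are known to define a Markov kernel. -/
lemma condDistrib_ae_eq_withDensity (hX : Measurable X) (hY : Measurable Y) {q : E → ℝ → ℝ≥0∞}
    (hq : Measurable (Function.uncurry q))
    (h : ∀ F : E × ℝ → ℝ≥0∞, Measurable F →
      ∫⁻ ω, F (X ω, Y ω) ∂P = ∫⁻ ω, (∫⁻ y, q (X ω) y * F (X ω, y)) ∂P) :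
    ∀ᵐ x ∂P.map X, condDistrib Y X P x = volume.withDensity (q x) := by
  have hQ : Measurable fun x => ∫⁻ y, q x y := hq.lintegral_prod_right'
  have hone : ∀ᵐ x ∂P.map X, ∫⁻ y, q x y = 1 := by
    have := Measure.isProbabilityMeasure_map (μ := P) hX.aemeasurable
    refine ae_eq_of_forall_setLIntegral_eq_of_sigmaFinite hQ measurable_const fun A hA _ => ?_
    have hA1 : Measurable (A.indicator (1 : E → ℝ≥0∞)) := measurable_one.indicator hA
    have h1 := h (fun p => A.indicator 1 p.1) (hA1.comp measurable_fst)
    simp only at h1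
    rw [setLIntegral_one, ← lintegral_indicator_one hA, lintegral_map hA1 hX, h1,
      ← lintegral_indicator hA, lintegral_map (hQ.indicator hA) hX]
    refine lintegral_congr fun ω => ?_
    by_cases hω : X ω ∈ A <;> simp [hω]
  set A : Set E := {x | ∫⁻ y, q x y = 1} with hA
  have hAm : MeasurableSet A := measurableSet_eq_fun hQ measurable_const
  classical
  -- At the exceptional points where q x has mass other than 1, the uniform law on (0, 1) is
  -- substituted so that the kernel is Markov everywhere.
  set q' : E → ℝ → ℝ≥0∞ := fun x y => if x ∈ A then q x y else (Set.Ioo 0 1).indicator 1 y with hq'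
  have hq'm : Measurable (Function.uncurry q') :=
    Measurable.ite (measurable_fst hAm) hq
      ((measurable_one.indicator measurableSet_Ioo).comp measurable_snd)
  set κ : Kernel E ℝ := (Kernel.const E volume).withDensity q' with hκ
  have hκa : ∀ x, κ x = volume.withDensity (q' x) := fun x => by
    rw [hκ, Kernel.withDensity_apply _ hq'm, Kernel.const_apply]
  have : IsMarkovKernel κ := ⟨fun x => ⟨by
    rw [hκa, withDensity_apply _ MeasurableSet.univ, Measure.restrict_univ]
    by_cases hx : x ∈ A
    · simp only [hq', hx, if_true]; exact hx
    · simp only [hq', hx, if_false]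
      rw [lintegral_indicator_one measurableSet_Ioo]; simp⟩⟩
  have heq : P.map (fun ω => (X ω, Y ω)) = P.map X ⊗ₘ κ := by
    refine Measure.ext_of_lintegral _ fun F hF => ?_
    have hG : Measurable fun x => ∫⁻ y, F (x, y) ∂κ x := hF.lintegral_kernel_prod_right'
    rw [lintegral_map hF (hX.prodMk hY), Measure.lintegral_compProd hF, lintegral_map hG hX, h F hF]
    refine lintegral_congr_ae ?_
    filter_upwards [ae_of_ae_map hX.aemeasurable hone] with ω hω
    have hm : Measurable (q' (X ω)) := hq'm.of_uncurry_left
    have hFm : Measurable fun y => F (X ω, y) := hF.comp measurable_prodMk_left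
    rw [hκa, lintegral_withDensity_eq_lintegral_mul _ hm hFm]
    have hωA : X ω ∈ A := hω
    simp only [hq', hωA, if_true]
    rfl
  filter_upwards [condDistrib_ae_eq_of_measure_eq_compProd X hY.aemeasurable heq, hone] with x hx hx1
  have hxA : x ∈ A := hx1
  rw [hx, hκa]
  simp only [hq', hxA, if_true]

end CondDistrib

lemma chainWeight_snocR_eq (α : ℝ) {n : ℕ} (v : Fin (n + 1) → ℝ) (u : ℝ) :
    chainWeight α (n + 1) (snocR v u) =
      chainWeight α n v * ENNReal.ofReal (Theta α (v (Fin.last n) - u) / v (Fin.last n)) := by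
  have := chainWeight_snocR α (fun i : Fin n => v i.castSucc) (v (Fin.last n)) u
  rwa [← eq_snocR] at this

/-- The joint density of the first residual sums. -/
def jointDensity (α : ℝ) (m n : ℕ) (v : Fin (n + 1) → ℝ) : ℝ≥0∞ :=
  (m + 1).ascFactorial n * ENNReal.ofReal (sumDensity α (m + n) (v (Fin.last n))) * chainWeight α n v

lemma measurable_jointDensity (α : ℝ) (m n : ℕ) : Measurable (jointDensity α m n) := by
  have := measurable_chainWeight α n
  unfold jointDensity
  fun_prop

lemma ae_last {n : ℕ} {p : ℝ → Prop} (h : ∀ᵐ t, p t) :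
    ∀ᵐ v : Fin (n + 1) → ℝ, p (v (Fin.last n)) :=
  (Measure.quasiMeasurePreserving_eval (fun _ : Fin (n + 1) => (volume : Measure ℝ))
    (Fin.last n)).ae h

lemma measurable_transitionDensity {g : ℕ → ℝ → ℝ} (hg : ∀ k, Measurable (g (k + 1))) (m n : ℕ) :
    Measurable (Function.uncurry fun t s =>
      ENNReal.ofReal (transitionDensity α g (m + 1) n t s)) := by
  have h1 : g (m + 1 + n) = g (m + n + 1) := by rw [add_right_comm]
  have h2 : g (m + 1 + n + 1) = g (m + n + 1 + 1) := by rw [add_right_comm m]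
  have hg1 := hg (m + n)
  have hg2 := hg (m + n + 1)
  refine ENNReal.measurable_ofReal.comp ?_
  have hs : MeasurableSet {p : ℝ × ℝ | p.2 ∈ Set.Ioo 0 p.1} :=
    (measurableSet_lt measurable_const measurable_snd).inter
      (measurableSet_lt measurable_snd measurable_fst)
  have : (fun p : ℝ × ℝ => transitionDensity α g (m + 1) n p.1 p.2) =
      {p : ℝ × ℝ | p.2 ∈ Set.Ioo 0 p.1}.indicator fun p =>
        (((m + 1 : ℕ) : ℝ) + n) * (Theta α (p.1 - p.2) / p.1) *
          (g (m + n + 1 + 1) p.2 / g (m + n + 1) p.1) := by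
    funext p
    rw [transitionDensity, h1, h2]
    rfl
  rw [this]
  refine Measurable.indicator ?_ hs
  fun_prop

/-- Almost everywhere positivity of the density at t > 0 permits the division in the transition
density. Outside 0 < u < t both sides vanish, through the density if u ≤ 0 and through Θ if u ≥ t.
-/
lemma ae_jointDensity_snocR (hα0 : 0 < α) (hα1 : α < 1) {g : ℕ → ℝ → ℝ}
    (hg : ∀ k, g (k + 1) = sumDensity α k) (m n : ℕ) :
    ∀ᵐ v : Fin (n + 1) → ℝ, ∀ᵐ u, jointDensity α m (n + 1) (snocR v u) =
      jointDensity α m n v *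
        ENNReal.ofReal (transitionDensity α g (m + 1) n (v (Fin.last n)) u) := by
  filter_upwards [ae_last (ae_sumDensity_pos hα0 hα1 (m + n))] with v hv
  filter_upwards [ae_sumDensity_eq_zero hα0 hα1 (m + n + 1)] with u hu
  set t := v (Fin.last n) with ht
  have h1 : g (m + 1 + n) = sumDensity α (m + n) := by rw [add_right_comm, hg]
  have h2 : g (m + 1 + n + 1) = sumDensity α (m + n + 1) := by rw [add_right_comm m, hg]
  rw [jointDensity, jointDensity, chainWeight_snocR_eq, snocR_last, transitionDensity, h1, h2, ← ht,
    ← add_assoc]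
  by_cases hut : u ∈ Set.Ioo 0 t
  · have ht0 : 0 < t := hut.1.trans hut.2
    have hpos := hv ht0
    rw [Set.indicator_of_mem hut]
    have e : ENNReal.ofReal (sumDensity α (m + n) t) * ENNReal.ofReal (((m + 1 : ℕ) + n : ℝ) *
        (Theta α (t - u) / t) * (sumDensity α (m + n + 1) u / sumDensity α (m + n) t)) =
        ((m + 1 + n : ℕ) : ℝ≥0∞) * (ENNReal.ofReal (sumDensity α (m + n + 1) u) *
          ENNReal.ofReal (Theta α (t - u) / t)) := by
      rw [← ENNReal.ofReal_mul hpos.le, ← ENNReal.ofReal_mul (sumDensity_nonneg _ _ _),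
        ← ENNReal.ofReal_natCast, ← ENNReal.ofReal_mul (by positivity)]
      congr 1
      push_cast
      field_simp
    calc _ = chainWeight α n v * ((m + 1).ascFactorial n) *
          (((m + 1 + n : ℕ) : ℝ≥0∞) * (ENNReal.ofReal (sumDensity α (m + n + 1) u) *
          ENNReal.ofReal (Theta α (t - u) / t))) := by
          rw [Nat.ascFactorial_succ]; push_cast; ring
      _ = _ := by rw [← e]; ring
  · rw [Set.indicator_of_notMem hut, ENNReal.ofReal_zero, mul_zero]
    rw [Set.mem_Ioo, not_and_or, not_lt, not_lt] at hut
    rcases hut with h | h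
    · rw [hu h]; simp
    · rw [Theta_of_notMem fun h' => by linarith [h'.1]]; simp

lemma ae_jointDensity_eq (hα0 : 0 < α) (hα1 : α < 1) {g : ℕ → ℝ → ℝ}
    (hg : ∀ k, g (k + 1) = sumDensity α k) (m n : ℕ) :
    ∀ᵐ v : Fin (n + 1) → ℝ, jointDensity α m n v =
      ENNReal.ofReal (densityT α g (m + 1) n v) := by
  filter_upwards [ae_last (ae_sumDensity_eq_zero hα0 hα1 (m + n))] with v hv
  have h1 : g (m + 1 + n) = sumDensity α (m + n) := by rw [add_right_comm, hg]
  rw [jointDensity, densityT, h1]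
  by_cases hmem : StrictAnti v ∧ 0 < v (Fin.last n)
  · rw [Set.indicator_of_mem (by exact hmem), ENNReal.ofReal_mul
      (mul_nonneg (Nat.cast_nonneg _) (sumDensity_nonneg _ _ _)), ENNReal.ofReal_mul
      (Nat.cast_nonneg _), ENNReal.ofReal_natCast, chainWeight, ENNReal.ofReal_prod_of_nonneg]
    exact fun i _ => div_nonneg (Theta_nonneg hα0 _)
      (hmem.2.le.trans (hmem.1.antitone (Fin.le_last _)))
  · rw [Set.indicator_of_notMem (by exact hmem), ENNReal.ofReal_zero]
    rw [not_and_or] at hmem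
    rcases hmem with h | h
    · rw [Fin.strictAnti_iff_succ_lt] at h
      push Not at h
      obtain ⟨i, hi⟩ := h
      have : chainWeight α n v = 0 := by
        rw [chainWeight, Finset.prod_eq_zero_iff]
        refine ⟨i, Finset.mem_univ _, ?_⟩
        rw [Theta_of_notMem fun h' => by linarith [h'.1]]; simp
      rw [this, mul_zero]
    · rw [hv (not_lt.1 h)]; simp

section Subordinator

variable {Ω : Type*} [MeasurableSpace Ω] {P : Measure Ω} [IsProbabilityMeasure P]
  {S : ℝ≥0 → Ω → ℝ} {m : ℕ} {Jt : ℕ → Ω → ℝ}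

/-- The functional depends on the remaining sequence only through its total, whose law has density
`sumDensity α (m + n)`. -/
lemma lintegral_residualSum (hα0 : 0 < α) (hα1 : α < 1) (hc : 0 < c)
    (hS : IsStableSubordinator S α c P) (hJt : IsSizeBiasedPermutation S (m + 1) Jt P) (n : ℕ)
    {F : (Fin (n + 1) → ℝ) → ℝ≥0∞} (hF : Measurable F) :
    ∫⁻ ω, F (fun i => residualSum S (m + 1) Jt i ω) ∂P = ∫⁻ v, jointDensity α m n v * F v := by
  have hsn : Measurable fun p : (Fin n → ℝ) × (ℕ → ℝ) => snocR p.1 (total p.2) :=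
    measurable_snocR measurable_fst (by fun_prop)
  have h := lintegral_residualSum_remainingSeq hα0 hα1 hc hS hJt n
    (Ψ := fun τ s => F (snocR τ (total s))) (hF.comp hsn)
  have hsn' : Measurable fun p : ℝ × (Fin n → ℝ) => snocR p.2 p.1 :=
    measurable_snocR measurable_snd measurable_fst
  have hWF : Measurable fun p : ℝ × (Fin n → ℝ) =>
      chainWeight α n (snocR p.2 p.1) * F (snocR p.2 p.1) :=
    ((measurable_chainWeight α n).comp hsn').mul (hF.comp hsn')
  have hI : Measurable fun t => ∫⁻ τ : Fin n → ℝ, chainWeight α n (snocR τ t) * F (snocR τ t) :=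
    hWF.lintegral_prod_right'
  rw [← lintegral_sumLaw hI, lintegral_sumLaw_density hα0 hα1 _ hI] at h
  have hd : Measurable fun v => jointDensity α m n v * F v := (measurable_jointDensity α m n).mul hF
  rw [lintegral_snocR hd]
  have hd' : Measurable fun p : (Fin n → ℝ) × ℝ =>
      jointDensity α m n (snocR p.1 p.2) * F (snocR p.1 p.2) :=
    hd.comp (measurable_snocR measurable_fst measurable_snd)
  rw [lintegral_lintegral_swap (f := fun τ t => jointDensity α m n (snocR τ t) * F (snocR τ t))
    hd'.aemeasurable]
  refine Eq.trans (lintegral_congr_ae ?_) (h.trans ?_)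
  · filter_upwards [ae_remainingSeq hα0 hα1 hc hS hJt] with ω ⟨_, hω⟩
    obtain ⟨-, -, ht, -⟩ := hω n
    rw [ht, eq_snocR fun i : Fin (n + 1) => residualSum S (m + 1) Jt i ω]
    rfl
  · rw [← lintegral_const_mul' _ _ (by finiteness)]
    refine lintegral_congr fun t => ?_
    rw [← lintegral_const_mul' _ _ (by finiteness), ← lintegral_const_mul' _ _ (by finiteness)]
    refine lintegral_congr fun τ => ?_
    rw [jointDensity, snocR_last]
    ring

theorem hasLaw_residualSum (hα0 : 0 < α) (hα1 : α < 1) (hc : 0 < c)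
    (hS : IsStableSubordinator S α c P) (hJt : IsSizeBiasedPermutation S (m + 1) Jt P)
    {g : ℕ → ℝ → ℝ} (hg : ∀ k, g (k + 1) = sumDensity α k) (n : ℕ) :
    HasLaw (fun ω (i : Fin (n + 1)) => residualSum S (m + 1) Jt i ω)
      (volume.withDensity fun t => ENNReal.ofReal (densityT α g (m + 1) n t)) P := by
  have hm : Measurable fun ω (i : Fin (n + 1)) => residualSum S (m + 1) Jt i ω :=
    measurable_pi_iff.2 fun i => measurable_residualSum hS hJt i
  refine ⟨hm.aemeasurable, ?_⟩
  rw [← withDensity_congr_ae (ae_jointDensity_eq hα0 hα1 hg m n)]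
  refine Measure.ext_of_lintegral _ fun F hF => ?_
  rw [lintegral_map hF hm, lintegral_residualSum hα0 hα1 hc hS hJt n hF,
    lintegral_withDensity_eq_lintegral_mul _ (measurable_jointDensity α m n) hF]
  rfl

lemma lintegral_residualSum_succ (hα0 : 0 < α) (hα1 : α < 1) (hc : 0 < c)
    (hS : IsStableSubordinator S α c P) (hJt : IsSizeBiasedPermutation S (m + 1) Jt P)
    {g : ℕ → ℝ → ℝ} (hg : ∀ k, g (k + 1) = sumDensity α k) (n : ℕ)
    {F : (Fin (n + 1) → ℝ) × ℝ → ℝ≥0∞} (hF : Measurable F) :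
    ∫⁻ ω, F (fun i => residualSum S (m + 1) Jt i ω, residualSum S (m + 1) Jt (n + 1) ω) ∂P =
      ∫⁻ ω, (∫⁻ u, ENNReal.ofReal
        (transitionDensity α g (m + 1) n (residualSum S (m + 1) Jt n ω) u) *
          F (fun i => residualSum S (m + 1) Jt i ω, u)) ∂P := by
  have hq := measurable_transitionDensity (α := α) (g := g)
    (fun k => by rw [hg]; exact measurable_sumDensity α k) m n
  have hq' : Measurable fun p : (Fin (n + 1) → ℝ) × ℝ =>
      ENNReal.ofReal (transitionDensity α g (m + 1) n (p.1 (Fin.last n)) p.2) := by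
    have : Measurable fun p : (Fin (n + 1) → ℝ) × ℝ => (p.1 (Fin.last n), p.2) := by fun_prop
    exact hq.comp this
  have hG : Measurable fun v : Fin (n + 1) → ℝ => ∫⁻ u, ENNReal.ofReal
      (transitionDensity α g (m + 1) n (v (Fin.last n)) u) * F (v, u) :=
    (hq'.mul hF).lintegral_prod_right'
  have hF' : Measurable fun w : Fin (n + 2) → ℝ =>
      F (fun i : Fin (n + 1) => w i.castSucc, w (Fin.last (n + 1))) := by
    refine hF.comp ?_
    fun_prop
  have h1 := lintegral_residualSum hα0 hα1 hc hS hJt (n + 1) hF'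
  have h2 := lintegral_residualSum hα0 hα1 hc hS hJt n hG
  refine Eq.trans h1 (Eq.trans ?_ h2.symm)
  refine (lintegral_snocR ((measurable_jointDensity α m (n + 1)).mul hF')).trans
    (lintegral_congr_ae ?_)
  filter_upwards [ae_jointDensity_snocR hα0 hα1 hg m n] with v hv
  have hm : Measurable fun u => ENNReal.ofReal
      (transitionDensity α g (m + 1) n (v (Fin.last n)) u) * F (v, u) :=
    (hq'.mul hF).comp measurable_prodMk_left
  rw [← lintegral_const_mul _ hm]
  refine lintegral_congr_ae ?_
  filter_upwards [hv] with u hu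
  simp only [Pi.mul_apply, snocR_castSucc, snocR_last]
  rw [hu, mul_assoc]

theorem condDistrib_residualSum (hα0 : 0 < α) (hα1 : α < 1) (hc : 0 < c)
    (hS : IsStableSubordinator S α c P) (hJt : IsSizeBiasedPermutation S (m + 1) Jt P)
    {g : ℕ → ℝ → ℝ} (hg : ∀ k, g (k + 1) = sumDensity α k) (n : ℕ) :
    ∀ᵐ t ∂P.map (residualSum S (m + 1) Jt n),
      condDistrib (residualSum S (m + 1) Jt (n + 1)) (residualSum S (m + 1) Jt n) P t =
        volume.withDensity fun s => ENNReal.ofReal (transitionDensity α g (m + 1) n t s) := by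
  refine condDistrib_ae_eq_withDensity (measurable_residualSum hS hJt n)
    (measurable_residualSum hS hJt (n + 1)) (measurable_transitionDensity
    (fun k => by rw [hg]; exact measurable_sumDensity α k) m n) fun F hF => ?_
  have hF' : Measurable fun p : (Fin (n + 1) → ℝ) × ℝ => F (p.1 (Fin.last n), p.2) := by
    refine hF.comp ?_
    fun_prop
  exact lintegral_residualSum_succ hα0 hα1 hc hS hJt hg n hF'

theorem isMarkovChain_residualSum (hα0 : 0 < α) (hα1 : α < 1) (hc : 0 < c)
    (hS : IsStableSubordinator S α c P) (hJt : IsSizeBiasedPermutation S (m + 1) Jt P)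
    {g : ℕ → ℝ → ℝ} (hg : ∀ k, g (k + 1) = sumDensity α k) :
    IsMarkovChain (residualSum S (m + 1) Jt) P := by
  set T := residualSum S (m + 1) Jt with hT
  have hTm : ∀ n, Measurable (T n) := fun n => measurable_residualSum hS hJt n
  refine ⟨hTm, fun n A hA => ?_⟩
  have hX : Measurable fun ω (i : Fin (n + 1)) => T i ω := measurable_pi_iff.2 fun i => hTm i
  have hq := measurable_transitionDensity (α := α) (g := g)
    (fun k => by rw [hg]; exact measurable_sumDensity α k) m n
  have hq' : Measurable fun p : (Fin (n + 1) → ℝ) × ℝ =>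
      ENNReal.ofReal (transitionDensity α g (m + 1) n (p.1 (Fin.last n)) p.2) := by
    have : Measurable fun p : (Fin (n + 1) → ℝ) × ℝ => (p.1 (Fin.last n), p.2) := by fun_prop
    exact hq.comp this
  -- The conditional law given the whole past has a density involving only the last coordinate, so
  -- it equals the conditional law given the present.
  have h1 := condDistrib_ae_eq_withDensity hX (hTm (n + 1)) (q := fun v u =>
      ENNReal.ofReal (transitionDensity α g (m + 1) n (v (Fin.last n)) u)) hq'
    fun F hF => lintegral_residualSum_succ hα0 hα1 hc hS hJt hg n hF
  have h2 := condDistrib_residualSum hα0 hα1 hc hS hJt hg n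
  refine (condDistrib_ae_eq_condExp hX (hTm (n + 1)) hA).symm.trans
    (EventuallyEq.trans ?_ (condDistrib_ae_eq_condExp (hTm n) (hTm (n + 1)) hA))
  filter_upwards [ae_of_ae_map hX.aemeasurable h1, ae_of_ae_map (hTm n).aemeasurable h2]
    with ω hω1 hω2
  rw [hω1, hω2]
  rfl

end Subordinator

end TrimmedStable

end

/-! ### Non-homogeneity of the chain. -/

noncomputable section

namespace TrimmedStable

variable {α c : ℝ}

lemma exists_mem_Ioo_of_ae {p : ℝ → Prop} (h : ∀ᵐ t, p t) {a b : ℝ} (hab : a < b) :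
    ∃ t ∈ Set.Ioo a b, p t := by
  have hne : (ae (volume.restrict (Set.Ioo a b))).NeBot := by
    rw [ae_neBot, Ne, Measure.restrict_eq_zero, Real.volume_Ioo]
    simpa only [ENNReal.ofReal_eq_zero, not_le, sub_pos] using hab
  have h1 : ∀ᵐ t ∂volume.restrict (Set.Ioo a b), p t := ae_restrict_of_ae h
  obtain ⟨t, ht, hmem⟩ := (h1.and (ae_restrict_mem measurableSet_Ioo)).exists
  exact ⟨t, hmem, ht⟩

/-- Functions that are proportional on almost all intervals of length one are proportional. -/
lemma exists_ae_eq_const_mul {a b : ℝ → ℝ} (ha : ∀ᵐ u, 0 < u → 0 < a u)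
    (h : ∀ᵐ t, 0 < t → ∃ c : ℝ, ∀ᵐ u, 0 < u → u ∈ Set.Ioo (t - 1) t → b u = c * a u) :
    ∃ c : ℝ, ∀ᵐ u, 0 < u → b u = c * a u := by
  -- With t_k between k/2 and (k+1)/2, the unit intervals ending at consecutive t_k overlap in a set
  -- of positive measure, where the two constants can be compared.
  have hk : ∀ k : ℕ, ∃ t ∈ Set.Ioo ((k : ℝ) / 2) ((k + 1 : ℝ) / 2),
      0 < t → ∃ c : ℝ, ∀ᵐ u, 0 < u → u ∈ Set.Ioo (t - 1) t → b u = c * a u :=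
    fun k => exists_mem_Ioo_of_ae h (by linarith)
  choose t htmem ht using hk
  have ht0 : ∀ k, 0 < t k := fun k => lt_of_le_of_lt (by positivity) (htmem k).1
  choose c hc using fun k => ht k (ht0 k)
  have hstep : ∀ k, c k = c 0 := by
    intro k
    induction k with
    | zero => rfl
    | succ k ih =>
      have h1 := (htmem k).1
      have h2 := (htmem (k + 1)).2
      have h3 := (htmem k).2
      have h4 := (htmem (k + 1)).1
      push_cast at h2 h4
      have hlt : max 0 (t (k + 1) - 1) < t k := max_lt (ht0 k) (by linarith)
      obtain ⟨u, hu, ⟨hu1, hu2⟩, hu3⟩ :=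
        exists_mem_Ioo_of_ae (((hc k).and (hc (k + 1))).and ha) hlt
      have hu0 : 0 < u := (le_max_left _ _).trans_lt hu.1
      have hu4 : t (k + 1) - 1 < u := (le_max_right _ _).trans_lt hu.1
      have e1 := hu1 hu0 ⟨by linarith, hu.2⟩
      have e2 := hu2 hu0 ⟨hu4, by linarith [hu.2]⟩
      rw [← ih]
      exact mul_right_cancel₀ (hu3 hu0).ne' (e2.symm.trans e1)
  refine ⟨c 0, ?_⟩
  filter_upwards [ae_all_iff.2 hc] with u hu hu0
  -- The index k = ⌊2u⌋ + 1 gives u < t_k < u + 1.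
  have h1 := Nat.lt_floor_add_one (2 * u)
  have h2 := Nat.floor_le (a := 2 * u) (by linarith)
  have h3 := htmem (⌊2 * u⌋₊ + 1)
  push_cast at h3
  rw [← hstep (⌊2 * u⌋₊ + 1)]
  exact hu _ hu0 ⟨by linarith [h3.2], by linarith [h3.1]⟩

/-- Both functions are probability densities, so proportionality means equality; but the means are
(m + 2)α/(1-α) and (m + 1)α/(1-α). -/
lemma sumDensity_not_proportional (hα0 : 0 < α) (hα1 : α < 1) (m : ℕ) (c : ℝ) :
    ¬ ∀ᵐ u, 0 < u → sumDensity α (m + 1) u = c * sumDensity α m u := by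
  intro h
  have h1 : ∀ᵐ u, ENNReal.ofReal (sumDensity α (m + 1) u) =
      ENNReal.ofReal c * ENNReal.ofReal (sumDensity α m u) := by
    filter_upwards [h, ae_sumDensity_eq_zero hα0 hα1 m, ae_sumDensity_eq_zero hα0 hα1 (m + 1)]
      with u hu hu1 hu2
    rcases lt_or_ge 0 u with h0 | h0
    · rw [hu h0, mul_comm, ENNReal.ofReal_mul (sumDensity_nonneg _ _ _), mul_comm]
    · rw [hu1 h0, hu2 h0]; simp
  have h2 : sumLaw α (m + 1) = ENNReal.ofReal c • sumLaw α m := by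
    rw [sumLaw_eq_withDensity hα0 hα1, sumLaw_eq_withDensity hα0 hα1 m, withDensity_congr_ae h1,
      ← withDensity_smul _ (by fun_prop)]
    rfl
  have h3 : ENNReal.ofReal c = 1 := by
    have := congrArg (fun μ => μ Set.univ) h2
    simpa using this.symm
  rw [h3, one_smul] at h2
  have h4 := lintegral_ofReal_sumLaw hα0 hα1 (m + 1)
  rw [h2, lintegral_ofReal_sumLaw hα0 hα1 m] at h4
  have hpos : 0 < α / (1 - α) := div_pos hα0 (by linarith)
  rw [ENNReal.mul_left_inj (by simpa using hpos) ENNReal.ofReal_ne_top] at h4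
  have : (m + 1 : ℕ) = m + 1 + 1 := by exact_mod_cast h4
  omega

lemma transitionDensity_pos (hα0 : 0 < α) {g : ℕ → ℝ → ℝ} {m n : ℕ} {t u : ℝ} (hu : 0 < u)
    (hut : u ∈ Set.Ioo (t - 1) t) (h1 : 0 < g (m + 1 + n) t) (h2 : 0 < g (m + 1 + n + 1) u) :
    0 < transitionDensity α g (m + 1) n t u := by
  have hmem : t - u ∈ Set.Ioo (0 : ℝ) 1 := ⟨by linarith [hut.2], by linarith [hut.1]⟩
  have h3 := Real.rpow_pos_of_pos hmem.1 (-α)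
  have ht : 0 < t := hu.trans hut.2
  rw [transitionDensity, Set.indicator_of_mem (show u ∈ Set.Ioo 0 t from ⟨hu, hut.2⟩),
    Theta_of_mem hmem]
  positivity

section Subordinator

variable {Ω : Type*} [MeasurableSpace Ω] {P : Measure Ω} [IsProbabilityMeasure P]
  {S : ℝ≥0 → Ω → ℝ} {m : ℕ} {Jt : ℕ → Ω → ℝ}

lemma ae_pos_of_ae_residualSum_zero (hα0 : 0 < α) (hα1 : α < 1) (hc : 0 < c)
    (hS : IsStableSubordinator S α c P) {p : ℝ → Prop}
    (h : ∀ᵐ t ∂P.map (residualSum S (m + 1) Jt 0), p t) : ∀ᵐ t, 0 < t → p t := by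
  change ∀ᵐ t ∂P.map (ratioSum S (m + 1)), p t at h
  rw [map_ratioSum hα0 hα1 hc hS, sumLaw_eq_withDensity hα0 hα1,
    ae_withDensity_iff (by fun_prop)] at h
  filter_upwards [h, ae_sumDensity_pos hα0 hα1 m] with t ht hpos h0
  exact ht (by simpa using hpos h0)

/-- The transition density from t is positive on (t - 1, t) for almost every t > 0, so a null set
for the law of T_1 is Lebesgue null in each such interval; exchanging the order of t and u covers
almost every u > 0. -/
lemma ae_pos_of_ae_residualSum_one (hα0 : 0 < α) (hα1 : α < 1) (hc : 0 < c)
    (hS : IsStableSubordinator S α c P) (hJt : IsSizeBiasedPermutation S (m + 1) Jt P) {p : ℝ → Prop}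
    (h : ∀ᵐ t ∂P.map (residualSum S (m + 1) Jt 1), p t) : ∀ᵐ t, 0 < t → p t := by
  obtain ⟨N, hN, hNm, hN0⟩ := exists_measurable_superset_of_null (ae_iff.1 h)
  set g : ℕ → ℝ → ℝ := fun k => sumDensity α (k - 1) with hg'
  have hg : ∀ k, g (k + 1) = sumDensity α k := fun k => by simp [hg']
  have hgm : ∀ k, Measurable (g (k + 1)) := fun k => by rw [hg]; exact measurable_sumDensity α k
  have hNi : Measurable (N.indicator (1 : ℝ → ℝ≥0∞)) := measurable_one.indicator hNm
  have hq := measurable_transitionDensity (α := α) hgm m 0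
  have hqN : Measurable fun p : ℝ × ℝ => ENNReal.ofReal (transitionDensity α g (m + 1) 0 p.1 p.2) *
      N.indicator 1 p.2 := hq.mul (hNi.comp measurable_snd)
  have hI : Measurable fun t => ∫⁻ u, ENNReal.ofReal (transitionDensity α g (m + 1) 0 t u) *
      N.indicator 1 u := hqN.lintegral_prod_right'
  have h1 := lintegral_residualSum_succ hα0 hα1 hc hS hJt hg 0
    (F := fun p => N.indicator (1 : ℝ → ℝ≥0∞) p.2) (hNi.comp measurable_snd)
  rw [zero_add, ← lintegral_map hNi (measurable_residualSum hS hJt 1),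
    lintegral_indicator_one hNm, hN0, eq_comm, ← lintegral_map hI (measurable_residualSum hS hJt 0),
    lintegral_eq_zero_iff hI] at h1
  have h2 : ∀ᵐ t, ∀ᵐ u, 0 < u → u ∈ Set.Ioo (t - 1) t → u ∉ N := by
    filter_upwards [ae_pos_of_ae_residualSum_zero hα0 hα1 hc hS h1, ae_sumDensity_pos hα0 hα1 m]
      with t ht hpos
    rcases le_or_gt t 0 with h0 | h0
    · exact ae_of_all _ fun u hu hut => by linarith [hut.2]
    · have ht := ht h0
      have hqt : Measurable fun u => ENNReal.ofReal (transitionDensity α g (m + 1) 0 t u) *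
          N.indicator 1 u := hqN.comp measurable_prodMk_left
      rw [Pi.zero_apply, lintegral_eq_zero_iff hqt] at ht
      filter_upwards [ht, ae_sumDensity_pos hα0 hα1 (m + 1)] with u hu hu0 hupos hut huN
      have h3 := transitionDensity_pos (g := g) (m := m) (n := 0) hα0 hupos hut
        (by rw [add_zero, hg]; exact hpos h0) (by rw [add_zero, hg]; exact hu0 hupos)
      exact absurd (by simpa [huN] using hu) (not_le.2 h3)
  have hms : MeasurableSet {p : ℝ × ℝ | 0 < p.2 → p.2 ∈ Set.Ioo (p.1 - 1) p.1 → p.2 ∉ N} := by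
    have a1 : MeasurableSet {p : ℝ × ℝ | 0 < p.2} := measurableSet_lt measurable_const measurable_snd
    have a2 : MeasurableSet {p : ℝ × ℝ | p.2 ∈ Set.Ioo (p.1 - 1) p.1} :=
      (measurableSet_lt (measurable_fst.sub_const 1) measurable_snd).inter
        (measurableSet_lt measurable_snd measurable_fst)
    have a3 : MeasurableSet {p : ℝ × ℝ | p.2 ∈ N} := measurable_snd hNm
    exact a1.imp (a2.imp a3.compl)
  filter_upwards [(Measure.ae_ae_comm hms).1 h2] with u hu h0
  obtain ⟨t, ht, htu⟩ := exists_mem_Ioo_of_ae hu (show u < u + 1 by linarith)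
  by_contra hp
  exact htu h0 ⟨by linarith [ht.2], ht.1⟩ (hN hp)

/-- The laws of T_0 and T_1 have the Lebesgue null sets on (0, ∞), so a common kernel equates the
first two transition densities for almost every t. The factor Θ(t - u) / t cancels, which makes the
densities of indices m + 2 and m + 1 proportional on (t - 1, t), and then on (0, ∞). -/
theorem not_isTimeHomogeneous_residualSum (hα0 : 0 < α) (hα1 : α < 1) (hc : 0 < c)
    (hS : IsStableSubordinator S α c P) (hJt : IsSizeBiasedPermutation S (m + 1) Jt P) :
    ¬ IsTimeHomogeneous (residualSum S (m + 1) Jt) P := by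
  rintro ⟨κ, hκ⟩
  set g : ℕ → ℝ → ℝ := fun k => sumDensity α (k - 1) with hg'
  have hg : ∀ k, g (k + 1) = sumDensity α k := fun k => by simp [hg']
  have hgm : ∀ k, Measurable (g (k + 1)) := fun k => by rw [hg]; exact measurable_sumDensity α k
  have key : ∀ n, ∀ᵐ t ∂P.map (residualSum S (m + 1) Jt n), IsProbabilityMeasure (κ t) ∧
      κ t = volume.withDensity fun s => ENNReal.ofReal (transitionDensity α g (m + 1) n t s) := by
    intro n
    filter_upwards [hκ n, condDistrib_residualSum hα0 hα1 hc hS hJt hg n] with t h1 h2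
    exact ⟨h1 ▸ inferInstance, h1.symm.trans h2⟩
  have h0 := ae_pos_of_ae_residualSum_zero hα0 hα1 hc hS (key 0)
  have h1 := ae_pos_of_ae_residualSum_one hα0 hα1 hc hS hJt (key 1)
  obtain ⟨C, hC⟩ := exists_ae_eq_const_mul (ae_sumDensity_pos hα0 hα1 (m + 1))
    (b := sumDensity α (m + 1 + 1)) (by
      filter_upwards [h0, h1, ae_sumDensity_pos hα0 hα1 (m + 1), ae_sumDensity_pos hα0 hα1 m] with t ht0 ht1 hpos hpos0 htpos
      obtain ⟨hp, e0⟩ := ht0 htpos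
      obtain ⟨-, e1⟩ := ht1 htpos
      have hpos := hpos htpos
      have hpos0 := hpos0 htpos
      refine ⟨(m + 1) * sumDensity α (m + 1) t / ((m + 2) * sumDensity α m t), ?_⟩
      have hfin : ∫⁻ s, ENNReal.ofReal (transitionDensity α g (m + 1) 0 t s) ≠ ∞ := by
        have := hp.measure_univ
        rw [e0, withDensity_apply _ MeasurableSet.univ, Measure.restrict_univ] at this
        rw [this]; exact ENNReal.one_ne_top
      have hm : ∀ n, Measurable fun s => ENNReal.ofReal (transitionDensity α g (m + 1) n t s) :=
        fun n => (measurable_transitionDensity hgm m n).of_uncurry_left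
      have heq := (withDensity_eq_iff (hm 0).aemeasurable (hm 1).aemeasurable hfin).1
        (e0.symm.trans e1)
      filter_upwards [heq, ae_sumDensity_pos hα0 hα1 (m + 1),
        ae_sumDensity_pos hα0 hα1 (m + 1 + 1)] with u hu hu1 hu2 hu0 hut
      have hmem : u ∈ Set.Ioo 0 t := ⟨hu0, hut.2⟩
      have hmem' : t - u ∈ Set.Ioo (0 : ℝ) 1 := ⟨by linarith [hut.2], by linarith [hut.1]⟩
      have hΘ : 0 < Theta α (t - u) := by
        rw [Theta_of_mem hmem']
        have := Real.rpow_pos_of_pos hmem'.1 (-α)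
        positivity
      have p0 := transitionDensity_pos (g := g) (m := m) (n := 0) hα0 hu0 hut
        (by rw [add_zero, hg]; exact hpos0) (by rw [add_zero, hg]; exact hu1 hu0)
      have p1 := transitionDensity_pos (g := g) (m := m) (n := 1) hα0 hu0 hut
        (by rw [hg]; exact hpos) (by rw [hg]; exact hu2 hu0)
      have hu := (ENNReal.ofReal_eq_ofReal_iff p0.le p1.le).1 hu
      rw [transitionDensity, transitionDensity, Set.indicator_of_mem hmem,
        Set.indicator_of_mem hmem] at hu
      simp only [add_zero, hg] at hu
      push_cast at hu
      field_simp at hu ⊢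
      linear_combination -hu)
  exact sumDensity_not_proportional hα0 hα1 (m + 1) C hC

end Subordinator

end TrimmedStable

end

/-! ### Residual fractions and the constants. -/

noncomputable section

namespace TrimmedStable

variable {α c : ℝ}

/-- Ratios of consecutive coordinates. -/
def consecutiveRatio {n : ℕ} (v : Fin (n + 1) → ℝ) : Fin n → ℝ := fun i => v i.succ / v i.castSucc

@[fun_prop] lemma measurable_consecutiveRatio {n : ℕ} :
    Measurable (consecutiveRatio : (Fin (n + 1) → ℝ) → Fin n → ℝ) :=
  measurable_pi_iff.2 fun i => by unfold consecutiveRatio; fun_prop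

lemma consecutiveRatio_snocR {n : ℕ} (τ : Fin n → ℝ) (s t : ℝ) :
    consecutiveRatio (snocR (snocR τ s) t) = snocR (consecutiveRatio (snocR τ s)) (t / s) := by
  funext i
  induction i using Fin.lastCases with
  | last => simp [consecutiveRatio]
  | cast i => simp [consecutiveRatio, ← Fin.castSucc_succ]

lemma prod_Ici_eq {n : ℕ} (f : Fin n → ℝ) (i : Fin n) :
    ∏ j ∈ Finset.Ici i, f j = ∏ j, if i ≤ j then f j else 1 := by
  rw [← Finset.prod_filter]
  congr 1
  ext j; simp

lemma prod_Ici_castSucc_snocR {n : ℕ} (u : Fin n → ℝ) (w : ℝ) (i : Fin n) :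
    ∏ j ∈ Finset.Ici i.castSucc, snocR u w j = (∏ j ∈ Finset.Ici i, u j) * w := by
  rw [prod_Ici_eq, prod_Ici_eq, Fin.prod_univ_castSucc]
  simp [Fin.le_last]

lemma prod_Ici_last_snocR {n : ℕ} (u : Fin n → ℝ) (w : ℝ) :
    ∏ j ∈ Finset.Ici (Fin.last n), snocR u w j = w := by
  have : Finset.Ici (Fin.last n) = {Fin.last n} := by
    ext j; simp [Fin.last_le_iff]
  rw [this, Finset.prod_singleton, snocR_last]

/-- The chain weight in terms of the ratios of consecutive coordinates and the last coordinate. -/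
def ratioWeight (α : ℝ) (n : ℕ) (u : Fin n → ℝ) (t : ℝ) : ℝ≥0∞ :=
  ∏ i, (Set.Ioo (0 : ℝ) 1).indicator 1 (u i) *
    ENNReal.ofReal (Theta α (t / (∏ j ∈ Finset.Ici i, u j) * (1 - u i)) / u i)

lemma measurable_ratioWeight {β : Type*} {_ : MeasurableSpace β} {n : ℕ} {f : β → Fin n → ℝ}
    {g : β → ℝ} (hf : Measurable f) (hg : Measurable g) :
    Measurable fun b => ratioWeight α n (f b) (g b) := by
  have hfi : ∀ i, Measurable fun b => f b i := measurable_pi_iff.1 hf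
  have hp : ∀ i : Fin n, Measurable fun b => ∏ j ∈ Finset.Ici i, f b j := fun i =>
    Finset.measurable_prod _ fun j _ => hfi j
  refine Finset.measurable_prod _ fun i _ => ?_
  have h1 : Measurable fun b => (Set.Ioo (0 : ℝ) 1).indicator (1 : ℝ → ℝ≥0∞) (f b i) :=
    (measurable_one.indicator measurableSet_Ioo).comp (hfi i)
  have h2 : Measurable fun b => g b / (∏ j ∈ Finset.Ici i, f b j) * (1 - f b i) :=
    (hg.div (hp i)).mul (measurable_const.sub (hfi i))
  exact h1.mul (ENNReal.measurable_ofReal.comp ((measurable_Theta.comp h2).div (hfi i)))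

lemma ratioWeight_snocR {n : ℕ} (u : Fin n → ℝ) (w t : ℝ) :
    ratioWeight α (n + 1) (snocR u w) t = ratioWeight α n u (t / w) *
      ((Set.Ioo (0 : ℝ) 1).indicator 1 w * ENNReal.ofReal (Theta α (t / w * (1 - w)) / w)) := by
  rw [ratioWeight, Fin.prod_univ_castSucc, ratioWeight]
  simp only [prod_Ici_castSucc_snocR, prod_Ici_last_snocR, snocR_castSucc, snocR_last]
  congr 1
  refine Finset.prod_congr rfl fun i _ => ?_
  rw [div_div, mul_comm w]

lemma setLIntegral_Ioi_eq {t : ℝ} (ht : 0 < t) (f : ℝ → ℝ≥0∞) :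
    ∫⁻ s in Set.Ioi t, f s = ∫⁻ w in Set.Ioo 0 1, ENNReal.ofReal (t / w ^ 2) * f (t / w) := by
  have himg : (fun w => t / w) '' Set.Ioo 0 1 = Set.Ioi t := by
    ext s
    constructor
    · rintro ⟨w, hw, rfl⟩
      exact (lt_div_iff₀ hw.1).2 (by nlinarith [hw.2])
    · intro hs
      have hs0 : 0 < s := ht.trans hs
      exact ⟨t / s, ⟨div_pos ht hs0, (div_lt_one hs0).2 hs⟩, by field_simp⟩
  have hinj : Set.InjOn (fun w => t / w) (Set.Ioo 0 1) := fun a ha b hb h => by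
    have ha0 := ha.1.ne'
    have hb0 := hb.1.ne'
    simp only at h
    field_simp at h
    exact h.symm
  have hd : ∀ w ∈ Set.Ioo (0 : ℝ) 1,
      HasDerivWithinAt (fun w => t / w) (-(t / w ^ 2)) (Set.Ioo 0 1) w := fun w hw => by
    have h := ((hasDerivAt_inv hw.1.ne').const_mul t).hasDerivWithinAt (s := Set.Ioo 0 1)
    have e : t * -(w ^ 2)⁻¹ = -(t / w ^ 2) := by rw [mul_neg, div_eq_mul_inv]
    rw [e] at h
    exact h
  rw [← himg, lintegral_image_eq_lintegral_abs_deriv_mul measurableSet_Ioo hd hinj]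
  refine setLIntegral_congr_fun measurableSet_Ioo fun w hw => ?_
  have : 0 ≤ t / w ^ 2 := by positivity
  simp only [abs_neg, abs_of_nonneg this]

/-- The substitution starts from the last coordinate t, held fixed: the preceding one is s = t / w,
with s - t = s(1 - w), and the Jacobian t / w² turns 1/s into 1/w. The remaining coordinates are
handled by induction with t / w in place of t. -/
lemma lintegral_chainWeight_consecutiveRatio {n : ℕ} {G : (Fin n → ℝ) → ℝ≥0∞}
    (hG : Measurable G) {t : ℝ} (ht : 0 < t) :
    ∫⁻ τ, chainWeight α n (snocR τ t) * G (consecutiveRatio (snocR τ t)) =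
      ∫⁻ u, ratioWeight α n u t * G u := by
  induction n generalizing t with
  | zero =>
    refine lintegral_congr fun τ => ?_
    rw [Subsingleton.elim (consecutiveRatio (snocR τ t)) τ]
    simp [chainWeight, ratioWeight]
  | succ n ih =>
    have hL : Measurable fun τ : Fin (n + 1) → ℝ =>
        chainWeight α (n + 1) (snocR τ t) * G (consecutiveRatio (snocR τ t)) := by
      have h1 : Measurable fun τ : Fin (n + 1) → ℝ => snocR τ t :=
        measurable_snocR measurable_id measurable_const
      exact ((measurable_chainWeight α _).comp h1).mul
        (hG.comp (measurable_consecutiveRatio.comp h1))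
    have hR : Measurable fun u : Fin (n + 1) → ℝ => ratioWeight α (n + 1) u t * G u :=
      (measurable_ratioWeight measurable_id measurable_const).mul hG
    rw [lintegral_snocR hL, lintegral_snocR hR]
    have hGw : ∀ w, Measurable fun u : Fin n → ℝ => G (snocR u w) := fun w =>
      hG.comp (measurable_snocR measurable_id measurable_const)
    set A : (Fin n → ℝ) → ℝ → ℝ≥0∞ := fun τ s => chainWeight α (n + 1) (snocR (snocR τ s) t) *
      G (consecutiveRatio (snocR (snocR τ s) t)) with hA
    set B : (Fin n → ℝ) → ℝ → ℝ≥0∞ := fun u w => ratioWeight α (n + 1) (snocR u w) t *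
      G (snocR u w) with hB
    have hAm : Measurable (Function.uncurry A) :=
      hL.comp (measurable_snocR measurable_fst measurable_snd)
    have hBm : Measurable (Function.uncurry B) :=
      hR.comp (measurable_snocR measurable_fst measurable_snd)
    rw [lintegral_lintegral_swap hAm.aemeasurable, lintegral_lintegral_swap hBm.aemeasurable]
    have hAs : ∀ s, ∫⁻ τ, A τ s = (Set.Ioi t).indicator (fun s => ENNReal.ofReal (Theta α (s - t) / s) *
        ∫⁻ u, ratioWeight α n u s * G (snocR u (t / s))) s := by
      intro s
      have e : ∀ τ, A τ s = ENNReal.ofReal (Theta α (s - t) / s) *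
          (chainWeight α n (snocR τ s) * G (snocR (consecutiveRatio (snocR τ s)) (t / s))) := by
        intro τ
        simp only [hA, consecutiveRatio_snocR, chainWeight_snocR]
        ring
      rw [lintegral_congr e, lintegral_const_mul' _ _ ENNReal.ofReal_ne_top]
      by_cases hs : s ∈ Set.Ioi t
      · rw [Set.indicator_of_mem hs, ih (hGw (t / s)) (ht.trans hs)]
      · rw [Set.indicator_of_notMem hs, Theta_of_notMem fun h => hs (by simpa using h.1)]
        simp
    have hBw : ∀ w, ∫⁻ u, B u w = (Set.Ioo 0 1).indicator (fun w =>
        ENNReal.ofReal (Theta α (t / w * (1 - w)) / w) *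
          ∫⁻ u, ratioWeight α n u (t / w) * G (snocR u w)) w := by
      intro w
      have e : ∀ u, B u w = ((Set.Ioo (0 : ℝ) 1).indicator 1 w *
          ENNReal.ofReal (Theta α (t / w * (1 - w)) / w)) *
          (ratioWeight α n u (t / w) * G (snocR u w)) := by
        intro u
        simp only [hB, ratioWeight_snocR]
        ring
      rw [lintegral_congr e, lintegral_const_mul' _ _ (by
        refine ENNReal.mul_ne_top ?_ ENNReal.ofReal_ne_top
        by_cases h : w ∈ Set.Ioo (0 : ℝ) 1 <;> simp [h])]
      by_cases h : w ∈ Set.Ioo (0 : ℝ) 1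
      · simp only [Set.indicator_of_mem h, Pi.one_apply, one_mul]
      · simp only [Set.indicator_of_notMem h, zero_mul]
    rw [lintegral_congr hAs, lintegral_congr hBw, lintegral_indicator measurableSet_Ioi,
      lintegral_indicator measurableSet_Ioo, setLIntegral_Ioi_eq ht]
    refine setLIntegral_congr_fun measurableSet_Ioo fun w hw => ?_
    have hw0 := hw.1
    have e1 : t / (t / w) = w := by field_simp
    have e2 : t / w - t = t / w * (1 - w) := by field_simp
    simp only [e1, e2]
    rw [← mul_assoc, ← ENNReal.ofReal_mul (by positivity)]
    congr 2
    field_simp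

/-- The factor u_j occurs in the inner product for each i ≤ j, that is j + 1 times in zero-based
numbering; hence the exponents of the Beta densities. -/
lemma prod_prod_Ici_rpow {n : ℕ} {u : Fin n → ℝ} (hu : ∀ i, 0 < u i) (α : ℝ) :
    ∏ i, (∏ j ∈ Finset.Ici i, u j) ^ α = ∏ j, u j ^ (((j : ℕ) + 1 : ℝ) * α) := by
  have h1 : ∀ i, (∏ j ∈ Finset.Ici i, u j) ^ α = ∏ j ∈ Finset.Ici i, u j ^ α := fun i =>
    (Real.finsetProd_rpow _ _ (fun j _ => (hu j).le) _).symm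
  simp_rw [h1]
  rw [Finset.prod_comm' (t' := Finset.univ) (s' := fun j => Finset.Iic j) (by simp)]
  refine Finset.prod_congr rfl fun j _ => ?_
  rw [Finset.prod_const, Fin.card_Iic, ← Real.rpow_natCast, ← Real.rpow_mul (hu j).le, mul_comm]
  push_cast
  rfl

/-- The Beta normalizations in the density h are compensated by 1 / K_n, up to the factor α^n coming
from the n factors Θ. -/
lemma constK_mul_pow (hα0 : 0 < α) (hα1 : α < 1) (n : ℕ) :
    constK α n * α ^ n = ∏ i : Fin n, Real.Gamma (((i : ℕ) + 1 : ℝ) * α + 1 - α) /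
      (Real.Gamma (((i : ℕ) + 1 : ℝ) * α) * Real.Gamma (1 - α)) := by
  have h1 : 0 < Real.Gamma (1 - α) := Real.Gamma_pos_of_pos (by linarith)
  rw [Fin.prod_univ_eq_prod_range (fun i => Real.Gamma (((i : ℕ) + 1 : ℝ) * α + 1 - α) /
      (Real.Gamma (((i : ℕ) + 1 : ℝ) * α) * Real.Gamma (1 - α))) n, Finset.prod_div_distrib,
    Finset.prod_mul_distrib, Finset.prod_const, Finset.card_range, constK]
  have e1 : ∏ i ∈ Finset.Icc 1 n, Real.Gamma (i * α) =
      ∏ i ∈ Finset.range n, Real.Gamma (((i : ℕ) + 1 : ℝ) * α) := by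
    rw [← Finset.Ico_add_one_right_eq_Icc, Finset.prod_Ico_eq_prod_range]
    refine Finset.prod_congr (by simp) fun i _ => ?_
    push_cast
    rw [add_comm]
  have e2 : ∏ i ∈ Finset.range n, Real.Gamma (((i : ℕ) + 1 : ℝ) * α + 1 - α) =
      ∏ i ∈ Finset.range n, Real.Gamma (1 + i * α) :=
    Finset.prod_congr rfl fun i _ => by congr 1; ring
  rw [e1, e2]
  have h2 : 0 < ∏ i ∈ Finset.range n, Real.Gamma (((i : ℕ) + 1 : ℝ) * α) :=
    Finset.prod_pos fun i _ => Real.Gamma_pos_of_pos (by positivity)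
  generalize ∏ i ∈ Finset.range n, Real.Gamma (1 + i * α) = Q
  field_simp

lemma constK_pos (hα0 : 0 < α) (hα1 : α < 1) (n : ℕ) : 0 < constK α n := by
  have h1 : 0 < Real.Gamma (1 - α) := Real.Gamma_pos_of_pos (by linarith)
  refine div_pos (Finset.prod_pos fun i _ => Real.Gamma_pos_of_pos (by positivity))
    (mul_pos (by positivity) (Finset.prod_pos fun i hi => Real.Gamma_pos_of_pos ?_))
  have : 1 ≤ i := (Finset.mem_Icc.1 hi).1
  positivity

/-- Induction on n: the quotient of consecutive constants contains Γ(nα + 1), which cancels, and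
Γ((n + 1)α), which the functional equation turns into Γ((n + 1)α + 1). -/
lemma constK_eq (hα0 : 0 < α) (hα1 : α < 1) (n : ℕ) : constK α n =
    Real.Gamma (n + 1) / (Real.Gamma (1 - α) ^ n * Real.Gamma (n * α + 1)) := by
  have h1 : 0 < Real.Gamma (1 - α) := Real.Gamma_pos_of_pos (by linarith)
  induction n with
  | zero => simp [constK]
  | succ n ih =>
    have h2 : 0 < Real.Gamma (n * α + 1) := Real.Gamma_pos_of_pos (by positivity)
    have h3 : 0 < Real.Gamma ((n + 1) * α) := Real.Gamma_pos_of_pos (by positivity)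
    have e1 : Real.Gamma ((n : ℝ) + 1 + 1) = (n + 1) * Real.Gamma (n + 1) :=
      Real.Gamma_add_one (by positivity)
    have e2 : Real.Gamma ((n + 1) * α + 1) = (n + 1) * α * Real.Gamma ((n + 1) * α) :=
      Real.Gamma_add_one (by positivity)
    have e3 : constK α (n + 1) = constK α n *
        (Real.Gamma (n * α + 1) / (α * Real.Gamma (1 - α) * Real.Gamma ((n + 1) * α))) := by
      rw [constK, constK, Finset.prod_range_succ, Finset.prod_Icc_succ_top (by omega), pow_succ,
        pow_succ, div_mul_div_comm, add_comm 1 ((n : ℝ) * α)]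
      push_cast
      congr 1
      ring
    rw [e3, ih]
    push_cast
    rw [e1, e2, pow_succ]
    field_simp

lemma ratioWeight_eq_zero {n : ℕ} {u : Fin n → ℝ} (h : ¬ ∀ i, u i ∈ Set.Ioo (0 : ℝ) 1) (t : ℝ) :
    ratioWeight α n u t = 0 := by
  push Not at h
  obtain ⟨i, hi⟩ := h
  rw [ratioWeight, Finset.prod_eq_zero_iff]
  exact ⟨i, Finset.mem_univ _, by rw [Set.indicator_of_notMem hi, zero_mul]⟩

/-- With p_i the product of the u_j for j ≥ i, the sum before pick i + 1 is t / p_i and the pick is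
(t / p_i)(1 - u_i). The condition that it be less than 1 is the indicator, and the powers p_i^α
combine through `prod_prod_Ici_rpow`. -/
lemma ratioWeight_eq (hα0 : 0 < α) (hα1 : α < 1) {n : ℕ} {u : Fin n → ℝ}
    (hu : ∀ i, u i ∈ Set.Ioo (0 : ℝ) 1) {t : ℝ} (ht : 0 < t) :
    ratioWeight α n u t = ENNReal.ofReal (1 / constK α n * t ^ (-(n : ℝ) * α) *
      ∏ i : Fin n,
        (Real.Gamma (((i : ℕ) + 1 : ℝ) * α + 1 - α) /
            (Real.Gamma (((i : ℕ) + 1 : ℝ) * α) * Real.Gamma (1 - α)) *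
          u i ^ (((i : ℕ) + 1 : ℝ) * α - 1) * (1 - u i) ^ (-α) *
          Set.indicator (Set.Iio ((∏ j ∈ Finset.Ici i, u j) / (1 - u i)))
            (fun _ => (1 : ℝ)) t)) := by
  set I : Fin n → ℝ := fun i => Set.indicator (Set.Iio ((∏ j ∈ Finset.Ici i, u j) / (1 - u i)))
            (fun _ => (1 : ℝ)) t with hI
  set p : Fin n → ℝ := fun i => ∏ j ∈ Finset.Ici i, u j with hp
  have hp0 : ∀ i, 0 < p i := fun i => Finset.prod_pos fun j _ => (hu j).1
  have hv0 : ∀ i, 0 < 1 - u i := fun i => by linarith [(hu i).2]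
  have hfac : ∀ i, Theta α (t / p i * (1 - u i)) / u i =
      α * t ^ (-α) * (p i ^ α * ((u i)⁻¹ * (1 - u i) ^ (-α)) * I i) := by
    intro i
    have hx : 0 < t / p i * (1 - u i) := mul_pos (div_pos ht (hp0 i)) (hv0 i)
    have hiff : t / p i * (1 - u i) < 1 ↔ t ∈ Set.Iio (p i / (1 - u i)) := by
      rw [Set.mem_Iio, lt_div_iff₀ (hv0 i), div_mul_eq_mul_div, div_lt_one (hp0 i)]
    by_cases h : t / p i * (1 - u i) < 1
    · rw [Theta_of_mem ⟨hx, h⟩, hI]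
      simp only
      rw [Set.indicator_of_mem (hiff.1 h), Real.mul_rpow (div_pos ht (hp0 i)).le (hv0 i).le,
        Real.div_rpow ht.le (hp0 i).le, Real.rpow_neg (hp0 i).le, div_inv_eq_mul]
      field_simp
    · rw [Theta_of_notMem fun h' => h h'.2, hI]
      simp only
      rw [Set.indicator_of_notMem (mt hiff.2 h)]
      simp
  have h1 : ratioWeight α n u t = ENNReal.ofReal (∏ i, Theta α (t / p i * (1 - u i)) / u i) := by
    rw [ratioWeight, ENNReal.ofReal_prod_of_nonneg fun i _ =>
      div_nonneg (Theta_nonneg hα0 _) (hu i).1.le]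
    refine Finset.prod_congr rfl fun i _ => ?_
    rw [Set.indicator_of_mem (hu i), Pi.one_apply, one_mul]
  rw [h1]
  congr 1
  simp_rw [hfac, Finset.prod_mul_distrib]
  rw [← constK_mul_pow hα0 hα1, prod_prod_Ici_rpow (fun i => (hu i).1)]
  have h2 : ∏ i, u i ^ (((i : ℕ) + 1 : ℝ) * α - 1) =
      (∏ i, u i ^ (((i : ℕ) + 1 : ℝ) * α)) * ∏ i, (u i)⁻¹ := by
    rw [← Finset.prod_mul_distrib]
    refine Finset.prod_congr rfl fun i _ => ?_
    rw [Real.rpow_sub_one (hu i).1.ne', div_eq_mul_inv]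
  have h3 : ∏ _i : Fin n, t ^ (-α) = t ^ (-(n : ℝ) * α) := by
    rw [Finset.prod_const, Finset.card_univ, Fintype.card_fin, ← Real.rpow_natCast,
      ← Real.rpow_mul ht.le]
    congr 1; ring
  have h4 := (constK_pos hα0 hα1 n).ne'
  rw [h2, h3, Finset.prod_const, Finset.card_univ, Fintype.card_fin]
  change _ = _ * (_ * ∏ i, I i)
  field_simp

section Subordinator

variable {Ω : Type*} [MeasurableSpace Ω] {P : Measure Ω} [IsProbabilityMeasure P]
  {S : ℝ≥0 → Ω → ℝ} {m : ℕ} {Jt : ℕ → Ω → ℝ}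

theorem hasLaw_residualFraction (hα0 : 0 < α) (hα1 : α < 1) (hc : 0 < c)
    (hS : IsStableSubordinator S α c P) (hJt : IsSizeBiasedPermutation S (m + 1) Jt P)
    {g : ℕ → ℝ → ℝ} (hg : ∀ k, g (k + 1) = sumDensity α k) (n : ℕ) :
    HasLaw (fun ω => (residualSum S (m + 1) Jt n ω,
        fun i : Fin n => residualFraction S (m + 1) Jt (i + 1) ω))
      (volume.withDensity fun p => ENNReal.ofReal (densityTU α g (m + 1) n p)) P := by
  have hTm := fun n => measurable_residualSum hS hJt n
  have hm : Measurable fun ω => (residualSum S (m + 1) Jt n ω,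
      fun i : Fin n => residualFraction S (m + 1) Jt (i + 1) ω) :=
    (hTm n).prodMk (measurable_pi_iff.2 fun i => (hTm _).div (hTm _))
  refine ⟨hm.aemeasurable, ?_⟩
  set D : ℝ × (Fin n → ℝ) → ℝ≥0∞ := fun p => (m + 1).ascFactorial n *
    ENNReal.ofReal (sumDensity α (m + n) p.1) * ((Set.Ioi 0).indicator 1 p.1 *
      ratioWeight α n p.2 p.1) with hD
  have hDm : Measurable D := by
    have h1 : Measurable fun p : ℝ × (Fin n → ℝ) => (Set.Ioi 0).indicator (1 : ℝ → ℝ≥0∞) p.1 :=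
      (measurable_one.indicator measurableSet_Ioi).comp measurable_fst
    have h2 : Measurable fun p : ℝ × (Fin n → ℝ) => ratioWeight α n p.2 p.1 :=
      measurable_ratioWeight measurable_snd measurable_fst
    have h3 : Measurable fun p : ℝ × (Fin n → ℝ) => ((m + 1).ascFactorial n : ℝ≥0∞) *
      ENNReal.ofReal (sumDensity α (m + n) p.1) := by fun_prop
    exact h3.mul (h1.mul h2)
  have hdens : ∀ p, ENNReal.ofReal (densityTU α g (m + 1) n p) = D p := by
    rintro ⟨t, u⟩
    have h1 : g (m + 1 + n) = sumDensity α (m + n) := by rw [add_right_comm, hg]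
    rw [densityTU, hD]
    simp only
    by_cases hmem : 0 < t ∧ ∀ i, u i ∈ Set.Ioo (0 : ℝ) 1
    · rw [Set.indicator_of_mem (by exact hmem), Set.indicator_of_mem (by exact hmem.1),
        Pi.one_apply, one_mul, ratioWeight_eq hα0 hα1 hmem.2 hmem.1, ← ENNReal.ofReal_natCast,
        ← ENNReal.ofReal_mul (Nat.cast_nonneg _), ← ENNReal.ofReal_mul
        (mul_nonneg (Nat.cast_nonneg _) (sumDensity_nonneg _ _ _)), h1]
      congr 1
      ring
    · rw [Set.indicator_of_notMem (by exact hmem), ENNReal.ofReal_zero]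
      rw [not_and_or] at hmem
      rcases hmem with h | h
      · rw [Set.indicator_of_notMem (by exact h)]; simp
      · rw [ratioWeight_eq_zero h]; simp
  simp_rw [hdens]
  refine Measure.ext_of_lintegral _ fun F hF => ?_
  rw [lintegral_map hF hm, lintegral_withDensity_eq_lintegral_mul _ hDm hF, Measure.volume_eq_prod,
    lintegral_prod _ (hDm.mul hF).aemeasurable]
  have hF' : Measurable fun v : Fin (n + 1) → ℝ => F (v (Fin.last n), consecutiveRatio v) :=
    hF.comp (by fun_prop)
  have h1 := lintegral_residualSum hα0 hα1 hc hS hJt n hF'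
  refine Eq.trans h1 ?_
  have hL : Measurable fun v => jointDensity α m n v * F (v (Fin.last n), consecutiveRatio v) :=
    (measurable_jointDensity α m n).mul hF'
  rw [lintegral_snocR hL]
  set A : (Fin n → ℝ) → ℝ → ℝ≥0∞ := fun τ t => jointDensity α m n (snocR τ t) *
    F (snocR τ t (Fin.last n), consecutiveRatio (snocR τ t)) with hA
  have hAm : Measurable (Function.uncurry A) :=
    hL.comp (measurable_snocR measurable_fst measurable_snd)
  rw [lintegral_lintegral_swap hAm.aemeasurable]
  refine lintegral_congr_ae ?_
  -- The change of variables needs t > 0; for t ≤ 0 the density of the last sum vanishes.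
  filter_upwards [ae_sumDensity_eq_zero hα0 hα1 (m + n)] with t ht
  rcases lt_or_ge 0 t with h0 | h0
  · have e1 : ∀ τ, A τ t = ((m + 1).ascFactorial n * ENNReal.ofReal (sumDensity α (m + n) t)) *
        (chainWeight α n (snocR τ t) * F (t, consecutiveRatio (snocR τ t))) := fun τ => by
      simp only [hA, jointDensity, snocR_last, mul_assoc]
    have e2 : ∀ u, (D * F) (t, u) =
        ((m + 1).ascFactorial n * ENNReal.ofReal (sumDensity α (m + n) t)) *
        (ratioWeight α n u t * F (t, u)) := fun u => by
      rw [Pi.mul_apply, hD]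
      simp only
      rw [Set.indicator_of_mem (by exact h0), Pi.one_apply, one_mul, mul_assoc]
    rw [lintegral_congr e1, lintegral_congr e2, lintegral_const_mul' _ _ (by finiteness),
      lintegral_const_mul' _ _ (by finiteness), lintegral_chainWeight_consecutiveRatio
        (G := fun u => F (t, u)) (hF.comp measurable_prodMk_left) h0]
  · have e1 : ∀ τ, A τ t = 0 := fun τ => by
      simp only [hA, jointDensity, snocR_last, ht h0]; simp
    have e2 : ∀ u, (D * F) (t, u) = 0 := fun u => by
      rw [Pi.mul_apply, hD]
      simp [ht h0]
    rw [lintegral_congr e1, lintegral_congr e2]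

end Subordinator

end TrimmedStable

end

theorem proposition2p6 {Ω : Type*} [MeasurableSpace Ω] (P : Measure Ω) [IsProbabilityMeasure P]
    (α c : ℝ) (hα0 : 0 < α) (hα1 : α < 1) (hc : 0 < c)
    (S : ℝ≥0 → Ω → ℝ) (hS : TrimmedStable.IsStableSubordinator S α c P)
    (r : ℕ) (hr : 1 ≤ r)
    (Jt : ℕ → Ω → ℝ) (hJt : TrimmedStable.IsSizeBiasedPermutation S r Jt P)
    (g : ℕ → ℝ → ℝ) (hg : g = TrimmedStable.ratioSumDensity S P)
    (T : ℕ → Ω → ℝ) (hT : T = TrimmedStable.residualSum S r Jt)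
    (U : ℕ → Ω → ℝ) (hU : U = TrimmedStable.residualFraction S r Jt) :
    -- the sums of ratios have densities `g k`
    (∀ k, 1 ≤ k → HasLaw (TrimmedStable.ratioSum S k)
      (volume.withDensity (fun t => ENNReal.ofReal (g k t))) P) ∧
    -- (i)
    (∀ n : ℕ, HasLaw (fun ω (i : Fin (n + 1)) => T i ω)
      (volume.withDensity (fun t => ENNReal.ofReal (TrimmedStable.densityT α g r n t))) P) ∧
    -- (ii)
    (TrimmedStable.IsMarkovChain T P ∧
      (∀ n : ℕ, ∀ᵐ t ∂(P.map (T n)), condDistrib (T (n + 1)) (T n) P t =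
        volume.withDensity
          (fun s => ENNReal.ofReal (TrimmedStable.transitionDensity α g r n t s))) ∧
      ¬ TrimmedStable.IsTimeHomogeneous T P) ∧
    -- (iii)
    (∀ n : ℕ, HasLaw (fun ω => (T n ω, fun i : Fin n => U (i + 1) ω))
      (volume.withDensity (fun p => ENNReal.ofReal (TrimmedStable.densityTU α g r n p))) P) ∧
    (∀ n : ℕ, TrimmedStable.constK α n =
      Real.Gamma (n + 1) / (Real.Gamma (1 - α) ^ n * Real.Gamma (n * α + 1))) := by
  subst hg hT hU
  -- The reference laws count from 0, so r = m + 1 and g_{k+1} is `sumDensity α k`; g_0 plays no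
  -- part.
  obtain ⟨m, rfl⟩ := Nat.exists_eq_add_of_le' hr
  have hg : ∀ k, TrimmedStable.ratioSumDensity S P (k + 1) = TrimmedStable.sumDensity α k :=
    TrimmedStable.ratioSumDensity_eq hα0 hα1 hc hS
  refine ⟨fun k hk => ?_, TrimmedStable.hasLaw_residualSum hα0 hα1 hc hS hJt hg,
    ⟨TrimmedStable.isMarkovChain_residualSum hα0 hα1 hc hS hJt hg,
      TrimmedStable.condDistrib_residualSum hα0 hα1 hc hS hJt hg,
      TrimmedStable.not_isTimeHomogeneous_residualSum hα0 hα1 hc hS hJt⟩,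
    TrimmedStable.hasLaw_residualFraction hα0 hα1 hc hS hJt hg,
    TrimmedStable.constK_eq hα0 hα1⟩
  obtain ⟨k, rfl⟩ := Nat.exists_eq_add_of_le' hk
  refine ⟨(TrimmedStable.measurable_ratioSum hS _).aemeasurable, ?_⟩
  rw [TrimmedStable.map_ratioSum hα0 hα1 hc hS, hg]
  exact TrimmedStable.sumLaw_eq_withDensity hα0 hα1 k
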